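/- Let $D$ be a regular diagram of a link $L$. A $\mathbb{Z}$-coloring on $D$ is a map $\gamma:\{\text{arcs of } D\}\to\mathbb{Z}$ such that $2\gamma(a)=\gamma(b)+\gamma(c)$ at each crossing of $D$ with over arc $a$ and under arcs $b$ and $c$; it is trivial if it assigns the same integer to all the arcs. The link $L$ is $\mathbb{Z}$-colorable if some diagram of $L$ admits a non-trivial $\mathbb{Z}$-coloring, and then $\mathrm{mincol}_{\mathbb{Z}}(L)$ denotes the minimum of the number of colors $|\mathrm{Im}(\gamma)|$ over all non-trivial $\mathbb{Z}$-colorings $\gamma$ on all diagrams of $L$. The link $L$ is splittable if it is isotopic to the union of two non-empty links separated by a plane. **Theorem 5.3.** Let $L$ be a non-splittable link. If some diagram of $L$ admits a $\mathbb{Z}$-coloring $\gamma$ with exactly five colors, that is, $|\mathrm{Im}(\gamma)|=5$, then $\mathrm{mincol}_{\mathbb{Z}}(L)=4$. -/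

import Mathlib

namespace LinkColoring

/-!
# Link diagrams, links and `ℤ`-colorings

A regular (unoriented) link diagram in the plane, after a planar isotopy putting it in general
position with respect to the height function, is cut by horizontal lines into layers, each of which
contains exactly one local minimum, local maximum or crossing, all the other strands of the layer
being vertical.  A link diagram is recorded as the list of its layers, read from bottom to top.
Links are diagrams up to planar isotopy and the three Reidemeister moves.
-/

/-- The elementary pieces of a diagram.

* `cup`: a local minimum, at which two adjacent strands are born;
* `cap`: a local maximum, at which two adjacent strands are joined;
* `cross b`: a crossing of two adjacent strands.  If `b = true` the over strand is the one running
  from the lower left to the upper right; if `b = false` it is the one running from the lower right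
  to the upper left. -/
inductive Piece : Type
  | cup : Piece
  | cap : Piece
  | cross (b : Bool) : Piece

/-- Number of strands entering a piece from below. -/
def Piece.dom : Piece → ℕ
  | .cup => 0
  | .cap => 2
  | .cross _ => 2

/-- Number of strands leaving a piece at the top. -/
def Piece.cod : Piece → ℕ
  | .cup => 2
  | .cap => 0
  | .cross _ => 2

/-- A layer: a piece, together with the number of vertical strands to its left.  (The number of
vertical strands to its right is determined by the total number of strands.) -/
structure Layer : Type where
  left : ℕ
  piece : Piece

/-- `IsTangle w m n`: the layers of `w` can be stacked, in this order from bottom to top, on `m`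
strands, and `n` strands leave at the top. -/
def IsTangle : List Layer → ℕ → ℕ → Prop
  | [], m, n => m = n
  | l :: w, m, n =>
      l.left + l.piece.dom ≤ m ∧ IsTangle w (m - l.piece.dom + l.piece.cod) n

/-- The number of strands above the layers `w`, when stacked on `m` strands. -/
def strandsAfter : List Layer → ℕ → ℕ
  | [], m => m
  | l :: w, m => strandsAfter w (m - l.piece.dom + l.piece.cod)

theorem IsTangle.append {u v : List Layer} {m n k : ℕ} (hu : IsTangle u m n)
    (hv : IsTangle v n k) : IsTangle (u ++ v) m k := by
  induction u generalizing m with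
  | nil => cases hu; exact hv
  | cons l u ih => exact ⟨hu.1, ih hu.2⟩

/-- A link diagram: a list of layers that starts and ends with no strands. -/
structure Diagram : Type where
  word : List Layer
  closed : IsTangle word 0 0

namespace Diagram

/-! ### Arcs and crossings -/

/-- The number of strands of `D` at level `t`, i.e. on the horizontal line above the first `t`
layers. -/
def width (D : Diagram) (t : ℕ) : ℕ := strandsAfter (D.word.take t) 0

/-- The points at which `D` meets the horizontal lines between its layers: the point `(t, p)` is on
the strand number `p` (counted from the left, starting at `0`) at level `t`. -/
def Point (D : Diagram) : Type :=
  {x : ℕ × ℕ // x.1 ≤ D.word.length ∧ x.2 < D.width x.1}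

/-- Two points are joined directly, inside one layer, by a part of the diagram that is not
interrupted by an undercrossing.  The layer number `t` lies between the levels `t` and `t + 1`. -/
inductive Joins (w : List Layer) : ℕ × ℕ → ℕ × ℕ → Prop
  | left {t p : ℕ} {l : Layer} (h : w[t]? = some l) (hp : p < l.left) :
      Joins w (t, p) (t + 1, p)
  | right {t : ℕ} {l : Layer} (h : w[t]? = some l) (k : ℕ) :
      Joins w (t, l.left + l.piece.dom + k) (t + 1, l.left + l.piece.cod + k)
  | cup {t i : ℕ} (h : w[t]? = some ⟨i, .cup⟩) : Joins w (t + 1, i) (t + 1, i + 1)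
  | cap {t i : ℕ} (h : w[t]? = some ⟨i, .cap⟩) : Joins w (t, i) (t, i + 1)
  | overTrue {t i : ℕ} (h : w[t]? = some ⟨i, .cross true⟩) : Joins w (t, i) (t + 1, i + 1)
  | overFalse {t i : ℕ} (h : w[t]? = some ⟨i, .cross false⟩) : Joins w (t, i + 1) (t + 1, i)

/-- The arcs of a diagram: the pieces into which its curves are cut at the undercrossings (a closed
curve without undercrossings is one arc). -/
def Arc (D : Diagram) : Type :=
  Quot (fun x y : D.Point => Joins D.word x.1 y.1)

/-- The arc through a point. -/
def arc (D : Diagram) (x : D.Point) : D.Arc := Quot.mk _ x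

/-- `IsCrossing w x y z`: some layer is a crossing whose over strand passes through `x`, and whose
under strand enters at `y` and leaves at `z`. -/
inductive IsCrossing (w : List Layer) : ℕ × ℕ → ℕ × ℕ → ℕ × ℕ → Prop
  | crossTrue {t i : ℕ} (h : w[t]? = some ⟨i, .cross true⟩) :
      IsCrossing w (t, i) (t, i + 1) (t + 1, i)
  | crossFalse {t i : ℕ} (h : w[t]? = some ⟨i, .cross false⟩) :
      IsCrossing w (t, i + 1) (t, i) (t + 1, i + 1)

/-! ### `ℤ`-colorings -/

/-- A `ℤ`-coloring: a map from the arcs to `ℤ` with `2 γ(a) = γ(b) + γ(c)` at each crossing with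
over arc `a` and under arcs `b` and `c`. -/
def IsZColoring (D : Diagram) (γ : D.Arc → ℤ) : Prop :=
  ∀ x y z : D.Point, IsCrossing D.word x.1 y.1 z.1 →
    2 * γ (D.arc x) = γ (D.arc y) + γ (D.arc z)

/-- The same color is assigned to all the arcs. -/
def IsTrivial (D : Diagram) (γ : D.Arc → ℤ) : Prop := ∀ a b : D.Arc, γ a = γ b

/-! ### Equivalence of diagrams and links -/

/-- The local moves: the elementary planar isotopies of diagrams in general position with respect
to the height function, and the Reidemeister moves. -/
inductive LocalMove : List Layer → List Layer → Prop
  /-- Planar isotopy: two pieces next to each other exchange their heights. -/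
  | exchange (i k : ℕ) (g h : Piece) :
      LocalMove [⟨i, g⟩, ⟨i + g.cod + k, h⟩] [⟨i + g.dom + k, h⟩, ⟨i, g⟩]
  /-- Planar isotopy: a minimum and a maximum of a zigzag cancel. -/
  | zigzag (i : ℕ) : LocalMove [⟨i, .cup⟩, ⟨i + 1, .cap⟩] []
  /-- Planar isotopy: the mirror image zigzag. -/
  | zigzag' (i : ℕ) : LocalMove [⟨i + 1, .cup⟩, ⟨i, .cap⟩] []
  /-- Planar isotopy: a crossing is slid through a maximum. -/
  | slideCap (i : ℕ) (b : Bool) :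
      LocalMove [⟨i, .cross b⟩, ⟨i + 1, .cap⟩] [⟨i + 1, .cross (!b)⟩, ⟨i, .cap⟩]
  /-- Planar isotopy: a crossing is slid through a minimum. -/
  | slideCup (i : ℕ) (b : Bool) :
      LocalMove [⟨i + 1, .cup⟩, ⟨i, .cross b⟩] [⟨i, .cup⟩, ⟨i + 1, .cross (!b)⟩]
  /-- The first Reidemeister move, at a maximum. -/
  | reidemeister1Cap (i : ℕ) (b : Bool) : LocalMove [⟨i, .cross b⟩, ⟨i, .cap⟩] [⟨i, .cap⟩]
  /-- The first Reidemeister move, at a minimum. -/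
  | reidemeister1Cup (i : ℕ) (b : Bool) : LocalMove [⟨i, .cup⟩, ⟨i, .cross b⟩] [⟨i, .cup⟩]
  /-- The second Reidemeister move. -/
  | reidemeister2 (i : ℕ) (b : Bool) : LocalMove [⟨i, .cross b⟩, ⟨i, .cross (!b)⟩] []
  /-- The third Reidemeister move.  The side condition says that the three strands are at three
  different heights, i.e. that "being over" is not cyclic. -/
  | reidemeister3 (i : ℕ) (a b c : Bool) (h : a = b ∨ b = c) :
      LocalMove [⟨i, .cross a⟩, ⟨i + 1, .cross b⟩, ⟨i, .cross c⟩]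
        [⟨i + 1, .cross c⟩, ⟨i, .cross b⟩, ⟨i + 1, .cross a⟩]

/-- Two diagrams differ by one local move. -/
def Move (D E : Diagram) : Prop :=
  ∃ u x y v : List Layer, LocalMove x y ∧ D.word = u ++ x ++ v ∧ E.word = u ++ y ++ v

/-- The diagram consisting of `D` and, above it and separated from it by a horizontal line, `E`. -/
def stack (D E : Diagram) : Diagram := ⟨D.word ++ E.word, D.closed.append E.closed⟩

end Diagram

/-- A link (up to isotopy): a class of diagrams for the equivalence relation generated by the
moves. -/
def Link : Type := Quot Diagram.Move

/-- `D` is a diagram of the link `L`. -/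
def Diagram.Represents (D : Diagram) (L : Link) : Prop := Quot.mk Diagram.Move D = L

namespace Link

/-- A link is splittable if it has a diagram consisting of two non-empty link diagrams separated by
a line. -/
def IsSplittable (L : Link) : Prop :=
  ∃ D E : Diagram, D.word ≠ [] ∧ E.word ≠ [] ∧ (D.stack E).Represents L

/-- The numbers of colors of the non-trivial `ℤ`-colorings of the diagrams of `L`. -/
def colorNumbers (L : Link) : Set ℕ :=
  {k | ∃ D : Diagram, D.Represents L ∧ ∃ γ : D.Arc → ℤ,
    D.IsZColoring γ ∧ ¬ D.IsTrivial γ ∧ (Set.range γ).ncard = k}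

/-- The minimal coloring number of a `ℤ`-colorable link (and `0` if `L` is not `ℤ`-colorable). -/
noncomputable def mincol (L : Link) : ℕ := sInf L.colorNumbers

end Link

end LinkColoring

/-! Diagrams are handled as words of slices whose strands carry labels: colors, or colors with an
index that tells strands apart. Two facts drive the proof. First, in a non-splittable link a class
of strands that is respected by both strands of every crossing, and lies over its complement at
every mixed crossing, is empty or contains everything (`Rep.all_or_none`). Otherwise the braid
`sortWord` gathers the class on the left and turns the diagram into two separate ones
(`sort_chain`). In particular, every non-empty proper set of strands meets its complement at some
crossing (`Rep.exists_mixed`). Second, two crossings joined by a strand can be made neighbours by a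
planar isotopy (`hit_of_once`, `exists_adjacent`), so that only small tangles have to be rewritten.

Lower bound (`Colored.three_lt_card`). A crossing with distinct colors shows m - d, m and m + d. If
these were all the colors, m could occur at a crossing with distinct colors only as the over color.
The strands of color m would then lie over all the others, and the link would split. If no crossing
has distinct colors, any color class splits off.

Upper bound. Call the distance between the over and the under colors of a crossing its difference.
Given neighbouring crossings with differences 0 < δ₂ < δ₁, a strand can be pulled across so that the
crossing of difference δ₁ is replaced by crossings of smaller difference (`exists_lowers`).
Crossings of a single color may keep such a pair apart; `Labelled.surround` encloses them in
crossings of intermediate difference. By induction all non-zero differences become equal to one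
number d (`Colored.exists_uniform`).

Then the largest color M is, at any crossing not wholly of color M, an under color: the over color
there is M - d and the other under color M - 2d. A strand that attains M while passing under two
arcs of color M - d can instead run over them, back, and then under them; this uses colors no
smaller than M - 4d (`tangleEq_detour`). So M can be removed as long as the colors stay in an
interval [m, M] with m + 4d ≤ M (`exists_fewer`). In the end the colors lie among 4d consecutive
integers and are congruent modulo d, hence there are at most four of them. A coloring with five
colors provides the non-trivial coloring to start from. -/

namespace LinkColoring
open Diagram

/-! ### Tangle words up to moves -/

/-- Two words of layers, both from `m` to `n` strands, that differ by one local move. -/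
def TangleStep (m n : ℕ) (a b : List Layer) : Prop :=
  IsTangle a m n ∧ IsTangle b m n ∧
    ∃ u x y v : List Layer, LocalMove x y ∧ a = u ++ x ++ v ∧ b = u ++ y ++ v

/-- Isotopy of tangles from `m` to `n` strands. -/
def TangleEq (m n : ℕ) : List Layer → List Layer → Prop := Relation.EqvGen (TangleStep m n)

namespace TangleEq

theorem refl {m n : ℕ} (a : List Layer) : TangleEq m n a a :=
  Relation.EqvGen.refl a

theorem of_step {m n : ℕ} {a b : List Layer} (h : TangleStep m n a b) : TangleEq m n a b :=
  Relation.EqvGen.rel _ _ h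

theorem symm {m n : ℕ} {a b : List Layer} (h : TangleEq m n a b) : TangleEq m n b a :=
  Relation.EqvGen.symm _ _ h

theorem trans {m n : ℕ} {a b c : List Layer} (h : TangleEq m n a b) (h' : TangleEq m n b c) :
    TangleEq m n a c := Relation.EqvGen.trans _ _ _ h h'

theorem of_eq {m n : ℕ} {a b : List Layer} (h : a = b) : TangleEq m n a b := h ▸ refl a

theorem of_move {m n : ℕ} {x y : List Layer} (h : LocalMove x y) (hx : IsTangle x m n)
    (hy : IsTangle y m n) : TangleEq m n x y :=
  of_step ⟨hx, hy, [], x, y, [], h, by simp, by simp⟩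

theorem isTangle_iff {m n : ℕ} {a b : List Layer} (h : TangleEq m n a b) :
    IsTangle a m n ↔ IsTangle b m n := by
  induction h with
  | rel _ _ h => exact iff_of_true h.1 h.2.1
  | refl => rfl
  | symm _ _ _ ih => exact ih.symm
  | trans _ _ _ _ _ ih ih' => exact ih.trans ih'

theorem map {m n m' n' : ℕ} (f : List Layer → List Layer)
    (hf : ∀ a b, TangleStep m n a b → TangleEq m' n' (f a) (f b)) {a b : List Layer}
    (h : TangleEq m n a b) : TangleEq m' n' (f a) (f b) := by
  induction h with
  | rel _ _ h => exact hf _ _ h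
  | refl => exact refl _
  | symm _ _ _ ih => exact ih.symm
  | trans _ _ _ _ _ ih ih' => exact ih.trans ih'

theorem context {k l m n : ℕ} {u v a b : List Layer} (hu : IsTangle u k m) (hv : IsTangle v n l)
    (h : TangleEq m n a b) : TangleEq k l (u ++ a ++ v) (u ++ b ++ v) := by
  refine h.map (fun a => u ++ a ++ v) ?_
  rintro a b ⟨ha, hb, u', x, y, v', hxy, rfl, rfl⟩
  refine of_step ⟨(hu.append ha).append hv, (hu.append hb).append hv, u ++ u', x, y, v' ++ v,
    hxy, by simp, by simp⟩

theorem append_left {k m n : ℕ} {u a b : List Layer} (hu : IsTangle u k m)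
    (h : TangleEq m n a b) : TangleEq k n (u ++ a) (u ++ b) := by
  simpa using context hu (v := []) (l := n) rfl h

theorem append_right {m n l : ℕ} {v a b : List Layer} (hv : IsTangle v n l)
    (h : TangleEq m n a b) : TangleEq m l (a ++ v) (b ++ v) := by
  simpa using context (u := []) (k := m) rfl hv h

theorem cons {m n : ℕ} {l : Layer} {a b : List Layer} (hl : l.left + l.piece.dom ≤ m)
    (h : TangleEq (m - l.piece.dom + l.piece.cod) n a b) : TangleEq m n (l :: a) (l :: b) :=
  append_left (u := [l]) ⟨hl, rfl⟩ h

end TangleEq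

/-- Every intermediate word of the isotopy is itself closed, so each step is a `Move` between
diagrams and is an equality in the quotient. -/
theorem represents_of_tangleEq {D E : Diagram} {L : Link} (h : TangleEq 0 0 D.word E.word)
    (hD : D.Represents L) : E.Represents L := by
  have key : ∀ a b : List Layer, TangleEq 0 0 a b → ∀ (ha : IsTangle a 0 0) (hb : IsTangle b 0 0),
      Quot.mk Move (⟨a, ha⟩ : Diagram) = Quot.mk Move (⟨b, hb⟩ : Diagram) := by
    intro a b h
    induction h with
    | rel a b h =>
      intro ha hb
      obtain ⟨_, _, u, x, y, v, hxy, h1, h2⟩ := h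
      exact Quot.sound ⟨u, x, y, v, hxy, h1, h2⟩
    | refl => intro _ _; rfl
    | symm _ _ _ ih => intro ha hb; exact (ih hb ha).symm
    | trans a b c h _ ih ih' =>
      intro ha hc
      have hb : IsTangle b 0 0 := (TangleEq.isTangle_iff h).1 ha
      exact (ih ha hb).trans (ih' hb hc)
  exact (key _ _ h D.closed E.closed).symm.trans hD

/-- Adding `k` vertical strands on the left. -/
def shift (k : ℕ) (w : List Layer) : List Layer := w.map fun l => ⟨k + l.left, l.piece⟩

@[simp] theorem shift_nil (k : ℕ) : shift k [] = [] := rfl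

@[simp] theorem shift_cons (k : ℕ) (l : Layer) (w : List Layer) :
    shift k (l :: w) = ⟨k + l.left, l.piece⟩ :: shift k w := rfl

@[simp] theorem shift_append (k : ℕ) (u v : List Layer) :
    shift k (u ++ v) = shift k u ++ shift k v := by simp [shift]

@[simp] theorem shift_zero (w : List Layer) : shift 0 w = w := by simp [shift]

@[simp] theorem shift_shift (j k : ℕ) (w : List Layer) : shift j (shift k w) = shift (j + k) w := by
  simp [shift, add_assoc]

theorem IsTangle.shift {w : List Layer} {m n : ℕ} (h : IsTangle w m n) (k : ℕ) :
    IsTangle (shift k w) (k + m) (k + n) := by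
  induction w generalizing m with
  | nil => cases h; rfl
  | cons l w ih =>
    refine ⟨by have := h.1; simp only; omega, ?_⟩
    have := ih h.2
    change IsTangle (LinkColoring.shift k w) (k + m - l.piece.dom + l.piece.cod) _
    have e : k + m - l.piece.dom + l.piece.cod = k + (m - l.piece.dom + l.piece.cod) := by
      have := h.1; omega
    rw [e]; exact this

/-- Positions are counted from the left, so strands added on the right leave the word unchanged. -/
theorem IsTangle.widen {w : List Layer} {m n : ℕ} (h : IsTangle w m n) (k : ℕ) :
    IsTangle w (m + k) (n + k) := by
  induction w generalizing m with
  | nil => cases h; rfl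
  | cons l w ih =>
    refine ⟨by have := h.1; omega, ?_⟩
    have := ih h.2
    have e : m + k - l.piece.dom + l.piece.cod = (m - l.piece.dom + l.piece.cod) + k := by
      have := h.1; omega
    simpa [e] using this

theorem localMove_shift {x y : List Layer} (h : LocalMove x y) (k : ℕ) :
    LocalMove (shift k x) (shift k y) := by
  cases h with
  | exchange i j g h => simpa [add_assoc] using LocalMove.exchange (k + i) j g h
  | zigzag i => simpa [add_assoc] using LocalMove.zigzag (k + i)
  | zigzag' i => simpa [add_assoc] using LocalMove.zigzag' (k + i)
  | slideCap i b => simpa [add_assoc] using LocalMove.slideCap (k + i) b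
  | slideCup i b => simpa [add_assoc] using LocalMove.slideCup (k + i) b
  | reidemeister1Cap i b => simpa [add_assoc] using LocalMove.reidemeister1Cap (k + i) b
  | reidemeister1Cup i b => simpa [add_assoc] using LocalMove.reidemeister1Cup (k + i) b
  | reidemeister2 i b => simpa [add_assoc] using LocalMove.reidemeister2 (k + i) b
  | reidemeister3 i a b c h => simpa [add_assoc] using LocalMove.reidemeister3 (k + i) a b c h

theorem TangleEq.shift {m n : ℕ} {a b : List Layer} (h : TangleEq m n a b) (k : ℕ) :
    TangleEq (k + m) (k + n) (shift k a) (shift k b) := by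
  refine h.map (LinkColoring.shift k) ?_
  rintro a b ⟨ha, hb, u, x, y, v, hxy, rfl, rfl⟩
  exact .of_step ⟨ha.shift k, hb.shift k, LinkColoring.shift k u, _, _, LinkColoring.shift k v,
    localMove_shift hxy k, by simp, by simp⟩

theorem TangleEq.widen {m n : ℕ} {a b : List Layer} (h : TangleEq m n a b) (k : ℕ) :
    TangleEq (m + k) (n + k) a b := by
  refine h.map id ?_
  rintro a b ⟨ha, hb, u, x, y, v, hxy, rfl, rfl⟩
  exact .of_step ⟨ha.widen k, hb.widen k, _, _, _, _, hxy, rfl, rfl⟩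

/-! ### Reflection in a horizontal line -/

/-- The reflection of a piece in a horizontal line. -/
def Piece.flip : Piece → Piece
  | .cup => .cap
  | .cap => .cup
  | .cross b => .cross (!b)

@[simp] theorem Piece.dom_flip (p : Piece) : p.flip.dom = p.cod := by cases p <;> rfl
@[simp] theorem Piece.cod_flip (p : Piece) : p.flip.cod = p.dom := by cases p <;> rfl

/-- The reflection of a word of layers in a horizontal line. -/
def flipWord (w : List Layer) : List Layer := (w.map fun l => ⟨l.left, l.piece.flip⟩).reverse

theorem flipWord_append (u v : List Layer) : flipWord (u ++ v) = flipWord v ++ flipWord u := by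
  simp [flipWord]

theorem IsTangle.flip {w : List Layer} {m n : ℕ} (h : IsTangle w m n) :
    IsTangle (flipWord w) n m := by
  induction w generalizing m with
  | nil => cases h; rfl
  | cons l w ih =>
    have h1 := h.1
    rw [show l :: w = [l] ++ w from rfl, flipWord_append]
    refine (ih h.2).append ?_
    simp only [flipWord, List.map_cons, List.map_nil, List.reverse_singleton, IsTangle,
      Piece.dom_flip, Piece.cod_flip]
    omega

/-- The disjunction is needed for `exchange`, the one move whose reflection runs in the opposite
direction. -/
theorem localMove_flip {x y : List Layer} (h : LocalMove x y) :
    LocalMove (flipWord x) (flipWord y) ∨ LocalMove (flipWord y) (flipWord x) := by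
  cases h with
  | exchange i k g h => right; simpa [flipWord] using LocalMove.exchange i k g.flip h.flip
  | zigzag i => left; exact LocalMove.zigzag' i
  | zigzag' i => left; exact LocalMove.zigzag i
  | slideCap i b => left; exact LocalMove.slideCup i (!b)
  | slideCup i b => left; exact LocalMove.slideCap i (!b)
  | reidemeister1Cap i b => left; exact LocalMove.reidemeister1Cup i (!b)
  | reidemeister1Cup i b => left; exact LocalMove.reidemeister1Cap i (!b)
  | reidemeister2 i b => left; simpa [flipWord, Piece.flip] using LocalMove.reidemeister2 i b
  | reidemeister3 i a b c h =>
    left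
    simpa [flipWord, Piece.flip] using
      LocalMove.reidemeister3 i (!c) (!b) (!a) (by rcases h with rfl | rfl <;> simp)

theorem TangleEq.flip {m n : ℕ} {a b : List Layer} (h : TangleEq m n a b) :
    TangleEq n m (flipWord a) (flipWord b) := by
  refine h.map flipWord ?_
  rintro a b ⟨ha, hb, u, x, y, v, hxy, rfl, rfl⟩
  rcases localMove_flip hxy with h | h
  · exact .of_step ⟨ha.flip, hb.flip, _, _, _, _, h, by simp only [flipWord_append, List.append_assoc]; rfl,
      by simp only [flipWord_append, List.append_assoc]⟩
  · exact .symm (.of_step ⟨hb.flip, ha.flip, _, _, _, _, h,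
      by simp only [flipWord_append, List.append_assoc]; rfl,
      by simp only [flipWord_append, List.append_assoc]⟩)

/-! ### Distant layers commute -/

/-- The piece `g` lies to the left of all of `w`, so repeated `exchange` carries it to the top; only
the shift of `w` feels whether `g` is below or above. -/
theorem layer_comm_shift (i : ℕ) (g : Piece) {w : List Layer} {m n : ℕ} (h : IsTangle w m n) :
    TangleEq (i + g.dom + m) (i + g.cod + n) (⟨i, g⟩ :: shift (i + g.cod) w)
      (shift (i + g.dom) w ++ [⟨i, g⟩]) := by
  induction w generalizing m with
  | nil => cases h; exact .refl _
  | cons l w ih =>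
    have h1 := h.1
    have step : TangleEq (i + g.dom + m) (i + g.cod + (m - l.piece.dom + l.piece.cod))
        [⟨i, g⟩, ⟨i + g.cod + l.left, l.piece⟩] [⟨i + g.dom + l.left, l.piece⟩, ⟨i, g⟩] := by
      refine .of_move (.exchange _ _ _ _) ?_ ?_ <;> simp only [IsTangle] <;> omega
    have s1 := TangleEq.append_right (h.2.shift (i + g.cod)) step
    refine TangleEq.trans (by simpa using s1) ?_
    have s2 := ih h.2
    have := TangleEq.cons (m := i + g.dom + m) (l := ⟨i + g.dom + l.left, l.piece⟩)
      (by simp only; omega) (a := ⟨i, g⟩ :: shift (i + g.cod) w)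
      (b := shift (i + g.dom) w ++ [⟨i, g⟩]) (n := i + g.cod + n) (by
        have e : i + g.dom + m - l.piece.dom + l.piece.cod
          = i + g.dom + (m - l.piece.dom + l.piece.cod) := by omega
        simpa [e] using s2)
    simpa using this

/-- The companion for a piece to the right of `w`: here the position of the piece changes, with the
width of `w`. -/
theorem layer_comm_word (i r : ℕ) (h : Piece) {w : List Layer} {m n : ℕ} (hw : IsTangle w m n) :
    TangleEq (m + i + h.dom + r) (n + i + h.cod + r) (⟨m + i, h⟩ :: w)
      (w ++ [⟨n + i, h⟩]) := by
  induction w generalizing m with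
  | nil => cases hw; exact .refl _
  | cons l w ih =>
    have h1 := hw.1
    obtain ⟨k, hk⟩ := Nat.exists_eq_add_of_le h1
    have step : TangleEq (m + i + h.dom + r) (m - l.piece.dom + l.piece.cod + i + h.cod + r)
        [⟨m + i, h⟩, l] [l, ⟨m - l.piece.dom + l.piece.cod + i, h⟩] := by
      have := LocalMove.exchange l.left (k + i) l.piece h
      rw [show l.left + l.piece.cod + (k + i) = m - l.piece.dom + l.piece.cod + i by omega,
        show l.left + l.piece.dom + (k + i) = m + i by omega] at this
      refine (TangleEq.of_move this ?_ ?_).symm <;> simp only [IsTangle] <;> omega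
    have t := (hw.2.widen (i + h.cod + r))
    have s1 := TangleEq.append_right (l := n + i + h.cod + r) (v := w)
      (by simpa [add_assoc] using t) step
    refine TangleEq.trans (by simpa using s1) ?_
    refine TangleEq.cons (by omega) ?_
    have e : m + i + h.dom + r - l.piece.dom + l.piece.cod
      = m - l.piece.dom + l.piece.cod + i + h.dom + r := by omega
    rw [e]
    exact ih hw.2

end LinkColoring

namespace LinkColoring
open Diagram

/-! ### Labelled words -/

/-- A crossing with labels on its four ends: bottom left, bottom right, top left, top right. -/
structure Crs (S : Type*) where
  b : Bool
  bl : S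
  br : S
  tl : S
  tr : S

@[simp] theorem Piece.dom_cross (b : Bool) : (Piece.cross b).dom = 2 := rfl
@[simp] theorem Piece.cod_cross (b : Bool) : (Piece.cross b).cod = 2 := rfl
@[simp] theorem Piece.dom_cup : Piece.cup.dom = 0 := rfl
@[simp] theorem Piece.cod_cup : Piece.cup.cod = 2 := rfl
@[simp] theorem Piece.dom_cap : Piece.cap.dom = 2 := rfl
@[simp] theorem Piece.cod_cap : Piece.cap.cod = 0 := rfl

/-- A piece with labelled strands. -/
inductive LPiece (S : Type*)
  | cup (s : S)
  | cap (s : S)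
  | cross (c : Crs S)

/-- The labels of the strands entering from below. -/
def LPiece.bot {S : Type*} : LPiece S → List S
  | .cup _ => []
  | .cap s => [s, s]
  | .cross c => [c.bl, c.br]

/-- The labels of the strands leaving at the top. -/
def LPiece.top {S : Type*} : LPiece S → List S
  | .cup s => [s, s]
  | .cap _ => []
  | .cross c => [c.tl, c.tr]

/-- The underlying piece. -/
def LPiece.toPiece {S : Type*} : LPiece S → Piece
  | .cup _ => .cup
  | .cap _ => .cap
  | .cross c => .cross c.b

@[simp] theorem LPiece.length_bot {S : Type*} (p : LPiece S) : p.bot.length = p.toPiece.dom := by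
  cases p <;> rfl
@[simp] theorem LPiece.length_top {S : Type*} (p : LPiece S) : p.top.length = p.toPiece.cod := by
  cases p <;> rfl

/-- A layer with labelled strands. -/
structure Slice (S : Type*) where
  lft : List S
  pc : LPiece S
  rgt : List S

namespace Slice
variable {S : Type*}

/-- The labels below a slice. -/
def bot (s : Slice S) : List S := s.lft ++ (s.pc.bot ++ s.rgt)

/-- The labels above a slice. -/
def top (s : Slice S) : List S := s.lft ++ (s.pc.top ++ s.rgt)

/-- The underlying layer. -/
def layer (s : Slice S) : Layer := ⟨s.lft.length, s.pc.toPiece⟩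

end Slice

/-- The underlying word of layers. -/
def erase {S : Type*} (w : List (Slice S)) : List Layer := w.map Slice.layer

/-- The slices of `w` fit together, from the labels `m` to the labels `n`. -/
def Chain {S : Type*} : List (Slice S) → List S → List S → Prop
  | [], m, n => m = n
  | s :: w, m, n => s.bot = m ∧ Chain w s.top n

section Basic
variable {S : Type*}

@[simp] theorem erase_nil : erase ([] : List (Slice S)) = [] := rfl
@[simp] theorem erase_cons (s : Slice S) (w : List (Slice S)) :
    erase (s :: w) = s.layer :: erase w := rfl
@[simp] theorem erase_append (u v : List (Slice S)) : erase (u ++ v) = erase u ++ erase v := by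
  simp [erase]

theorem chain_append {u v : List (Slice S)} {m n : List S} :
    Chain (u ++ v) m n ↔ ∃ k, Chain u m k ∧ Chain v k n := by
  induction u generalizing m with
  | nil => simp [Chain]
  | cons l u ih => simp [Chain, ih, and_assoc]

theorem Chain.isTangle {w : List (Slice S)} {m n : List S} (h : Chain w m n) :
    IsTangle (erase w) m.length n.length := by
  induction w generalizing m with
  | nil => cases h; rfl
  | cons s w ih =>
    obtain ⟨rfl, h2⟩ := h
    refine ⟨by simp [Slice.bot, Slice.layer], ?_⟩
    have e : s.bot.length - s.layer.piece.dom + s.layer.piece.cod = s.top.length := by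
      simp only [Slice.bot, Slice.top, Slice.layer, List.length_append, LPiece.length_bot,
        LPiece.length_top]
      omega
    rw [e]
    exact ih h2

end Basic

/-! ### Sorting the strands of a word -/

/-- A strand passes from the left under `a` strands. -/
def pass : ℕ → List Layer
  | 0 => []
  | a + 1 => ⟨0, .cross false⟩ :: shift 1 (pass a)

theorem isTangle_pass (a : ℕ) : IsTangle (pass a) (1 + a) (1 + a) := by
  induction a with
  | zero => rfl
  | succ a ih =>
    refine ⟨by simp [Piece.dom_cross]; omega, ?_⟩
    have := ih.shift 1
    convert this using 1 <;> simp [Piece.dom_cross, Piece.cod_cross] <;> omega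

theorem pass_add (a c : ℕ) : pass (a + c) = pass a ++ shift a (pass c) := by
  induction a with
  | zero => simp [pass]
  | succ a ih => rw [show a + 1 + c = a + c + 1 by omega]; simp only [pass, ih, shift_append, shift_shift, add_comm 1 a, List.cons_append]

/-- `c` parallel strands pass from the right over a strand. -/
def under : ℕ → List Layer
  | 0 => []
  | c + 1 => ⟨c, .cross false⟩ :: under c

/-- `c` strands pass from the left under `a` strands. -/
def passes (c : ℕ) : ℕ → List Layer
  | 0 => []
  | a + 1 => under c ++ shift 1 (passes c a)

theorem isTangle_under (c : ℕ) : IsTangle (under c) (c + 1) (c + 1) := by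
  induction c with
  | zero => rfl
  | succ c ih =>
    refine ⟨by simp [Piece.dom_cross], ?_⟩
    simpa [Piece.dom_cross, Piece.cod_cross] using ih.widen 1

theorem isTangle_passes (c a : ℕ) : IsTangle (passes c a) (c + a) (c + a) := by
  induction a with
  | zero => rfl
  | succ a ih =>
    refine IsTangle.append (n := c + (a + 1)) ?_ ?_
    · have := (isTangle_under c).widen a
      rwa [show c + 1 + a = c + (a + 1) by omega] at this
    · have := ih.shift 1
      rwa [show 1 + (c + a) = c + (a + 1) by omega] at this

/-- A strand that is below everything slides past any piece: by the second Reidemeister move at a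
minimum or maximum, by the third at a crossing, which may be of either type. -/
theorem under_piece (g : Piece) :
    TangleEq (1 + g.dom) (1 + g.cod) (⟨1, g⟩ :: pass g.cod) (pass g.dom ++ [⟨0, g⟩]) := by
  cases g with
  | cup =>
    have h1 : TangleEq 1 3 [⟨1, .cup⟩, ⟨0, .cross false⟩] [⟨0, .cup⟩, ⟨1, .cross true⟩] :=
      .of_move (LocalMove.slideCup 0 false) (by simp [IsTangle])
        (by simp [IsTangle])
    have h2 : TangleEq 3 3 [⟨1, .cross true⟩, ⟨1, .cross false⟩] [] :=
      .of_move (LocalMove.reidemeister2 1 true) (by simp [IsTangle])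
        (by simp [IsTangle])
    exact (h1.append_right (v := [⟨1, .cross false⟩]) (l := 3)
      (by simp [IsTangle])).trans (h2.append_left (u := [⟨0, .cup⟩]) (k := 1)
      (by simp [IsTangle]))
  | cap =>
    have h1 : TangleEq 3 1 [⟨0, .cross true⟩, ⟨1, .cap⟩] [⟨1, .cross false⟩, ⟨0, .cap⟩] :=
      .of_move (LocalMove.slideCap 0 true) (by simp [IsTangle])
        (by simp [IsTangle])
    have h2 : TangleEq 3 3 [⟨0, .cross false⟩, ⟨0, .cross true⟩] [] :=
      .of_move (LocalMove.reidemeister2 0 false) (by simp [IsTangle])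
        (by simp [IsTangle])
    exact (h2.append_right (v := [⟨1, .cap⟩]) (l := 1)
      (by simp [IsTangle])).symm.trans
      (h1.append_left (u := [⟨0, .cross false⟩]) (k := 3)
      (by simp [IsTangle]))
  | cross b =>
    exact TangleEq.symm (.of_move (LocalMove.reidemeister3 0 false false b (.inl rfl))
      (by simp [IsTangle, pass]) (by simp [IsTangle, pass]))

/-- The same for a strand that passes leftwards above everything. -/
theorem over_piece (g : Piece) :
    TangleEq (g.dom + 1) (g.cod + 1) (⟨0, g⟩ :: under g.cod) (under g.dom ++ [⟨1, g⟩]) := by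
  cases g with
  | cup =>
    have h1 : TangleEq 1 3 [⟨1, .cup⟩, ⟨0, .cross true⟩] [⟨0, .cup⟩, ⟨1, .cross false⟩] :=
      .of_move (LocalMove.slideCup 0 true) (by simp [IsTangle])
        (by simp [IsTangle])
    have h2 : TangleEq 3 3 [⟨0, .cross true⟩, ⟨0, .cross false⟩] [] :=
      .of_move (LocalMove.reidemeister2 0 true) (by simp [IsTangle])
        (by simp [IsTangle])
    exact (h1.append_right (v := [⟨0, .cross false⟩]) (l := 3)
      (by simp [IsTangle])).symm.trans
      (h2.append_left (u := [⟨1, .cup⟩]) (k := 1) (by simp [IsTangle]))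
  | cap =>
    have h1 : TangleEq 3 1 [⟨0, .cross false⟩, ⟨1, .cap⟩] [⟨1, .cross true⟩, ⟨0, .cap⟩] :=
      .of_move (LocalMove.slideCap 0 false) (by simp [IsTangle])
        (by simp [IsTangle])
    have h2 : TangleEq 3 3 [⟨1, .cross false⟩, ⟨1, .cross true⟩] [] :=
      .of_move (LocalMove.reidemeister2 1 false) (by simp [IsTangle])
        (by simp [IsTangle])
    exact (h2.append_right (v := [⟨0, .cap⟩]) (l := 1)
      (by simp [IsTangle])).symm.trans
      (h1.append_left (u := [⟨1, .cross false⟩]) (k := 3)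
      (by simp [IsTangle])).symm
  | cross b =>
    exact .of_move (LocalMove.reidemeister3 0 b false false (.inr rfl))
      (by simp [IsTangle, under]) (by simp [IsTangle, under])

/-- Induction on the number of strands to the left of the piece: the first crossing of `pass` is far
from the piece and commutes with it, until the passing strand reaches the piece and `under_piece`
applies. -/
theorem pass_piece (j r : ℕ) (g : Piece) :
    TangleEq (1 + (j + g.dom + r)) (1 + (j + g.cod + r)) (⟨1 + j, g⟩ :: pass (j + g.cod + r))
      (pass (j + g.dom + r) ++ [⟨j, g⟩]) := by
  induction j with
  | zero =>
    simp only [zero_add, add_zero, pass_add]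
    have h1 := (under_piece g).widen r
    have h2 := layer_comm_shift 0 g (isTangle_pass r)
    have t2 : IsTangle (shift g.cod (pass r)) (1 + g.cod + r) (1 + (g.cod + r)) := by
      have := (isTangle_pass r).shift g.cod
      convert this using 1 <;> omega
    have t1 : IsTangle (pass g.dom) (1 + (g.dom + r)) (1 + g.dom + r) := by
      have := (isTangle_pass g.dom).widen r
      convert this using 1 <;> omega
    have h1' := h1.append_right t2
    have h2' : TangleEq (1 + g.dom + r) (1 + (g.cod + r)) (⟨0, g⟩ :: shift g.cod (pass r))
      (shift g.dom (pass r) ++ [⟨0, g⟩]) := by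
      convert h2 using 1 <;> simp <;> omega
    have h3' := h2'.append_left t1
    rw [← add_assoc] at h3' ⊢
    refine TangleEq.trans ?_ (by simpa using h3')
    simpa using h1'
  | succ j ih =>
    have e : ∀ c, j + 1 + c + r = j + c + r + 1 := by intro c; omega
    simp only [e, pass]
    have step : TangleEq (1 + (j + g.dom + r + 1)) (1 + (j + g.cod + r + 1))
        [⟨0, .cross false⟩, ⟨0 + Piece.cod (.cross false) + j, g⟩]
        [⟨0 + Piece.dom (.cross false) + j, g⟩, ⟨0, .cross false⟩] := by
      refine .of_move (.exchange 0 j (.cross false) g) ?_ ?_ <;>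
        simp only [IsTangle, Piece.dom_cross, Piece.cod_cross] <;> omega
    have h1 := step.symm.append_right (v := shift 1 (pass (j + g.cod + r)))
      (l := 1 + (j + g.cod + r + 1)) (by
        have := (isTangle_pass (j + g.cod + r)).shift 1
        convert this using 1 <;> omega)
    simp only [Piece.dom_cross, Piece.cod_cross, List.cons_append, List.nil_append] at h1
    rw [show 0 + 2 + j = 1 + (j + 1) by omega] at h1
    refine h1.trans ?_
    simp only [List.cons_append]
    refine TangleEq.cons (by simp only [Piece.dom_cross]; omega) ?_
    have h2 := ih.shift 1
    simp only [Piece.dom_cross, Piece.cod_cross, shift_append, shift_cons, shift_nil] at h2 ⊢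
    rw [show 1 + (1 + j) = 1 + (j + 1) by omega] at h2
    rw [show j + 1 = 1 + j by omega] at h2 ⊢
    convert h2 using 1 <;> omega

theorem passes_piece (a : ℕ) (g : Piece) :
    TangleEq (g.dom + a) (g.cod + a) (⟨0, g⟩ :: passes g.cod a) (passes g.dom a ++ [⟨a, g⟩]) := by
  induction a with
  | zero => exact .refl _
  | succ a ih =>
    simp only [passes]
    have h1 := ((over_piece g).widen a).append_right (v := shift 1 (passes g.cod a))
      (l := g.cod + (a + 1)) (by
        have := (isTangle_passes g.cod a).shift 1
        convert this using 1 <;> omega)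
    have h2 := (ih.shift 1).append_left (u := under g.dom) (k := g.dom + (a + 1)) (by
        have := (isTangle_under g.dom).widen a
        convert this using 1 <;> omega)
    rw [show g.dom + 1 + a = g.dom + (a + 1) by omega] at h1
    rw [show 1 + (g.cod + a) = g.cod + (a + 1) by omega] at h2
    refine TangleEq.trans (by simpa using h1) ?_
    simpa [add_comm] using h2

/-- `sortWord` moves strands one at a time, whereas a piece needs its two strands to travel
together; the two braids differ only by the order of distant crossings. -/
theorem passes_two (a : ℕ) :
    TangleEq (2 + a) (2 + a) (shift 1 (pass a) ++ pass a) (passes 2 a) := by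
  induction a with
  | zero => exact .refl _
  | succ a ih =>
    simp only [pass, passes, under, shift_cons, shift_shift, List.cons_append, List.nil_append]
    refine TangleEq.cons (by simp only [Piece.dom_cross]; omega) ?_
    have h1 := layer_comm_shift 0 (.cross false) (isTangle_pass a)
    have h2 := h1.symm.append_right (v := shift 1 (pass a)) (l := 0 + 2 + (1 + a)) (by
      have := ((isTangle_pass a).shift 1).widen 1
      simp only [Piece.cod_cross]
      convert this using 1 <;> omega)
    simp only [Piece.dom_cross, Piece.cod_cross, zero_add, List.append_assoc, List.cons_append,
      List.nil_append] at h2 ⊢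
    rw [show 2 + (a + 1) - 2 + 2 = 2 + (1 + a) by omega, show 2 + (a + 1) = 2 + (1 + a) by omega]
    refine h2.trans (TangleEq.cons (by simp only [Piece.dom_cross]; omega) ?_)
    have h3 := ih.shift 1
    simp only [shift_append, shift_shift, Piece.dom_cross, Piece.cod_cross] at h3 ⊢
    convert h3 using 1 <;> omega

/-- The braid that moves all strands marked `true` to the left, over the other strands. -/
def sortWord : List Bool → List Layer
  | [] => []
  | true :: m => shift 1 (sortWord m)
  | false :: m => shift 1 (sortWord m) ++ pass (m.count true)

theorem isTangle_sortWord (m : List Bool) : IsTangle (sortWord m) m.length m.length := by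
  induction m with
  | nil => rfl
  | cons x m ih =>
    have h := ih.shift 1
    rw [add_comm] at h
    cases x with
    | true => exact h
    | false =>
      refine IsTangle.append h ?_
      have := (isTangle_pass (m.count true)).widen (m.length - m.count true)
      have hc := List.count_le_length (a := true) (l := m)
      simp only [List.length_cons]
      convert this using 1 <;> omega

end LinkColoring

/-! ### Sorting a word whose strands form an upper and a lower class -/

namespace LinkColoring
open Diagram

/-- Crossings of a word whose strands are divided into two classes, the first one (`A`) being
always over the second one. -/
def Crs.Splits {S : Type*} (A : S → Prop) (c : Crs S) : Prop :=
  (A c.bl ↔ A c.tr) ∧ (A c.br ↔ A c.tl) ∧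
    ((c.b = true → A c.br → A c.bl) ∧ (c.b = false → A c.bl → A c.br))

/-- The crossings of a word. -/
def crs {S : Type*} : List (Slice S) → List (Crs S)
  | [] => []
  | ⟨_, .cross c, _⟩ :: w => c :: crs w
  | ⟨_, .cup _, _⟩ :: w => crs w
  | ⟨_, .cap _, _⟩ :: w => crs w

section
variable {S : Type*}
@[simp] theorem crs_nil : crs ([] : List (Slice S)) = [] := rfl
@[simp] theorem crs_cross (x y : List S) (c : Crs S) (w : List (Slice S)) :
    crs (⟨x, .cross c, y⟩ :: w) = c :: crs w := rfl
@[simp] theorem crs_cup (x y : List S) (s : S) (w : List (Slice S)) :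
    crs (⟨x, .cup s, y⟩ :: w) = crs w := rfl
@[simp] theorem crs_cap (x y : List S) (s : S) (w : List (Slice S)) :
    crs (⟨x, .cap s, y⟩ :: w) = crs w := rfl
@[simp] theorem crs_append (u v : List (Slice S)) : crs (u ++ v) = crs u ++ crs v := by
  induction u with
  | nil => rfl
  | cons s u ih => obtain ⟨x, p, y⟩ := s; cases p <;> simp [ih]

theorem mem_crs {c : Crs S} {w : List (Slice S)} :
    c ∈ crs w ↔ ∃ u x y v, w = u ++ ⟨x, .cross c, y⟩ :: v := by
  constructor
  · intro h
    induction w with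
    | nil => simp at h
    | cons s w ih =>
      have key : c ∈ crs w → ∃ u x y v, s :: w = u ++ ⟨x, .cross c, y⟩ :: v := by
        intro h
        obtain ⟨u, x, y, v, rfl⟩ := ih h
        exact ⟨s :: u, x, y, v, rfl⟩
      obtain ⟨x, p, y⟩ := s
      cases p with
      | cup s => exact key h
      | cap s => exact key h
      | cross c' =>
        rcases List.mem_cons.1 h with rfl | h
        · exact ⟨[], x, y, w, rfl⟩
        · exact key h
  · rintro ⟨u, x, y, v, rfl⟩
    simp
end

/-- The sorted form of a slice. -/
def sortedLayer (s : Slice Bool) : List Layer :=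
  match s.pc.bot ++ s.pc.top with
  | true :: true :: _ => [⟨s.lft.count true, s.pc.toPiece⟩]
  | false :: false :: _ => [⟨s.lft.count true + s.rgt.count true + s.lft.count false, s.pc.toPiece⟩]
  | _ => []

/-- The crossings of a slice split. -/
def Slice.Splits (s : Slice Bool) : Prop := ∀ c, s.pc = .cross c → c.Splits (· = true)

theorem length_eq_count (m : List Bool) : m.length = m.count true + m.count false :=
  (List.count_true_add_count_false m).symm

theorem Crs.Splits.eq {c : Crs Bool} (h : c.Splits (· = true)) :
    c.tl = c.br ∧ c.tr = c.bl ∧ (c.bl = c.br ∨ c.bl = c.b ∧ c.br = !c.b) := by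
  obtain ⟨b, bl, br, tl, tr⟩ := c
  obtain ⟨h1, h2, h3, h4⟩ := h
  dsimp only at *
  revert h1 h2 h3 h4
  revert b bl br tl tr
  decide

theorem sort_true (ys : List Bool) (p : LPiece Bool)
    (hb : p.bot = List.replicate p.toPiece.dom true)
    (ht : p.top = List.replicate p.toPiece.cod true) :
    TangleEq (p.toPiece.dom + ys.length) (p.toPiece.cod + ys.length)
      (⟨0, p.toPiece⟩ :: sortWord (p.top ++ ys)) (sortWord (p.bot ++ ys) ++ [⟨0, p.toPiece⟩]) := by
  have key : ∀ k, sortWord (List.replicate k true ++ ys) = shift k (sortWord ys) := by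
    intro k
    induction k with
    | zero => simp
    | succ k ih => simp [List.replicate_succ, sortWord, ih, add_comm]
  rw [hb, ht, key, key]
  simpa using layer_comm_shift 0 p.toPiece (isTangle_sortWord ys)

/-- The strands of the piece travel together under the `true` strands of `ys`, and the piece follows
them by `passes_piece`. -/
theorem sort_false (ys : List Bool) (p : LPiece Bool)
    (hb : p.bot = List.replicate p.toPiece.dom false)
    (ht : p.top = List.replicate p.toPiece.cod false) :
    TangleEq (p.toPiece.dom + ys.length) (p.toPiece.cod + ys.length)
      (⟨0, p.toPiece⟩ :: sortWord (p.top ++ ys))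
      (sortWord (p.bot ++ ys) ++ [⟨ys.count true, p.toPiece⟩]) := by
  have key : ∀ k, k = 0 ∨ k = 2 → TangleEq (k + ys.length) (k + ys.length)
      (sortWord (List.replicate k false ++ ys))
      (shift k (sortWord ys) ++ passes k (ys.count true)) := by
    rintro k (rfl | rfl)
    · have : ∀ a, passes 0 a = [] := by
        intro a
        induction a with
        | zero => rfl
        | succ a ih => simp [passes, under, ih]
      rw [this]
      simpa using TangleEq.refl _
    · have h := ((passes_two (ys.count true)).widen (ys.count false)).append_left
        (u := shift 2 (sortWord ys)) (k := 2 + ys.length) (by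
          have e := length_eq_count ys
          have := (isTangle_sortWord ys).shift 2
          convert this using 1; omega)
      rw [add_assoc, ← length_eq_count] at h
      simpa [sortWord] using h
  have hd : ∀ p : Piece, p.dom = 0 ∨ p.dom = 2 := by intro p; cases p <;> simp
  have hc : ∀ p : Piece, p.cod = 0 ∨ p.cod = 2 := by intro p; cases p <;> simp
  rw [hb, ht]
  have h1 := TangleEq.append_left (u := [⟨0, p.toPiece⟩]) (k := p.toPiece.dom + ys.length)
    ⟨by simp, by simp [IsTangle]; omega⟩ (key _ (hc p.toPiece))
  have h2 := (layer_comm_shift 0 p.toPiece (isTangle_sortWord ys)).append_right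
    (v := passes p.toPiece.cod (ys.count true)) (l := p.toPiece.cod + ys.length) (by
      have e := length_eq_count ys
      have := (isTangle_passes p.toPiece.cod (ys.count true)).widen (ys.count false)
      convert this using 1 <;> omega)
  have h3 := ((passes_piece (ys.count true) p.toPiece).widen (ys.count false)).append_left
    (u := shift p.toPiece.dom (sortWord ys)) (k := p.toPiece.dom + ys.length) (by
      have e := length_eq_count ys
      have := (isTangle_sortWord ys).shift p.toPiece.dom
      convert this using 1; omega)
  rw [add_assoc p.toPiece.cod, ← length_eq_count] at h3
  have h4 := (key _ (hd p.toPiece)).append_right (v := [⟨ys.count true, p.toPiece⟩])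
    (l := p.toPiece.cod + ys.length) ⟨by
      have := length_eq_count ys
      simp only; omega, by
      simp only [IsTangle]; omega⟩
  refine h1.trans (TangleEq.trans ?_ h4.symm)
  refine TangleEq.trans ?_ (by simpa using h3)
  simpa using h2

/-- The sorting braid absorbs a mixed crossing, because the `true` strand is over in both. If the
crossing moves the `true` strand to the right, it cancels against the first sorting crossing by a
second Reidemeister move; if it moves it to the left, it is itself a sorting crossing. -/
theorem sort_mixed (ys : List Bool) (c : Crs Bool) (hc : c.Splits (· = true)) (hne : c.bl ≠ c.br) :
    TangleEq (2 + ys.length) (2 + ys.length)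
      (⟨0, .cross c.b⟩ :: sortWord (c.tl :: c.tr :: ys)) (sortWord (c.bl :: c.br :: ys)) := by
  have hc := hc.eq
  obtain ⟨b, bl, br, tl, tr⟩ := c
  dsimp only at hc hne ⊢
  obtain ⟨rfl, rfl, hc⟩ := hc
  obtain ⟨h1, h2⟩ := hc.resolve_left hne
  subst h1 h2
  have h5 := layer_comm_shift 0 (.cross tr) (isTangle_sortWord ys)
  have e := length_eq_count ys
  cases tr with
  | true =>
    simp only [sortWord, Bool.not_true, List.count_cons_self, pass, shift_append,
      shift_shift]
    have h6 : TangleEq (2 + ys.length) (2 + ys.length)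
        [⟨0, .cross true⟩, ⟨0, .cross false⟩] [] :=
      .of_move (LocalMove.reidemeister2 0 true) ⟨by simp, by simp [IsTangle]; omega⟩ rfl
    have t1 : IsTangle (shift 1 (pass (ys.count true))) (2 + ys.length) (2 + ys.length) := by
      have := ((isTangle_pass (ys.count true)).shift 1).widen (ys.count false)
      convert this using 1 <;> omega
    have h7 := h5.append_right (v := ⟨0, .cross false⟩ :: shift 1 (pass (ys.count true)))
      (l := 2 + ys.length) ⟨by simp, by simpa [add_comm] using t1⟩
    have h8 := TangleEq.context (u := shift 2 (sortWord ys)) (v := shift 1 (pass (ys.count true)))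
      (k := 2 + ys.length) (l := 2 + ys.length) ((isTangle_sortWord ys).shift 2) t1 h6
    refine TangleEq.trans (by simpa using h7) ?_
    simpa using h8
  | false =>
    simp only [sortWord, Bool.not_false, List.count_cons_self, pass, shift_append,
      shift_shift]
    have h7 := h5.append_right (v := shift 1 (pass (ys.count true))) (l := 2 + ys.length) (by
      have := ((isTangle_pass (ys.count true)).shift 1).widen (ys.count false)
      convert this using 1 <;> (try simp only [Piece.cod_cross]) <;> omega)
    simpa using h7

/-- The inductive step of sorting: sorting above a slice amounts to sorting below it and then
applying the piece to the sorted strands. The induction runs over the strands to the left of the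
piece. -/
theorem sort_slice (s : Slice Bool) (hs : s.Splits) :
    TangleEq s.bot.length s.top.length (s.layer :: sortWord s.top)
      (sortWord s.bot ++ sortedLayer s) := by
  obtain ⟨xs, p, ys⟩ := s
  induction xs with
  | nil =>
    have hbase : (∃ x, p.bot = List.replicate p.toPiece.dom x ∧
        p.top = List.replicate p.toPiece.cod x) ∨ ∃ c, p = .cross c ∧ c.bl ≠ c.br := by
      cases p with
      | cup s => exact .inl ⟨s, rfl, rfl⟩
      | cap s => exact .inl ⟨s, rfl, rfl⟩
      | cross c =>
        by_cases h : c.bl = c.br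
        · left
          obtain ⟨h1, h2, -⟩ := (hs _ rfl).eq
          refine ⟨c.bl, ?_⟩
          simp [LPiece.bot, LPiece.top, LPiece.toPiece, List.replicate, h1, h2, ← h]
        · exact .inr ⟨c, rfl, h⟩
    rcases hbase with ⟨x, hb, ht⟩ | ⟨c, rfl, hc⟩
    · have hk : sortedLayer ⟨[], p, ys⟩ = [⟨if x then 0 else ys.count true, p.toPiece⟩] := by
        simp only [sortedLayer, hb, ht]
        cases p <;> cases x <;> simp [LPiece.toPiece, List.replicate]
      rw [hk]
      cases x with
      | true => simpa [Slice.bot, Slice.top, Slice.layer] using sort_true ys p hb ht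
      | false => simpa [Slice.bot, Slice.top, Slice.layer] using sort_false ys p hb ht
    · have hk : sortedLayer ⟨[], .cross c, ys⟩ = [] := by
        obtain ⟨b, bl, br, tl, tr⟩ := c
        cases bl <;> cases br <;> simp_all [sortedLayer, LPiece.bot]
      rw [hk]
      have := sort_mixed ys c (hs c rfl) hc
      rw [add_comm] at this
      simpa [Slice.bot, Slice.top, Slice.layer, LPiece.bot, LPiece.top, LPiece.toPiece]
        using this
  | cons x xs ih =>
    have ih := (ih hs).shift 1
    -- The three alternatives: a mixed crossing, which disappears, a piece of the upper class, and a
    -- piece of the lower class.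
    have hsl : sortedLayer ⟨xs, p, ys⟩ = [] ∧ sortedLayer ⟨x :: xs, p, ys⟩ = [] ∧
          p.bot.count true = p.top.count true ∨
        sortedLayer ⟨xs, p, ys⟩ = [⟨xs.count true, p.toPiece⟩] ∧
          sortedLayer ⟨x :: xs, p, ys⟩ = [⟨(x :: xs).count true, p.toPiece⟩] ∧
          p.bot.count true = p.toPiece.dom ∧ p.top.count true = p.toPiece.cod ∨
        sortedLayer ⟨xs, p, ys⟩ =
            [⟨xs.count true + ys.count true + xs.count false, p.toPiece⟩] ∧
          sortedLayer ⟨x :: xs, p, ys⟩ =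
            [⟨(x :: xs).count true + ys.count true + (x :: xs).count false, p.toPiece⟩] ∧
          p.bot.count true = 0 ∧ p.top.count true = 0 := by
      cases p with
      | cup s => cases s <;> simp [sortedLayer, LPiece.bot, LPiece.top, LPiece.toPiece]
      | cap s => cases s <;> simp [sortedLayer, LPiece.bot, LPiece.top, LPiece.toPiece]
      | cross c =>
        have h := (hs _ rfl).eq
        clear hs ih
        obtain ⟨b, bl, br, tl, tr⟩ := c
        dsimp only at h
        obtain ⟨rfl, rfl, h⟩ := h
        cases b <;> cases tr <;> cases tl <;>
          simp [sortedLayer, LPiece.bot, LPiece.top, LPiece.toPiece] at h ⊢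
    cases x with
    | true =>
      have e : sortedLayer ⟨true :: xs, p, ys⟩ = shift 1 (sortedLayer ⟨xs, p, ys⟩) := by
        rcases hsl with ⟨h1, h2, -⟩ | ⟨h1, h2, -⟩ | ⟨h1, h2, -⟩ <;> rw [h1, h2] <;> simp
        · omega
        · omega
      rw [e]
      simpa [Slice.bot, Slice.top, Slice.layer, sortWord, add_comm, add_assoc, add_left_comm]
        using ih
    | false =>
      set aT := (xs ++ (p.top ++ ys)).count true with haT
      set aB := (xs ++ (p.bot ++ ys)).count true with haB
      set N := xs.length + (p.toPiece.dom + ys.length) with hN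
      set N' := xs.length + (p.toPiece.cod + ys.length) with hN'
      have lT : (xs ++ (p.top ++ ys)).length = N' := by simp [hN']
      have lB : (xs ++ (p.bot ++ ys)).length = N := by simp [hN]
      have cT := length_eq_count (xs ++ (p.top ++ ys))
      have cB := length_eq_count (xs ++ (p.bot ++ ys))
      rw [lT] at cT
      rw [lB] at cB
      -- The new lower strand passes under all upper strands. An upper piece is slid across it by
      -- `pass_piece`; a lower piece already lies to the right of that passage and commutes with it.
      have key : TangleEq (1 + N) (1 + N') (shift 1 (sortedLayer ⟨xs, p, ys⟩) ++ pass aT)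
          (pass aB ++ sortedLayer ⟨false :: xs, p, ys⟩) := by
        have lx := length_eq_count xs
        have ly := length_eq_count ys
        simp only [List.count_append] at haT haB cT cB
        rcases hsl with ⟨h1, h2, h3⟩ | ⟨h1, h2, h3, h4⟩ | ⟨h1, h2, h3, h4⟩
        · rw [h1, h2, show aT = aB by omega]
          simpa using TangleEq.refl _
        · rw [h1, h2]
          have := (pass_piece (xs.count true) (ys.count true) p.toPiece).widen
            (xs.count false + ys.count false)
          simp only [shift_cons, shift_nil, List.cons_append, List.nil_append]
          simp only [List.count_cons, Bool.false_eq_true, if_false, add_zero, beq_iff_eq]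
          convert this using 1
          · omega
          · omega
          · congr 2; omega
          · congr 2; omega
        · rw [h1, h2]
          have := layer_comm_word (xs.count false) (ys.count false) p.toPiece (isTangle_pass aB)
          simp only [shift_cons, shift_nil, List.cons_append, List.nil_append]
          simp only [List.count_cons, Bool.false_eq_true, if_false, add_zero, beq_iff_eq]
          rw [show aT = aB by omega]
          convert this using 1
          · omega
          · omega
          · congr 2; omega
          · congr 3; simp; omega
      have t1 : IsTangle (pass aT) (1 + N') (1 + N') := by
        have := (isTangle_pass aT).widen (List.count false (xs ++ (p.top ++ ys)))
        convert this using 1 <;> omega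
      have t2 : IsTangle (shift 1 (sortWord (xs ++ (p.bot ++ ys)))) (1 + N) (1 + N) := by
        have := (isTangle_sortWord (xs ++ (p.bot ++ ys))).shift 1
        rwa [lB] at this
      simp only [Slice.bot, Slice.top, Slice.layer, lT, lB] at ih
      have h1 := ih.append_right t1
      have h2 := key.append_left t2
      simp only [Slice.bot, Slice.top, Slice.layer, List.cons_append, sortWord, List.length_cons,
        lT, lB]
      rw [add_comm N, add_comm N', ← haT, ← haB, add_comm xs.length]
      refine TangleEq.trans (by simpa using h1) ?_
      simpa using h2

/-- The part of a word marked `true`. -/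
def truePart : List (Slice Bool) → List Layer
  | [] => []
  | s :: w => match s.pc.bot ++ s.pc.top with
    | true :: true :: _ => ⟨s.lft.count true, s.pc.toPiece⟩ :: truePart w
    | _ => truePart w

/-- The part of a word marked `false`. -/
def falsePart : List (Slice Bool) → List Layer
  | [] => []
  | s :: w => match s.pc.bot ++ s.pc.top with
    | false :: false :: _ => ⟨s.lft.count false, s.pc.toPiece⟩ :: falsePart w
    | _ => falsePart w

theorem slice_cases (s : Slice Bool) (hs : s.Splits) (w : List (Slice Bool)) :
    (sortedLayer s = [] ∧ truePart (s :: w) = truePart w ∧ falsePart (s :: w) = falsePart w ∧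
      s.pc.bot.count true = s.pc.top.count true ∧ s.pc.bot.count false = s.pc.top.count false) ∨
    (sortedLayer s = [⟨s.lft.count true, s.pc.toPiece⟩] ∧
      truePart (s :: w) = ⟨s.lft.count true, s.pc.toPiece⟩ :: truePart w ∧
      falsePart (s :: w) = falsePart w ∧
      s.pc.bot.count true = s.pc.toPiece.dom ∧ s.pc.top.count true = s.pc.toPiece.cod ∧
      s.pc.bot.count false = 0 ∧ s.pc.top.count false = 0) ∨
    (sortedLayer s =
        [⟨s.lft.count true + s.rgt.count true + s.lft.count false, s.pc.toPiece⟩] ∧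
      truePart (s :: w) = truePart w ∧
      falsePart (s :: w) = ⟨s.lft.count false, s.pc.toPiece⟩ :: falsePart w ∧
      s.pc.bot.count true = 0 ∧ s.pc.top.count true = 0 ∧
      s.pc.bot.count false = s.pc.toPiece.dom ∧ s.pc.top.count false = s.pc.toPiece.cod) := by
  obtain ⟨xs, p, ys⟩ := s
  cases p with
  | cup s => cases s <;>
      simp [sortedLayer, LPiece.bot, LPiece.top, LPiece.toPiece, truePart, falsePart]
  | cap s => cases s <;>
      simp [sortedLayer, LPiece.bot, LPiece.top, LPiece.toPiece, truePart, falsePart]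
  | cross c =>
    have h := (hs _ rfl).eq
    clear hs
    obtain ⟨b, bl, br, tl, tr⟩ := c
    dsimp only at h
    obtain ⟨rfl, rfl, h⟩ := h
    cases b <;> cases tr <;> cases tl <;>
      simp [sortedLayer, LPiece.bot, LPiece.top, LPiece.toPiece, truePart, falsePart] at h ⊢

theorem isTangle_parts {w : List (Slice Bool)} {m n : List Bool} (hw : Chain w m n)
    (hs : ∀ s ∈ w, s.Splits) :
    IsTangle (truePart w) (m.count true) (n.count true) ∧
      IsTangle (falsePart w) (m.count false) (n.count false) := by
  induction w generalizing m with
  | nil => cases hw; exact ⟨rfl, rfl⟩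
  | cons s w ih =>
    obtain ⟨rfl, h⟩ := hw
    obtain ⟨i1, i2⟩ := ih h fun t ht => hs t (List.mem_cons_of_mem _ ht)
    simp only [Slice.top, List.count_append] at i1 i2
    simp only [Slice.bot, List.count_append]
    rcases slice_cases s (hs s List.mem_cons_self) w with ⟨-, e1, e2, h1, h2⟩ |
      ⟨-, e1, e2, h1, h2, h3, h4⟩ | ⟨-, e1, e2, h1, h2, h3, h4⟩ <;> rw [e1, e2]
    · rw [h1, h2]; exact ⟨i1, i2⟩
    · refine ⟨⟨by simp only; omega, ?_⟩, ?_⟩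
      · convert i1 using 1; simp only; omega
      · convert i2 using 1; omega
    · refine ⟨?_, ⟨by simp only; omega, ?_⟩⟩
      · convert i1 using 1; omega
      · convert i2 using 1; simp only; omega

/-- For a closed word both sorting braids are empty, and the right side is the upper part followed
by the lower part, that is, a split diagram. -/
theorem sort_chain {w : List (Slice Bool)} {m n : List Bool} (hw : Chain w m n)
    (hs : ∀ s ∈ w, s.Splits) :
    TangleEq m.length n.length (erase w ++ sortWord n)
      (sortWord m ++ (truePart w ++ shift (n.count true) (falsePart w))) := by
  induction w generalizing m with
  | nil => cases hw; simpa [truePart, falsePart] using TangleEq.refl _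
  | cons s w ih =>
    obtain ⟨rfl, h⟩ := hw
    have hs' : ∀ t ∈ w, t.Splits := fun t ht => hs t (List.mem_cons_of_mem _ ht)
    have h1 := ih h hs'
    obtain ⟨t1, t2⟩ := isTangle_parts h hs'
    have cn := length_eq_count n
    have ct := length_eq_count s.top
    have h2 := h1.append_left (u := [s.layer]) (k := s.bot.length) ⟨by
      simp [Slice.bot, Slice.layer], by
      simp [IsTangle, Slice.bot, Slice.top, Slice.layer]; omega⟩
    have tA : IsTangle (truePart w ++ shift (n.count true) (falsePart w)) s.top.length n.length := by
      refine IsTangle.append (n := n.count true + s.top.count false) ?_ ?_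
      · have := t1.widen (s.top.count false)
        rwa [← ct] at this
      · have := t2.shift (n.count true)
        rwa [← cn] at this
    have h3 := (sort_slice s (hs s List.mem_cons_self)).append_right tA
    refine TangleEq.trans (by simpa using h2) (TangleEq.trans (by simpa using h3) ?_)
    refine TangleEq.append_left (isTangle_sortWord _) ?_
    simp only [Slice.top, List.count_append] at t1 t2
    rcases slice_cases s (hs s List.mem_cons_self) w with ⟨e0, e1, e2, h1, h2⟩ |
      ⟨e0, e1, e2, h1, h2, h3, h4⟩ | ⟨e0, e1, e2, h1, h2, h3, h4⟩ <;> rw [e0, e1, e2]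
    · exact .refl _
    · exact .refl _
    -- A lower piece lies to the right of all upper strands, so it can be lifted above the whole
    -- upper part.
    · have t3 := t2.shift (n.count true)
      have h5 := (layer_comm_word (s.lft.count false) (s.rgt.count false) s.pc.toPiece
        t1).append_right (v := shift (n.count true) (falsePart w)) (l := n.length) (by
          convert t3 using 1
          omega)
      have lx := length_eq_count s.lft
      have ly := length_eq_count s.rgt
      have e : s.bot.length = s.lft.count true + (s.pc.top.count true + s.rgt.count true) +
        s.lft.count false + s.pc.toPiece.dom + s.rgt.count false := by
        simp [Slice.bot]; omega
      rw [e, show s.lft.count true + s.rgt.count true + s.lft.count false =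
        s.lft.count true + (s.pc.top.count true + s.rgt.count true) + s.lft.count false by omega]
      simpa using h5

end LinkColoring

namespace LinkColoring
open Diagram

/-! ### Relabelling and reflecting words -/

section
variable {S T : Type*}

/-- Relabelling the ends of a crossing. -/
def Crs.map (f : S → T) (c : Crs S) : Crs T := ⟨c.b, f c.bl, f c.br, f c.tl, f c.tr⟩

/-- Relabelling a piece. -/
def LPiece.map (f : S → T) : LPiece S → LPiece T
  | .cup s => .cup (f s)
  | .cap s => .cap (f s)
  | .cross c => .cross (c.map f)

/-- Relabelling a slice. -/
def Slice.map (f : S → T) (s : Slice S) : Slice T := ⟨s.lft.map f, s.pc.map f, s.rgt.map f⟩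

/-- Relabelling a word. -/
def mapWord (f : S → T) (w : List (Slice S)) : List (Slice T) := w.map (Slice.map f)

@[simp] theorem LPiece.bot_map (f : S → T) (p : LPiece S) : (p.map f).bot = p.bot.map f := by
  cases p <;> rfl
@[simp] theorem LPiece.top_map (f : S → T) (p : LPiece S) : (p.map f).top = p.top.map f := by
  cases p <;> rfl
@[simp] theorem LPiece.toPiece_map (f : S → T) (p : LPiece S) : (p.map f).toPiece = p.toPiece := by
  cases p <;> rfl
@[simp] theorem Slice.bot_map (f : S → T) (s : Slice S) : (s.map f).bot = s.bot.map f := by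
  simp [Slice.bot, Slice.map]
@[simp] theorem Slice.top_map (f : S → T) (s : Slice S) : (s.map f).top = s.top.map f := by
  simp [Slice.top, Slice.map]
@[simp] theorem Slice.layer_map (f : S → T) (s : Slice S) : (s.map f).layer = s.layer := by
  simp [Slice.layer, Slice.map]

@[simp] theorem mapWord_nil (f : S → T) : mapWord f [] = [] := rfl
@[simp] theorem mapWord_cons (f : S → T) (s : Slice S) (w : List (Slice S)) :
    mapWord f (s :: w) = s.map f :: mapWord f w := rfl
@[simp] theorem mapWord_append (f : S → T) (u v : List (Slice S)) :
    mapWord f (u ++ v) = mapWord f u ++ mapWord f v := by simp [mapWord]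
@[simp] theorem erase_mapWord (f : S → T) (w : List (Slice S)) :
    erase (mapWord f w) = erase w := by simp [erase, mapWord]

theorem Chain.map (f : S → T) {w : List (Slice S)} {m n : List S} (h : Chain w m n) :
    Chain (mapWord f w) (m.map f) (n.map f) := by
  induction w generalizing m with
  | nil => cases h; rfl
  | cons s w ih => refine ⟨by simp [h.1], ?_⟩; rw [Slice.top_map]; exact ih h.2

@[simp] theorem crs_mapWord (f : S → T) (w : List (Slice S)) :
    crs (mapWord f w) = (crs w).map (Crs.map f) := by
  induction w with
  | nil => rfl
  | cons s w ih =>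
    obtain ⟨x, p, y⟩ := s
    cases p <;> simp [Slice.map, LPiece.map, ih]

/-- The reflection of a crossing in a horizontal line. -/
def Crs.flip (c : Crs S) : Crs S := ⟨!c.b, c.tl, c.tr, c.bl, c.br⟩

/-- The reflection of a labelled piece in a horizontal line. -/
def LPiece.flip : LPiece S → LPiece S
  | .cup s => .cap s
  | .cap s => .cup s
  | .cross c => .cross c.flip

/-- The reflection of a slice in a horizontal line. -/
def Slice.flip (s : Slice S) : Slice S := ⟨s.lft, s.pc.flip, s.rgt⟩

/-- The reflection of a labelled word in a horizontal line. -/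
def flipSlices (w : List (Slice S)) : List (Slice S) := (w.map Slice.flip).reverse

@[simp] theorem Crs.flip_flip (c : Crs S) : c.flip.flip = c := by simp [Crs.flip]
@[simp] theorem LPiece.flip_flip (p : LPiece S) : p.flip.flip = p := by
  cases p <;> simp [LPiece.flip]
@[simp] theorem LPiece.bot_flip (p : LPiece S) : p.flip.bot = p.top := by cases p <;> rfl
@[simp] theorem LPiece.top_flip (p : LPiece S) : p.flip.top = p.bot := by cases p <;> rfl
@[simp] theorem LPiece.toPiece_flip (p : LPiece S) : p.flip.toPiece = p.toPiece.flip := by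
  cases p <;> rfl
@[simp] theorem Slice.bot_flip (s : Slice S) : s.flip.bot = s.top := by
  simp [Slice.bot, Slice.top, Slice.flip]
@[simp] theorem Slice.top_flip (s : Slice S) : s.flip.top = s.bot := by
  simp [Slice.bot, Slice.top, Slice.flip]
@[simp] theorem Slice.flip_flip (s : Slice S) : s.flip.flip = s := by simp [Slice.flip]

@[simp] theorem flipSlices_append (u v : List (Slice S)) :
    flipSlices (u ++ v) = flipSlices v ++ flipSlices u := by simp [flipSlices]
@[simp] theorem flipSlices_nil : flipSlices ([] : List (Slice S)) = [] := rfl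
@[simp] theorem flipSlices_cons (s : Slice S) (w : List (Slice S)) :
    flipSlices (s :: w) = flipSlices w ++ [s.flip] := by simp [flipSlices]
@[simp] theorem flipSlices_flipSlices (w : List (Slice S)) : flipSlices (flipSlices w) = w := by
  induction w with
  | nil => rfl
  | cons s w ih => simp [ih]

theorem Chain.flip {w : List (Slice S)} {m n : List S} (h : Chain w m n) :
    Chain (flipSlices w) n m := by
  induction w generalizing m with
  | nil => cases h; rfl
  | cons s w ih =>
    rw [flipSlices_cons, chain_append]
    exact ⟨_, ih h.2, by simp, by simp [h.1, Chain]⟩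

@[simp] theorem flipWord_flipWord (w : List Layer) : flipWord (flipWord w) = w := by
  have : ∀ p : Piece, p.flip.flip = p := by intro p; cases p <;> simp [Piece.flip]
  simp [flipWord, Function.comp_def, this]

theorem erase_flipSlices (w : List (Slice S)) : erase (flipSlices w) = flipWord (erase w) := by
  simp [erase, flipWord, flipSlices, Function.comp_def, Slice.flip, Slice.layer]

@[simp] theorem crs_flipSlices (w : List (Slice S)) :
    crs (flipSlices w) = ((crs w).map Crs.flip).reverse := by
  induction w with
  | nil => rfl
  | cons s w ih =>
    obtain ⟨x, p, y⟩ := s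
    cases p <;> simp [Slice.flip, LPiece.flip, ih]

theorem Crs.Splits.flip {A : S → Prop} {c : Crs S} (h : c.Splits A) : c.flip.Splits A := by
  obtain ⟨b, bl, br, tl, tr⟩ := c
  obtain ⟨h1, h2, h3, h4⟩ := h
  dsimp only at *
  refine ⟨h2.symm, h1.symm, ?_, ?_⟩ <;> intro hb <;> simp only [Crs.flip] at hb ⊢ <;>
    cases b <;> simp_all

/-- `s` is the label of some strand of `w`. -/
def Strand (w : List (Slice S)) (s : S) : Prop := ∃ t ∈ w, s ∈ t.bot ∨ s ∈ t.top

theorem strand_flipSlices {w : List (Slice S)} {s : S} : Strand (flipSlices w) s ↔ Strand w s := by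
  constructor
  · rintro ⟨t, ht, h⟩
    simp only [flipSlices, List.mem_reverse, List.mem_map] at ht
    obtain ⟨t, ht, rfl⟩ := ht
    exact ⟨t, ht, by simpa [or_comm] using h⟩
  · rintro ⟨t, ht, h⟩
    exact ⟨t.flip, by simpa [flipSlices] using ⟨t, ht, rfl⟩, by simpa [or_comm] using h⟩

/-! ### Words representing a link -/

/-- The labelled word `w`, or its reflection, represents the link `L`. -/
def Rep (L : Link) (w : List (Slice S)) : Prop :=
  Chain w [] [] ∧ ∃ D : Diagram, D.Represents L ∧
    (TangleEq 0 0 D.word (erase w) ∨ TangleEq 0 0 D.word (flipWord (erase w)))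

theorem Rep.of_eq {T : Type*} {L : Link} {w : List (Slice S)} {w' : List (Slice T)}
    (h : Rep L w) (hc : Chain w' [] [])
    (hw : TangleEq 0 0 (erase w) (erase w')) : Rep L w' := by
  obtain ⟨-, D, hD, h⟩ := h
  exact ⟨hc, D, hD, h.imp (fun h => h.trans hw) fun h => h.trans hw.flip⟩

theorem Rep.flip {L : Link} {w : List (Slice S)} (h : Rep L w) : Rep L (flipSlices w) := by
  obtain ⟨hc, D, hD, h⟩ := h
  refine ⟨hc.flip, D, hD, ?_⟩
  rw [erase_flipSlices, flipWord_flipWord]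
  exact h.symm

theorem Rep.map {T : Type*} {L : Link} {w : List (Slice S)} (h : Rep L w) (f : S → T) :
    Rep L (mapWord f w) :=
  h.of_eq (by simpa using h.1.map f) (.of_eq (by simp))

theorem Rep.exists_diagram {L : Link} {w : List (Slice S)} (h : Rep L w) :
    ∃ w' : List (Slice S), (w' = w ∨ w' = flipSlices w) ∧ Chain w' [] [] ∧
      ∃ D : Diagram, D.word = erase w' ∧ D.Represents L := by
  obtain ⟨hc, D, hD, h | h⟩ := h
  · exact ⟨w, .inl rfl, hc, ⟨_, hc.isTangle⟩, rfl, represents_of_tangleEq h hD⟩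
  · rw [← erase_flipSlices] at h
    exact ⟨_, .inr rfl, hc.flip, ⟨_, hc.flip.isTangle⟩, rfl, represents_of_tangleEq h hD⟩

end

/-! ### Splitting off the strands that are over all others -/

/-- An upper strand in a word that starts without one must be born at an upper minimum. This makes
the two halves of the split diagram non-empty. -/
theorem forall_eq_false_of_truePart_eq_nil {w : List (Slice Bool)} {m n : List Bool}
    (hw : Chain w m n) (hs : ∀ s ∈ w, s.Splits) (h : truePart w = []) (hm : m.count true = 0) :
    ∀ s, Strand w s → s = false := by
  induction w generalizing m with
  | nil => rintro s ⟨t, ht, -⟩; simp at ht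
  | cons t w ih =>
    obtain ⟨rfl, hw⟩ := hw
    have key : truePart w = [] ∧ t.top.count true = 0 := by
      simp only [Slice.bot, Slice.top, List.count_append] at hm ⊢
      rcases slice_cases t (hs t List.mem_cons_self) w with ⟨-, e1, e2, h1, h2⟩ |
        ⟨-, e1, e2, h1, h2, h3, h4⟩ | ⟨-, e1, e2, h1, h2, h3, h4⟩ <;> rw [e1] at h
      · exact ⟨h, by omega⟩
      · simp at h
      · exact ⟨h, by omega⟩
    rintro s ⟨t', ht', hs'⟩
    rcases List.mem_cons.1 ht' with rfl | ht'
    · rw [List.count_eq_zero] at hm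
      have := List.count_eq_zero.1 key.2
      cases s
      · rfl
      · simp_all
    · exact ih hw (fun s h => hs s (List.mem_cons_of_mem _ h)) key.1 key.2 s ⟨t', ht', hs'⟩

theorem forall_eq_true_of_falsePart_eq_nil {w : List (Slice Bool)} {m n : List Bool}
    (hw : Chain w m n) (hs : ∀ s ∈ w, s.Splits) (h : falsePart w = []) (hm : m.count false = 0) :
    ∀ s, Strand w s → s = true := by
  induction w generalizing m with
  | nil => rintro s ⟨t, ht, -⟩; simp at ht
  | cons t w ih =>
    obtain ⟨rfl, hw⟩ := hw
    have key : falsePart w = [] ∧ t.top.count false = 0 := by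
      simp only [Slice.bot, Slice.top, List.count_append] at hm ⊢
      rcases slice_cases t (hs t List.mem_cons_self) w with ⟨-, e1, e2, h1, h2⟩ |
        ⟨-, e1, e2, h1, h2, h3, h4⟩ | ⟨-, e1, e2, h1, h2, h3, h4⟩ <;> rw [e2] at h
      · exact ⟨h, by omega⟩
      · exact ⟨h, by omega⟩
      · simp at h
    rintro s ⟨t', ht', hs'⟩
    rcases List.mem_cons.1 ht' with rfl | ht'
    · rw [List.count_eq_zero] at hm
      have := List.count_eq_zero.1 key.2
      cases s
      · simp_all
      · rfl
    · exact ih hw (fun s h => hs s (List.mem_cons_of_mem _ h)) key.1 key.2 s ⟨t', ht', hs'⟩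

/-- In a diagram of a non-splittable link, a set of strands that is always over the other strands
is empty or contains all strands. -/
theorem Rep.all_or_none {S : Type*} {L : Link} (hL : ¬ L.IsSplittable) {w : List (Slice S)}
    (hw : Rep L w) (A : S → Prop) (hA : ∀ c ∈ crs w, c.Splits A) :
    (∀ s, Strand w s → A s) ∨ ∀ s, Strand w s → ¬ A s := by
  classical
  by_contra hcon
  push Not at hcon
  obtain ⟨⟨s, hs, hsA⟩, t, ht, htA⟩ := hcon
  -- `Rep` allows the reflected word to be the one that represents the link, and the assumptions are
  -- invariant under reflection.
  have hcon' : ∀ w' : List (Slice S), (w' = w ∨ w' = flipSlices w) →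
      (∀ c ∈ crs w', c.Splits A) ∧ Strand w' s ∧ Strand w' t := by
    rintro w' (rfl | rfl)
    · exact ⟨hA, hs, ht⟩
    · refine ⟨?_, strand_flipSlices.2 hs, strand_flipSlices.2 ht⟩
      intro c hc
      simp only [crs_flipSlices, List.mem_reverse, List.mem_map] at hc
      obtain ⟨c, hc, rfl⟩ := hc
      exact (hA c hc).flip
  obtain ⟨w', hw', hc, D, hD, hDL⟩ := hw.exists_diagram
  obtain ⟨hA, hs, ht⟩ := hcon' w' hw'
  let f : S → Bool := fun s => decide (A s)
  have hspl : ∀ s ∈ mapWord f w', s.Splits := by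
    rintro s hs c hc
    have : c ∈ crs (mapWord f w') := by
      obtain ⟨u, v, h⟩ := List.append_of_mem hs
      obtain ⟨x, p, y⟩ := s
      dsimp only at hc
      subst hc
      rw [h]
      simp
    rw [crs_mapWord, List.mem_map] at this
    obtain ⟨c, hc', rfl⟩ := this
    simpa [Crs.Splits, Crs.map, f] using hA c hc'
  have hch : Chain (mapWord f w') [] [] := by simpa using hc.map f
  have hpart := isTangle_parts hch hspl
  have hsort := sort_chain hch hspl
  simp only [sortWord, List.append_nil, List.nil_append, List.count_nil, shift_zero,
    List.length_nil, erase_mapWord] at hsort hpart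
  have hstr : ∀ s, Strand w' s → Strand (mapWord f w') (f s) := by
    rintro s ⟨t, ht, h⟩
    refine ⟨t.map f, List.mem_map_of_mem ht, ?_⟩
    simp only [Slice.bot_map, Slice.top_map]
    exact h.imp (List.mem_map_of_mem) (List.mem_map_of_mem)
  refine hL ⟨⟨_, hpart.1⟩, ⟨_, hpart.2⟩, ?_, ?_, represents_of_tangleEq (D := D) ?_ hDL⟩
  · intro h
    have := forall_eq_false_of_truePart_eq_nil hch hspl h (by simp) _ (hstr t ht)
    simp [f, htA] at this
  · intro h
    have := forall_eq_true_of_falsePart_eq_nil hch hspl h (by simp) _ (hstr s hs)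
    simp [f, hsA] at this
  · rw [hD]
    exact hsort

end LinkColoring

namespace LinkColoring
open Diagram

/-! ### Planar isotopies of labelled words -/

section
variable {S : Type*}

@[simp] theorem LPiece.bot_cup (s : S) : (LPiece.cup s).bot = [] := rfl
@[simp] theorem LPiece.top_cup (s : S) : (LPiece.cup s).top = [s, s] := rfl
@[simp] theorem LPiece.bot_cap (s : S) : (LPiece.cap s).bot = [s, s] := rfl
@[simp] theorem LPiece.top_cap (s : S) : (LPiece.cap s).top = [] := rfl
@[simp] theorem LPiece.bot_cross (c : Crs S) : (LPiece.cross c).bot = [c.bl, c.br] := rfl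
@[simp] theorem LPiece.top_cross (c : Crs S) : (LPiece.cross c).top = [c.tl, c.tr] := rfl

/-- The labels of the two ends of the over strand, and those of the two ends of the under strand. -/
def Crs.abs (c : Crs S) : Multiset S × Multiset S :=
  if c.b then ({c.bl, c.tr}, {c.br, c.tl}) else ({c.br, c.tl}, {c.bl, c.tr})

/-- A crossing turned clockwise. -/
def Crs.rot (c : Crs S) : Crs S := ⟨!c.b, c.br, c.tr, c.bl, c.tl⟩

/-- A crossing turned counterclockwise. -/
def Crs.rotInv (c : Crs S) : Crs S := ⟨!c.b, c.tl, c.bl, c.tr, c.br⟩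

@[simp] theorem Crs.abs_rot (c : Crs S) : c.rot.abs = c.abs := by
  obtain ⟨b, bl, br, tl, tr⟩ := c
  cases b <;> simp [Crs.abs, Crs.rot] <;> exact Multiset.pair_comm _ _

@[simp] theorem Crs.abs_rotInv (c : Crs S) : c.rotInv.abs = c.abs := by
  obtain ⟨b, bl, br, tl, tr⟩ := c
  cases b <;> simp [Crs.abs, Crs.rotInv] <;> exact Multiset.pair_comm _ _

@[simp] theorem Crs.abs_flip (c : Crs S) : c.flip.abs = c.abs := by
  obtain ⟨b, bl, br, tl, tr⟩ := c
  cases b <;> simp [Crs.abs, Crs.flip] <;>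
    exact ⟨Multiset.pair_comm _ _, Multiset.pair_comm _ _⟩

/-- The crossings of a word, without their position. -/
def crossings (w : List (Slice S)) : Multiset (Multiset S × Multiset S) :=
  ((crs w).map Crs.abs : List _)

@[simp] theorem crossings_append (u v : List (Slice S)) :
    crossings (u ++ v) = crossings u + crossings v := by
  simp [crossings]

@[simp] theorem crossings_flipSlices (w : List (Slice S)) :
    crossings (flipSlices w) = crossings w := by
  simp [crossings, Function.comp_def]

/-- `b` is obtained from `a` by a planar isotopy. -/
def Pl (a b : List (Slice S)) : Prop :=
  ∀ m n, Chain a m n →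
    Chain b m n ∧ TangleEq m.length n.length (erase a) (erase b) ∧ crossings a = crossings b

theorem Pl.trans {a b c : List (Slice S)} (h : Pl a b) (h' : Pl b c) : Pl a c := by
  intro m n hc
  obtain ⟨h1, h2, h3⟩ := h m n hc
  obtain ⟨i1, i2, i3⟩ := h' m n h1
  exact ⟨i1, h2.trans i2, h3.trans i3⟩

theorem Pl.context {a b : List (Slice S)} (h : Pl a b) (u v : List (Slice S)) :
    Pl (u ++ a ++ v) (u ++ b ++ v) := by
  intro m n hc
  rw [chain_append] at hc
  obtain ⟨l, hc, hv⟩ := hc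
  rw [chain_append] at hc
  obtain ⟨k, hu, hc⟩ := hc
  obtain ⟨h1, h2, h3⟩ := h k l hc
  refine ⟨chain_append.2 ⟨l, chain_append.2 ⟨k, hu, h1⟩, hv⟩, ?_, by simp [h3]⟩
  simpa using h2.context hu.isTangle hv.isTangle

theorem Pl.flip {a b : List (Slice S)} (h : Pl a b) : Pl (flipSlices a) (flipSlices b) := by
  intro m n hc
  obtain ⟨h1, h2, h3⟩ := h n m (by simpa using hc.flip)
  exact ⟨h1.flip, by simpa [erase_flipSlices] using h2.flip, by simpa using h3⟩

theorem Rep.of_pl {L : Link} {a b : List (Slice S)} (h : Rep L a) (hab : Pl a b) : Rep L b := by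
  obtain ⟨h1, h2, -⟩ := hab _ _ h.1
  exact h.of_eq h1 h2

theorem pl_exchange (xs : List S) (p : LPiece S) (mid : List S) (q : LPiece S) (ys : List S) :
    Pl [⟨xs, p, mid ++ (q.bot ++ ys)⟩, ⟨xs ++ (p.top ++ mid), q, ys⟩]
      [⟨xs ++ (p.bot ++ mid), q, ys⟩, ⟨xs, p, mid ++ (q.top ++ ys)⟩] := by
  rintro m n ⟨rfl, -, rfl⟩
  refine ⟨⟨by simp [Slice.bot], by simp [Slice.bot, Slice.top], by simp [Chain, Slice.top]⟩, ?_, ?_⟩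
  · have := LocalMove.exchange xs.length mid.length p.toPiece q.toPiece
    refine .of_move (by simpa [Slice.layer, add_assoc] using this) ?_ ?_ <;>
      simp [IsTangle, Slice.layer, Slice.bot, Slice.top] <;> omega
  · cases p <;> cases q <;> simp [crossings, List.Perm.swap]

theorem pl_exchange' (xs : List S) (p : LPiece S) (mid : List S) (q : LPiece S) (ys : List S) :
    Pl [⟨xs ++ (p.bot ++ mid), q, ys⟩, ⟨xs, p, mid ++ (q.top ++ ys)⟩]
      [⟨xs, p, mid ++ (q.bot ++ ys)⟩, ⟨xs ++ (p.top ++ mid), q, ys⟩] := by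
  intro m n h
  obtain ⟨rfl, -, rfl⟩ := h
  have hc : Chain [(⟨xs, p, mid ++ (q.bot ++ ys)⟩ : Slice S), ⟨xs ++ (p.top ++ mid), q, ys⟩]
      (xs ++ (p.bot ++ (mid ++ (q.bot ++ ys)))) (xs ++ (p.top ++ (mid ++ (q.top ++ ys)))) := by
    simp [Chain, Slice.bot, Slice.top]
  obtain ⟨h1, h2, h3⟩ := pl_exchange xs p mid q ys _ _ hc
  refine ⟨by simpa [Slice.bot, Slice.top] using hc, ?_, h3.symm⟩
  simpa [Slice.bot, Slice.top] using h2.symm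

/-- A zigzag in the upper right end of a crossing leaves the upper left end as the only one that
continues upwards. This is the form of a `coupon`. -/
theorem tangleEq_zigzag_cross {i k : ℕ} (b : Bool) :
    TangleEq (i + 2 + k) (i + 2 + k) [⟨i, .cross b⟩]
      [⟨i + 2, .cup⟩, ⟨i, .cross b⟩, ⟨i + 1, .cap⟩] := by
  have h1 : TangleEq (i + 2 + k) (i + 2 + k) [⟨i + 1 + 1, .cup⟩, ⟨i + 1, .cap⟩] [] :=
    .of_move (.zigzag' (i + 1)) (by simp [IsTangle]; omega) rfl
  have h2 : TangleEq (i + 2 + k) (i + 4 + k) [⟨i, .cross b⟩, ⟨i + 2, .cup⟩]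
      [⟨i + 2, .cup⟩, ⟨i, .cross b⟩] :=
    .of_move (.exchange i 0 (.cross b) .cup) (by simp [IsTangle]; omega) (by simp [IsTangle]; omega)
  have h3 := h1.append_left (u := [⟨i, .cross b⟩]) (k := i + 2 + k) (by simp [IsTangle]; omega)
  have h4 := h2.append_right (v := [⟨i + 1, .cap⟩]) (l := i + 2 + k) (by simp [IsTangle]; omega)
  exact h3.symm.trans h4

/-- A quarter turn of a crossing; it exchanges the two types of crossings, whence `!b`. -/
theorem tangleEq_rot {i k : ℕ} (b : Bool) :
    TangleEq (i + 2 + k) (i + 2 + k) [⟨i, .cross b⟩]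
      [⟨i + 2, .cup⟩, ⟨i + 1, .cross (!b)⟩, ⟨i, .cap⟩] := by
  refine (tangleEq_zigzag_cross b).trans (.append_left (u := [⟨i + 2, .cup⟩]) (m := i + 4 + k)
    (by simp [IsTangle]; omega) ?_)
  exact .of_move (.slideCap i b) (by simp [IsTangle]; omega) (by simp [IsTangle]; omega)

theorem tangleEq_rotInv {i k : ℕ} (b : Bool) :
    TangleEq (i + 2 + k) (i + 2 + k) [⟨i, .cross b⟩]
      [⟨i, .cup⟩, ⟨i + 1, .cross (!b)⟩, ⟨i + 2, .cap⟩] := by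
  have h1 : TangleEq (i + 2 + k) (i + 2 + k) [⟨i + 1, .cup⟩, ⟨i + 1 + 1, .cap⟩] [] :=
    .of_move (.zigzag (i + 1)) (by simp [IsTangle]; omega) rfl
  have h2 : TangleEq (i + 4 + k) (i + 2 + k) [⟨i, .cross b⟩, ⟨i + 2, .cap⟩]
      [⟨i + 2, .cap⟩, ⟨i, .cross b⟩] :=
    .of_move (.exchange i 0 (.cross b) .cap) (by simp [IsTangle]; omega) (by simp [IsTangle]; omega)
  have h3 : TangleEq (i + 2 + k) (i + 4 + k) [⟨i + 1, .cup⟩, ⟨i, .cross b⟩]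
      [⟨i, .cup⟩, ⟨i + 1, .cross (!b)⟩] :=
    .of_move (.slideCup i b) (by simp [IsTangle]; omega) (by simp [IsTangle]; omega)
  have h4 := h1.append_right (v := [⟨i, .cross b⟩]) (l := i + 2 + k) (by simp [IsTangle]; omega)
  have h5 := h2.append_left (u := [⟨i + 1, .cup⟩]) (k := i + 2 + k) (by simp [IsTangle]; omega)
  have h6 := h3.append_right (v := [⟨i + 2, .cap⟩]) (l := i + 2 + k) (by simp [IsTangle]; omega)
  exact h4.symm.trans (h5.symm.trans h6)

theorem tangleEq_turn {i k : ℕ} (b : Bool) :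
    TangleEq (i + 4 + k) (i + k) [⟨i, .cross b⟩, ⟨i + 1, .cap⟩, ⟨i, .cap⟩]
      [⟨i + 2, .cross b⟩, ⟨i + 1, .cap⟩, ⟨i, .cap⟩] := by
  have h1 : TangleEq (i + 4 + k) (i + 2 + k) [⟨i, .cross b⟩, ⟨i + 1, .cap⟩]
      [⟨i + 1, .cross (!b)⟩, ⟨i, .cap⟩] :=
    .of_move (.slideCap i b) (by simp [IsTangle]; omega) (by simp [IsTangle]; omega)
  have h2 : TangleEq (i + 4 + k) (i + k) [⟨i, .cap⟩, ⟨i, .cap⟩] [⟨i + 2, .cap⟩, ⟨i, .cap⟩] :=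
    .of_move (.exchange i 0 .cap .cap) (by simp [IsTangle]; omega) (by simp [IsTangle]; omega)
  have h3 : TangleEq (i + 4 + k) (i + 2 + k) [⟨i + 1, .cross (!b)⟩, ⟨i + 2, .cap⟩]
      [⟨i + 2, .cross b⟩, ⟨i + 1, .cap⟩] := by
    have := LocalMove.slideCap (i + 1) (!b)
    rw [Bool.not_not] at this
    exact .of_move this (by simp [IsTangle]; omega) (by simp [IsTangle]; omega)
  have h4 := h1.append_right (v := [⟨i, .cap⟩]) (l := i + k) (by simp [IsTangle]; omega)
  have h5 := h2.append_left (u := [⟨i + 1, .cross (!b)⟩]) (k := i + 4 + k)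
    (by simp [IsTangle]; omega)
  have h6 := h3.append_right (v := [⟨i, .cap⟩]) (l := i + k) (by simp [IsTangle]; omega)
  exact h4.trans (h5.trans h6)

theorem tangleEq_turn' {i k : ℕ} (b : Bool) :
    TangleEq (i + 4 + k) (i + k) [⟨i + 1, .cross b⟩, ⟨i + 2, .cap⟩, ⟨i, .cap⟩]
      [⟨i, .cross (!b)⟩, ⟨i + 1, .cap⟩, ⟨i, .cap⟩] := by
  have h2 : TangleEq (i + 4 + k) (i + k) [⟨i, .cap⟩, ⟨i, .cap⟩] [⟨i + 2, .cap⟩, ⟨i, .cap⟩] :=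
    .of_move (.exchange i 0 .cap .cap) (by simp [IsTangle]; omega) (by simp [IsTangle]; omega)
  have h3 : TangleEq (i + 4 + k) (i + 2 + k) [⟨i, .cross (!b)⟩, ⟨i + 1, .cap⟩]
      [⟨i + 1, .cross b⟩, ⟨i, .cap⟩] := by
    have := LocalMove.slideCap i (!b)
    rw [Bool.not_not] at this
    exact .of_move this (by simp [IsTangle]; omega) (by simp [IsTangle]; omega)
  have h5 := h2.append_left (u := [⟨i + 1, .cross b⟩]) (k := i + 4 + k)
    (by simp [IsTangle]; omega)
  have h6 := h3.append_right (v := [⟨i, .cap⟩]) (l := i + k) (by simp [IsTangle]; omega)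
  exact h5.symm.trans h6.symm

theorem pl_zigzag_cross (xs ys : List S) (c : Crs S) :
    Pl [⟨xs, .cross c, ys⟩] [⟨xs ++ [c.bl, c.br], .cup c.tr, ys⟩,
      ⟨xs, .cross c, c.tr :: c.tr :: ys⟩, ⟨xs ++ [c.tl], .cap c.tr, c.tr :: ys⟩] := by
  rintro m n ⟨rfl, rfl⟩
  refine ⟨by simp [Chain, Slice.bot, Slice.top, LPiece.bot, LPiece.top], ?_, by simp [crossings]⟩
  have := tangleEq_zigzag_cross (i := xs.length) (k := ys.length) c.b
  simpa [Slice.layer, Slice.bot, Slice.top, LPiece.bot, LPiece.top, LPiece.toPiece, add_assoc,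
    add_comm, add_left_comm] using this

theorem pl_rot (xs ys : List S) (c : Crs S) :
    Pl [⟨xs, .cross c, ys⟩] [⟨xs ++ [c.bl, c.br], .cup c.tr, ys⟩,
      ⟨xs ++ [c.bl], .cross c.rot, c.tr :: ys⟩, ⟨xs, .cap c.bl, c.tl :: c.tr :: ys⟩] := by
  rintro m n ⟨rfl, rfl⟩
  refine ⟨by simp [Chain, Slice.bot, Slice.top, LPiece.bot, LPiece.top, Crs.rot], ?_,
    by simp [crossings]⟩
  have := tangleEq_rot (i := xs.length) (k := ys.length) c.b
  simpa [Slice.layer, Slice.bot, Slice.top, LPiece.bot, LPiece.top, LPiece.toPiece, add_assoc,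
    add_comm, add_left_comm, Crs.rot] using this

theorem pl_rotInv (xs ys : List S) (c : Crs S) :
    Pl [⟨xs, .cross c, ys⟩] [⟨xs, .cup c.tl, c.bl :: c.br :: ys⟩,
      ⟨xs ++ [c.tl], .cross c.rotInv, c.br :: ys⟩, ⟨xs ++ [c.tl, c.tr], .cap c.br, ys⟩] := by
  rintro m n ⟨rfl, rfl⟩
  refine ⟨by simp [Chain, Slice.bot, Slice.top, LPiece.bot, LPiece.top, Crs.rotInv], ?_,
    by simp [crossings]⟩
  have := tangleEq_rotInv (i := xs.length) (k := ys.length) c.b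
  simpa [Slice.layer, Slice.bot, Slice.top, LPiece.bot, LPiece.top, LPiece.toPiece, add_assoc,
    add_comm, add_left_comm, Crs.rotInv] using this

/-- A crossing with three ends at the bottom. -/
def coupon (xs : List S) (c : Crs S) (ys : List S) : List (Slice S) :=
  [⟨xs, .cross c, c.tr :: ys⟩, ⟨xs ++ [c.tl], .cap c.tr, ys⟩]

/-- A coupon climbs along its upper end past a slice whose piece does not touch that strand. -/
theorem pl_coupon_left (A : List S) (p : LPiece S) (M : List S) (c : Crs S) (ys : List S) :
    Pl (coupon (A ++ (p.bot ++ M)) c ys ++ [⟨A, p, M ++ c.tl :: ys⟩])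
      (⟨A, p, M ++ (c.bl :: c.br :: c.tr :: ys)⟩ :: coupon (A ++ (p.top ++ M)) c ys) := by
  have h1 := (pl_exchange' A p (M ++ [c.tl]) (.cap c.tr) ys).context
    [⟨A ++ (p.bot ++ M), .cross c, c.tr :: ys⟩] []
  have h2 := (pl_exchange' A p M (.cross c) (c.tr :: ys)).context []
    [⟨A ++ (p.top ++ M) ++ [c.tl], .cap c.tr, ys⟩]
  simp only [LPiece.bot_cap, LPiece.top_cap, LPiece.bot_cross, LPiece.top_cross,
    List.append_assoc, List.cons_append, List.nil_append, List.append_nil] at h1 h2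
  simpa only [coupon, List.append_assoc, List.cons_append, List.nil_append] using h1.trans h2

theorem pl_coupon_right (xs : List S) (c : Crs S) (M : List S) (p : LPiece S) (B : List S) :
    Pl (coupon xs c (M ++ (p.bot ++ B)) ++ [⟨xs ++ c.tl :: M, p, B⟩])
      (⟨xs ++ c.bl :: c.br :: c.tr :: M, p, B⟩ :: coupon xs c (M ++ (p.top ++ B))) := by
  have h1 := (pl_exchange (xs ++ [c.tl]) (.cap c.tr) M p B).context
    [⟨xs, .cross c, c.tr :: (M ++ (p.bot ++ B))⟩] []
  have h2 := (pl_exchange xs (.cross c) (c.tr :: M) p B).context []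
    [⟨xs ++ [c.tl], .cap c.tr, M ++ (p.top ++ B)⟩]
  simp only [LPiece.bot_cap, LPiece.top_cap, LPiece.bot_cross, LPiece.top_cross,
    List.append_assoc, List.cons_append, List.nil_append, List.append_nil] at h1 h2
  simpa only [coupon, List.append_assoc, List.cons_append, List.nil_append] using h1.trans h2

/-- When the climbing strand reaches a maximum, the crossing is carried over it. The maximum
labelled `c.tl` is used up, and the new maxima carry labels of other ends of the crossing; this
makes `turns` decrease in `hit_of_coupon`. -/
theorem pl_turn (xs : List S) (c : Crs S) (B : List S) :
    Pl (coupon xs c (c.tl :: B) ++ [⟨xs, .cap c.tl, B⟩])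
      [⟨xs ++ [c.bl, c.br], .cross c.rot.rot, B⟩, ⟨xs ++ [c.bl], .cap c.br, c.bl :: B⟩,
        ⟨xs, .cap c.bl, B⟩] := by
  rintro m n ⟨rfl, -, -, rfl⟩
  refine ⟨by simp [Chain, Slice.bot, Slice.top, LPiece.bot, LPiece.top, Crs.rot], ?_,
    by simp [crossings, coupon]⟩
  have := tangleEq_turn (i := xs.length) (k := B.length) c.b
  simpa [Slice.layer, Slice.bot, Slice.top, LPiece.bot, LPiece.top, LPiece.toPiece, add_assoc,
    add_comm, add_left_comm, Crs.rot, coupon] using this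

theorem pl_turn' (A : List S) (c : Crs S) (ys : List S) :
    Pl (coupon (A ++ [c.tl]) c ys ++ [⟨A, .cap c.tl, ys⟩])
      [⟨A, .cross c.rotInv, c.br :: c.tr :: ys⟩, ⟨A ++ [c.tr], .cap c.br, c.tr :: ys⟩,
        ⟨A, .cap c.tr, ys⟩] := by
  rintro m n ⟨rfl, -, -, rfl⟩
  refine ⟨by simp [Chain, Slice.bot, Slice.top, LPiece.bot, LPiece.top, Crs.rotInv], ?_,
    by simp [crossings, coupon]⟩
  have := tangleEq_turn' (i := A.length) (k := ys.length) c.b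
  simpa [Slice.layer, Slice.bot, Slice.top, LPiece.bot, LPiece.top, LPiece.toPiece, add_assoc,
    add_comm, add_left_comm, Crs.rotInv, coupon] using this

/-- When the climbing strand enters another crossing at its lower left end, a quarter turn of the
coupon makes the two crossings neighbours. -/
theorem pl_hit (xs : List S) (c c2 : Crs S) (B : List S) (h : c2.bl = c.tl) :
    Pl (coupon xs c (c2.br :: B) ++ [⟨xs, .cross c2, B⟩])
      [⟨xs ++ [c.bl], .cross c.rot, c2.br :: B⟩, ⟨xs ++ [c.bl, c.bl], .cross c2, B⟩,
        ⟨xs, .cap c.bl, c2.tl :: c2.tr :: B⟩] := by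
  rintro m n ⟨rfl, -, -, rfl⟩
  refine ⟨by simp [Chain, Slice.bot, Slice.top, LPiece.bot, LPiece.top, Crs.rot, h], ?_,
    by simp [crossings, coupon]⟩
  set i := xs.length with hi
  set k := B.length with hk
  have h1 : TangleEq (i + 4 + k) (i + 2 + k) [⟨i, .cross c.b⟩, ⟨i + 1, .cap⟩]
      [⟨i + 1, .cross (!c.b)⟩, ⟨i, .cap⟩] :=
    .of_move (.slideCap i c.b) (by simp [IsTangle]; omega) (by simp [IsTangle]; omega)
  have h2 : TangleEq (i + 4 + k) (i + 2 + k) [⟨i, .cap⟩, ⟨i, .cross c2.b⟩]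
      [⟨i + 2, .cross c2.b⟩, ⟨i, .cap⟩] :=
    .of_move (.exchange i 0 .cap (.cross c2.b)) (by simp [IsTangle]; omega)
      (by simp [IsTangle]; omega)
  have h3 := h1.append_right (v := [⟨i, .cross c2.b⟩]) (l := i + 2 + k) (by simp [IsTangle]; omega)
  have h4 := h2.append_left (u := [⟨i + 1, .cross (!c.b)⟩]) (k := i + 4 + k)
    (by simp [IsTangle]; omega)
  have := h3.trans h4
  simpa [Slice.layer, Slice.bot, Slice.top, LPiece.bot, LPiece.top, LPiece.toPiece, add_assoc,
    add_comm, add_left_comm, Crs.rot, coupon] using this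

end

end LinkColoring

namespace LinkColoring
open Diagram

/-! ### Bringing two neighbouring crossings together -/

section
variable {S : Type*}

open scoped Classical in
/-- The number of minima and maxima labelled `α`. -/
noncomputable def turns (α : S) (w : List (Slice S)) : ℕ :=
  w.countP fun s => s.pc = .cup α ∨ s.pc = .cap α

/-- Exactly one of the ends of `c` is labelled `α`. -/
def Crs.Once (α : S) (c : Crs S) : Prop :=
  (c.tl = α ∧ c.bl ≠ α ∧ c.br ≠ α ∧ c.tr ≠ α) ∨ (c.tr = α ∧ c.bl ≠ α ∧ c.br ≠ α ∧ c.tl ≠ α) ∨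
    (c.bl = α ∧ c.br ≠ α ∧ c.tl ≠ α ∧ c.tr ≠ α) ∨ (c.br = α ∧ c.bl ≠ α ∧ c.tl ≠ α ∧ c.tr ≠ α)

@[simp] theorem turns_append (α : S) (u v : List (Slice S)) :
    turns α (u ++ v) = turns α u + turns α v := by simp [turns]

@[simp] theorem turns_nil (α : S) : turns α [] = 0 := rfl

@[simp] theorem turns_cons_cross (α : S) (x y : List S) (c : Crs S) (v : List (Slice S)) :
    turns α (⟨x, .cross c, y⟩ :: v) = turns α v := by simp [turns]

theorem turns_cons (α : S) (x y x' y' : List S) (p : LPiece S) (v : List (Slice S)) :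
    turns α (⟨x, p, y⟩ :: v) = turns α [⟨x', p, y'⟩] + turns α v := by
  simp [turns, List.countP_cons]; omega

theorem turns_cap_self (α : S) (x y : List S) : turns α [⟨x, .cap α, y⟩] = 1 := by
  simp [turns]

theorem turns_cup_of_ne {α s : S} (h : s ≠ α) (x y : List S) (v : List (Slice S)) :
    turns α (⟨x, .cup s, y⟩ :: v) = turns α v := by
  simp [turns, h]

theorem turns_cap_of_ne {α s : S} (h : s ≠ α) (x y : List S) (v : List (Slice S)) :
    turns α (⟨x, .cap s, y⟩ :: v) = turns α v := by
  simp [turns, h]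

theorem turns_flipSlices (α : S) (w : List (Slice S)) : turns α (flipSlices w) = turns α w := by
  induction w with
  | nil => rfl
  | cons s w ih =>
    rw [flipSlices_cons, turns_append, ih, add_comm, ← List.singleton_append, turns_append]
    obtain ⟨x, p, y⟩ := s
    cases p with
    | cross c => simp [turns, Slice.flip, LPiece.flip]
    | cup s => by_cases h : s = α <;> simp [turns, Slice.flip, LPiece.flip, h, add_comm]
    | cap s => by_cases h : s = α <;> simp [turns, Slice.flip, LPiece.flip, h, add_comm]

/-- The crossings `c₁` and `c₂` are next to each other: the upper right end of `c₁` is the lower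
left end of `c₂`, it is labelled `α`. -/
def Adjacent (α : S) (c1 c2 : Crs S) (w : List (Slice S)) : Prop :=
  c1.tr = α ∧ c2.bl = α ∧ ∃ u v xs ys,
    w = u ++ ⟨xs, .cross c1, c2.br :: ys⟩ :: ⟨xs ++ [c1.tl], .cross c2, ys⟩ :: v

/-- After a planar isotopy, the crossing `X` is at the beginning of a strand `α` that joins it to a
crossing next to it. -/
def Hit (α : S) (X : Multiset S × Multiset S) (w : List (Slice S)) : Prop :=
  ∃ w', (Pl w w' ∨ Pl (flipSlices w) w') ∧ ∃ c1 c2, Adjacent α c1 c2 w' ∧ c1.abs = X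

theorem Hit.of_pl {α : S} {X : Multiset S × Multiset S} {w w' : List (Slice S)} (h : Pl w w')
    (hw : Hit α X w') : Hit α X w := by
  obtain ⟨w'', h1, h2⟩ := hw
  exact ⟨w'', h1.imp (fun h1 => h.trans h1) (fun h1 => h.flip.trans h1), h2⟩

theorem Hit.of_flip {α : S} {X : Multiset S × Multiset S} {w : List (Slice S)}
    (hw : Hit α X (flipSlices w)) : Hit α X w := by
  obtain ⟨w'', h1, h2⟩ := hw
  rw [flipSlices_flipSlices] at h1
  exact ⟨w'', h1.symm, h2⟩

theorem hit_of_coupon_cross (α : S) (u v : List (Slice S)) (xs : List S) (c c2 : Crs S)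
    (B : List S) (h : c2.bl = c.tl) (hα : c.tl = α) :
    Hit α c.abs (u ++ (coupon xs c (c2.br :: B) ++ [⟨xs, .cross c2, B⟩]) ++ v) := by
  refine ⟨_, .inl ((pl_hit xs c c2 B h).context u v), c.rot, c2, ⟨by simp [Crs.rot, hα],
    h.trans hα, u, ⟨xs, .cap c.bl, c2.tl :: c2.tr :: B⟩ :: v, xs ++ [c.bl], B, ?_⟩, by simp⟩
  simp [Crs.rot]

/-- The strand `t` is to the right of the piece with lower ends `b`, to its left, or one of these
ends. -/
theorem append_cons_eq_cases {A b B xs ys : List S} {t : S} (h : A ++ (b ++ B) = xs ++ t :: ys) :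
    (∃ M, xs = A ++ (b ++ M) ∧ B = M ++ t :: ys) ∨ (∃ M, A = xs ++ t :: M ∧ ys = M ++ (b ++ B)) ∨
      ∃ b1 b2, b = b1 ++ t :: b2 ∧ xs = A ++ b1 ∧ ys = b2 ++ B := by
  rcases List.append_eq_append_iff.1 h with ⟨a, rfl, h2⟩ | ⟨a, rfl, h2⟩
  · rcases List.append_eq_append_iff.1 h2 with ⟨c, rfl, h3⟩ | ⟨c, rfl, h3⟩
    · exact .inl ⟨c, rfl, h3⟩
    · rcases List.cons_eq_append_iff.1 h3 with ⟨rfl, rfl⟩ | ⟨d, rfl, rfl⟩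
      · exact .inl ⟨[], by simp, by simp⟩
      · exact .inr (.inr ⟨a, d, rfl, rfl, rfl⟩)
  · rcases List.cons_eq_append_iff.1 h2 with ⟨rfl, h3⟩ | ⟨d, rfl, rfl⟩
    · cases b with
      | nil => exact .inl ⟨[], by simp, by simpa using h3⟩
      | cons x b =>
        simp only [List.cons_append, List.cons.injEq] at h3
        exact .inr (.inr ⟨[], b, by simp [h3.1], by simp, h3.2.symm⟩)
    · exact .inr (.inl ⟨d, rfl, rfl⟩)

/-- The coupon climbs through the rest `v` of the word, by induction on `v`. A maximum of the strand
reverses the direction, but lowers the number of turns labelled `α`, so that `ih` applies; a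
crossing is what is sought. The word is closed, so the strand cannot run out at the top. -/
theorem hit_of_coupon {α : S} {N : ℕ}
    (ih : ∀ w, Chain w [] [] → turns α w < N → ∀ c ∈ crs w, c.Once α → Hit α c.abs w)
    (v : List (Slice S)) : ∀ (u : List (Slice S)) (xs : List S) (c : Crs S) (ys : List S),
      Chain (u ++ coupon xs c ys ++ v) [] [] → turns α (u ++ coupon xs c ys ++ v) ≤ N →
      c.tl = α → c.bl ≠ α → c.br ≠ α → c.tr ≠ α → Hit α c.abs (u ++ coupon xs c ys ++ v) := by
  induction v with
  | nil =>
    intro u xs c ys h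
    rw [List.append_nil, chain_append] at h
    obtain ⟨k, -, h⟩ := h
    obtain ⟨-, -, h⟩ := h
    simp [Chain, Slice.top] at h
  | cons s v ihv =>
    intro u xs c ys hw hN htl hbl hbr htr
    obtain ⟨A, p, B⟩ := s
    have hbot : A ++ (p.bot ++ B) = xs ++ c.tl :: ys := by
      rw [chain_append] at hw
      obtain ⟨k, h1, h2, -⟩ := hw
      rw [chain_append] at h1
      obtain ⟨k', -, -, -, rfl⟩ := h1
      simpa [Slice.bot, Slice.top] using h2
    -- The case of a maximum: one turn labelled `α` is lost and the turned crossing still has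
    -- exactly one end `α`.
    have hcap : ∀ b : List (Slice S),
        Pl (coupon xs c ys ++ [⟨A, p, B⟩]) b → turns α b + 1 ≤
          turns α (coupon xs c ys ++ [⟨A, p, B⟩]) →
          (∃ c' ∈ crs b, c'.Once α ∧ c'.abs = c.abs) →
        Hit α c.abs (u ++ coupon xs c ys ++ ⟨A, p, B⟩ :: v) := by
      rintro b hb hb1 ⟨c', hc', ho, hc⟩
      have hpl := hb.context u v
      rw [show u ++ (coupon xs c ys ++ [⟨A, p, B⟩]) ++ v = u ++ coupon xs c ys ++ ⟨A, p, B⟩ :: v by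
        simp] at hpl
      refine .of_pl hpl ?_
      rw [← hc]
      refine ih _ (hpl _ _ hw).1 ?_ c' (by simp [hc']) ho
      rw [← List.singleton_append, ← List.append_assoc] at hN
      simp only [turns_append] at hN hb1 ⊢
      omega
    rcases append_cons_eq_cases hbot with ⟨M, rfl, rfl⟩ | ⟨M, rfl, rfl⟩ | ⟨b1, b2, hb, rfl, rfl⟩
    · have hpl := (pl_coupon_left A p M c ys).context u v
      rw [show u ++ (coupon (A ++ (p.bot ++ M)) c ys ++ [⟨A, p, M ++ c.tl :: ys⟩]) ++ v =
        u ++ coupon (A ++ (p.bot ++ M)) c ys ++ ⟨A, p, M ++ c.tl :: ys⟩ :: v by simp,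
        show ∀ (x : Slice S) (a : List (Slice S)), u ++ (x :: a) ++ v = (u ++ [x]) ++ a ++ v by
          simp] at hpl
      refine .of_pl hpl (ihv _ _ _ _ (hpl _ _ hw).1 (le_trans (le_of_eq ?_) hN) htl hbl hbr htr)
      simp [coupon, turns_cap_of_ne htr, turns_cons α A _ [] [] p]
    · have hpl := (pl_coupon_right xs c M p B).context u v
      rw [show u ++ (coupon xs c (M ++ (p.bot ++ B)) ++ [⟨xs ++ c.tl :: M, p, B⟩]) ++ v =
        u ++ coupon xs c (M ++ (p.bot ++ B)) ++ ⟨xs ++ c.tl :: M, p, B⟩ :: v by simp,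
        show ∀ (x : Slice S) (a : List (Slice S)), u ++ (x :: a) ++ v = (u ++ [x]) ++ a ++ v by
          simp] at hpl
      refine .of_pl hpl (ihv _ _ _ _ (hpl _ _ hw).1 (le_trans (le_of_eq ?_) hN) htl hbl hbr htr)
      simp [coupon, turns_cap_of_ne htr]
      rw [turns_cons α (xs ++ c.bl :: c.br :: c.tr :: M) B [] [] p,
        turns_cons α (xs ++ c.tl :: M) B [] [] p v]
      simp [turns_cap_of_ne htr]
    · cases p with
      | cup s => simp at hb
      | cap s =>
        rcases b1 with - | ⟨x, - | ⟨y, b1⟩⟩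
        · simp only [LPiece.bot_cap, List.nil_append, List.cons.injEq] at hb
          obtain ⟨rfl, rfl⟩ := hb
          refine hcap _ (by simpa using pl_turn A c B) ?_
            ⟨c.rot.rot, by simp, .inr (.inr (.inr ⟨htl, htr, hbr, hbl⟩)), by simp⟩
          simp [coupon, turns_cap_of_ne, htr, hbr, hbl, htl, turns_cap_self]
        · simp only [LPiece.bot_cap, List.cons_append, List.nil_append, List.cons.injEq] at hb
          obtain ⟨rfl, rfl, rfl⟩ := hb
          refine hcap _ (by simpa using pl_turn' A c B) ?_
            ⟨c.rotInv, by simp, .inr (.inr (.inl ⟨htl, hbl, htr, hbr⟩)), by simp⟩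
          simp [coupon, turns_cap_of_ne, htr, hbr, htl, turns_cap_self]
        · simp at hb
      | cross c2 =>
        rcases b1 with - | ⟨x, - | ⟨y, b1⟩⟩
        · simp only [LPiece.bot_cross, List.nil_append, List.cons.injEq] at hb
          obtain ⟨h1, rfl⟩ := hb
          simpa using hit_of_coupon_cross α u v A c c2 B h1 htl
        · simp only [LPiece.bot_cross, List.cons_append, List.nil_append, List.cons.injEq] at hb
          obtain ⟨rfl, h1, rfl⟩ := hb
          -- The strand enters `c2` at its lower right end; a quarter turn of `c2` makes this the
          -- lower left end required by `pl_hit`. The coupon must first climb past the minimum so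
          -- created.
          have e1 := (pl_rot A B c2).context (u ++ coupon (A ++ [c2.bl]) c B) v
          have e2 := (pl_coupon_right (A ++ [c2.bl]) c [] (.cup c2.tr) B).context u
            (⟨A ++ [c2.bl], .cross c2.rot, c2.tr :: B⟩ ::
              ⟨A, .cap c2.bl, c2.tl :: c2.tr :: B⟩ :: v)
          have e3 := hit_of_coupon_cross α (u ++ [⟨A ++ [c2.bl, c.bl, c.br, c.tr], .cup c2.tr, B⟩])
            (⟨A, .cap c2.bl, c2.tl :: c2.tr :: B⟩ :: v) (A ++ [c2.bl]) c c2.rot (c2.tr :: B) h1 htl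
          simp only [coupon, List.append_assoc, List.cons_append, List.nil_append, LPiece.bot_cup,
            LPiece.top_cup, h1,
            show c2.rot.br = c2.tr from rfl] at e1 e2 e3 ⊢
          exact .of_pl e1 (.of_pl e2 e3)
        · simp at hb

/-- An upper end `α` becomes the free end of a coupon, by a zigzag at the upper left or a quarter
turn at the upper right. The added turns have labels other than `α`. -/
theorem hit_of_tl {α : S} {N : ℕ}
    (ih : ∀ w, Chain w [] [] → turns α w < N → ∀ c ∈ crs w, c.Once α → Hit α c.abs w)
    {u v : List (Slice S)} {x y : List S} {c : Crs S} 
    (hw : Chain (u ++ ⟨x, .cross c, y⟩ :: v) [] [])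
    (hN : turns α (u ++ ⟨x, .cross c, y⟩ :: v) ≤ N) 
    (h : (c.tl = α ∧ c.bl ≠ α ∧ c.br ≠ α ∧ c.tr ≠ α) ∨ 
      (c.tr = α ∧ c.bl ≠ α ∧ c.br ≠ α ∧ c.tl ≠ α)) : 
    Hit α c.abs (u ++ ⟨x, .cross c, y⟩ :: v) := by
  rcases h with ⟨h1, h2, h3, h4⟩ | ⟨h1, h2, h3, h4⟩
  · have hpl := (pl_zigzag_cross x y c).context u v
    rw [List.append_assoc] at hpl
    refine .of_pl hpl ?_
    have := hit_of_coupon ih v (u ++ [⟨x ++ [c.bl, c.br], .cup c.tr, y⟩]) x c (c.tr :: y)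
    simp only [coupon, List.append_assoc, List.cons_append, List.nil_append] at this hpl ⊢
    refine this (hpl _ _ hw).1 ?_ h1 h2 h3 h4
    simpa [turns_cup_of_ne, turns_cap_of_ne, h4] using hN
  · have hpl := (pl_rotInv x y c).context u v
    rw [List.append_assoc] at hpl
    refine .of_pl hpl ?_
    have := hit_of_coupon ih v (u ++ [⟨x, .cup c.tl, c.bl :: c.br :: y⟩]) (x ++ [c.tl]) c.rotInv y
    simp only [coupon, List.append_assoc, List.cons_append, List.nil_append, Crs.abs_rotInv]
      at this hpl ⊢
    refine this (hpl _ _ hw).1 ?_ h1 h4 h2 h3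
    simpa [turns_cup_of_ne, turns_cap_of_ne, h4, h3, Crs.rotInv] using hN

/-- Two crossings joined by a strand can be brought together by a planar isotopy. -/
theorem hit_of_once {α : S} {w : List (Slice S)} (hw : Chain w [] []) {c : Crs S} (hc : c ∈ crs w)
    (h : c.Once α) : Hit α c.abs w := by
  induction hN : turns α w using Nat.strong_induction_on generalizing w c with
  | _ N ih =>
    subst hN
    have ih' : ∀ w', Chain w' [] [] → turns α w' < turns α w → ∀ c ∈ crs w', c.Once α →
      Hit α c.abs w' := fun w' hw' hlt c hc h => ih _ hlt hw' hc h rfl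
    obtain ⟨u, x, y, v, rfl⟩ := mem_crs.1 hc
    rcases h with h | h | h | h
    · exact hit_of_tl ih' hw le_rfl (.inl h)
    · exact hit_of_tl ih' hw le_rfl (.inr h)
    · refine .of_flip ?_
      have e : flipSlices (u ++ ⟨x, .cross c, y⟩ :: v) =
        flipSlices v ++ ⟨x, .cross c.flip, y⟩ :: flipSlices u := by simp [Slice.flip, LPiece.flip]
      have hw' := hw.flip
      rw [← turns_flipSlices] at ih'
      rw [e] at hw' ih' ⊢
      rw [← Crs.abs_flip]
      exact hit_of_tl ih' hw' le_rfl (.inl ⟨h.1, h.2.2.1, h.2.2.2, h.2.1⟩)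
    · refine .of_flip ?_
      have e : flipSlices (u ++ ⟨x, .cross c, y⟩ :: v) =
        flipSlices v ++ ⟨x, .cross c.flip, y⟩ :: flipSlices u := by simp [Slice.flip, LPiece.flip]
      have hw' := hw.flip
      rw [← turns_flipSlices] at ih'
      rw [e] at hw' ih' ⊢
      rw [← Crs.abs_flip]
      exact hit_of_tl ih' hw' le_rfl (.inr ⟨h.1, h.2.2.1, h.2.2.2, h.2.1⟩)

end

end LinkColoring

namespace LinkColoring
open Diagram

/-! ### Colored words -/

/-- The coloring condition at a crossing with a given over pair and a given under pair. -/
def Fits (p : Multiset ℤ × Multiset ℤ) : Prop := ∀ a ∈ p.1, 2 * a = p.2.sum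

/-- The sum of the differences between the over and the under arcs of a crossing. -/
def dif (p : Multiset ℤ × Multiset ℤ) : ℕ :=
  (p.1.bind fun a => p.2.map fun b => (a - b).natAbs).sum

/-- The colored crossing with two given colors below. -/
def mkCrs (b : Bool) (x y : ℤ) : Crs ℤ :=
  if b then ⟨true, x, y, 2 * x - y, x⟩ else ⟨false, x, y, y, 2 * y - x⟩

@[simp] theorem mkCrs_b (b : Bool) (x y : ℤ) : (mkCrs b x y).b = b := by cases b <;> rfl
@[simp] theorem mkCrs_bl (b : Bool) (x y : ℤ) : (mkCrs b x y).bl = x := by cases b <;> rfl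
@[simp] theorem mkCrs_br (b : Bool) (x y : ℤ) : (mkCrs b x y).br = y := by cases b <;> rfl
@[simp] theorem mkCrs_true_tl (x y : ℤ) : (mkCrs true x y).tl = 2 * x - y := rfl
@[simp] theorem mkCrs_true_tr (x y : ℤ) : (mkCrs true x y).tr = x := rfl
@[simp] theorem mkCrs_false_tl (x y : ℤ) : (mkCrs false x y).tl = y := rfl
@[simp] theorem mkCrs_false_tr (x y : ℤ) : (mkCrs false x y).tr = 2 * y - x := rfl

theorem fits_abs_iff {c : Crs ℤ} : Fits c.abs ↔ c = mkCrs c.b c.bl c.br := by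
  obtain ⟨b, bl, br, tl, tr⟩ := c
  cases b <;> simp [Fits, Crs.abs, mkCrs] <;> omega

@[simp] theorem fits_mkCrs (b : Bool) (x y : ℤ) : Fits (mkCrs b x y).abs := by
  rw [fits_abs_iff]; simp

/-- All four pairs of an over and an under end have the same distance, whence the factor 4. -/
theorem dif_mkCrs (b : Bool) (x y : ℤ) : dif (mkCrs b x y).abs = 4 * (x - y).natAbs := by
  cases b <;> simp [dif, Crs.abs, mkCrs] <;> omega

/-- A part of a word that represents `L` can be replaced by an isotopic tangle. -/
theorem Rep.replace {S : Type*} {L : Link} {u v a b : List (Slice S)} {m n : List S}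
    (h : Rep L (u ++ a ++ v)) (ha : Chain a m n) (hb : Chain b m n)
    (hm : ∀ m' n', Chain a m' n' → m' = m ∧ n' = n)
    (hab : TangleEq m.length n.length (erase a) (erase b)) : Rep L (u ++ b ++ v) := by
  obtain ⟨l, hu, hv⟩ := chain_append.1 h.1
  obtain ⟨k, hu, ha'⟩ := chain_append.1 hu
  obtain ⟨rfl, rfl⟩ := hm _ _ ha'
  refine h.of_eq (chain_append.2 ⟨_, chain_append.2 ⟨_, hu, hb⟩, hv⟩) ?_
  simpa using hab.context hu.isTangle hv.isTangle

/-! ### Colored braids with three strands -/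

/-- The layers of a braid with three strands, `i` further strands being to its left.  The letter
`(q, b)` is a crossing of the two strands on the left if `q = false`, on the right if `q = true`. -/
def braidWord (i : ℕ) (l : List (Bool × Bool)) : List Layer :=
  l.map fun p => ⟨i + p.1.toNat, .cross p.2⟩

@[simp] theorem braidWord_append (i : ℕ) (l l' : List (Bool × Bool)) :
    braidWord i (l ++ l') = braidWord i l ++ braidWord i l' := by simp [braidWord]

theorem isTangle_braidWord (i k : ℕ) (l : List (Bool × Bool)) :
    IsTangle (braidWord i l) (i + 3 + k) (i + 3 + k) := by
  induction l with
  | nil => rfl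
  | cons p l ih =>
    obtain ⟨q, b⟩ := p
    refine ⟨by cases q <;> simp <;> omega, ?_⟩
    have e : i + 3 + k - 2 + 2 = i + 3 + k := by omega
    change IsTangle (braidWord i l) (i + 3 + k - 2 + 2) _
    rwa [e]

/-- Isotopy of braids with three strands. -/
def BraidEq (l l' : List (Bool × Bool)) : Prop :=
  ∀ i k, TangleEq (i + 3 + k) (i + 3 + k) (braidWord i l) (braidWord i l')

theorem BraidEq.trans {l l' l'' : List (Bool × Bool)} (h : BraidEq l l') (h' : BraidEq l' l'') :
    BraidEq l l'' := fun i k => (h i k).trans (h' i k)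

theorem BraidEq.symm {l l' : List (Bool × Bool)} (h : BraidEq l l') : BraidEq l' l :=
  fun i k => (h i k).symm

theorem BraidEq.context {l l' : List (Bool × Bool)} (h : BraidEq l l') (u v : List (Bool × Bool)) :
    BraidEq (u ++ l ++ v) (u ++ l' ++ v) := fun i k => by
  simpa using (h i k).context (isTangle_braidWord i k u) (isTangle_braidWord i k v)

theorem braidEq_cancel (q b : Bool) : BraidEq [(q, b), (q, !b)] [] := fun i k =>
  .of_move (.reidemeister2 _ b) (isTangle_braidWord i k [(q, b), (q, !b)]) rfl

/-- A pair of cancelling crossings `(q, s)`, `(q, !s)` is created on top, and the third Reidemeister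
move is applied to the first three crossings; `h` is its side condition. -/
theorem braidEq_slide (q b b' s : Bool) (h : b = b' ∨ b' = s) :
    BraidEq [(q, b), (!q, b')] [(!q, s), (q, b'), (!q, b), (q, !s)] := by
  have h1 := ((braidEq_cancel q s).context [(q, b), (!q, b')] []).symm
  have h2 : BraidEq [(q, b), (!q, b'), (q, s)] [(!q, s), (q, b'), (!q, b)] := by
    intro i k
    cases q
    · exact .of_move (.reidemeister3 i b b' s h)
        (isTangle_braidWord i k [(false, b), (true, b'), (false, s)])
        (isTangle_braidWord i k [(true, s), (false, b'), (true, b)])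
    · exact .symm (.of_move (.reidemeister3 i s b' b (by grind))
        (isTangle_braidWord i k [(false, s), (true, b'), (false, b)])
        (isTangle_braidWord i k [(true, b), (false, b'), (true, s)]))
  exact h1.trans (by simpa using h2.context [] [(q, !s)])

/-- The slices of the braid `l` with colors `x`, `y`, `z` at the bottom. -/
def braid (xs ys : List ℤ) : List (Bool × Bool) → ℤ → ℤ → ℤ → List (Slice ℤ)
  | [], _, _, _ => []
  | (false, b) :: l, x, y, z => ⟨xs, .cross (mkCrs b x y), z :: ys⟩ ::
      braid xs ys l (mkCrs b x y).tl (mkCrs b x y).tr z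
  | (true, b) :: l, x, y, z => ⟨xs ++ [x], .cross (mkCrs b y z), ys⟩ ::
      braid xs ys l x (mkCrs b y z).tl (mkCrs b y z).tr

/-- The colors at the top of the braid `l` with colors `x`, `y`, `z` at the bottom. -/
def braidTop : List (Bool × Bool) → ℤ → ℤ → ℤ → List ℤ
  | [], x, y, z => [x, y, z]
  | (false, b) :: l, x, y, z => braidTop l (mkCrs b x y).tl (mkCrs b x y).tr z
  | (true, b) :: l, x, y, z => braidTop l x (mkCrs b y z).tl (mkCrs b y z).tr

theorem chain_braid (xs ys : List ℤ) (l : List (Bool × Bool)) (x y z : ℤ) (m n : List ℤ) 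
    (hm : m = xs ++ x :: y :: z :: ys) (hn : n = xs ++ (braidTop l x y z ++ ys)) :
    Chain (braid xs ys l x y z) m n := by
  subst hm hn
  induction l generalizing x y z with
  | nil => rfl
  | cons p l ih =>
    obtain ⟨- | -, b⟩ := p
    · exact ⟨by simp [Slice.bot], by simpa [Slice.top, braidTop] using ih _ _ z⟩
    · exact ⟨by simp [Slice.bot], by simpa [Slice.top, braidTop] using ih x _ _⟩

theorem eq_of_chain_braid {xs ys : List ℤ} {l : List (Bool × Bool)} {x y z : ℤ} {m n : List ℤ}
    (hl : l ≠ []) (h : Chain (braid xs ys l x y z) m n) :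
    m = xs ++ x :: y :: z :: ys ∧ n = xs ++ (braidTop l x y z ++ ys) := by
  have hm : m = xs ++ x :: y :: z :: ys := by
    rcases l with - | ⟨⟨- | -, b⟩, l⟩
    · simp at hl
    · simpa [Slice.bot] using h.1.symm
    · simpa [Slice.bot] using h.1.symm
  refine ⟨hm, ?_⟩
  subst hm
  clear hl
  induction l generalizing x y z with
  | nil => exact h.symm
  | cons p l ih =>
    obtain ⟨- | -, b⟩ := p
    · exact ih (by simpa [Slice.top] using h.2)
    · exact ih (by simpa [Slice.top] using h.2)

theorem length_braidTop (l : List (Bool × Bool)) (x y z : ℤ) : (braidTop l x y z).length = 3 := by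
  induction l generalizing x y z with
  | nil => rfl
  | cons p l ih => obtain ⟨- | -, b⟩ := p <;> exact ih _ _ _

theorem erase_braid (xs ys : List ℤ) (l : List (Bool × Bool)) (x y z : ℤ) :
    erase (braid xs ys l x y z) = braidWord xs.length l := by
  induction l generalizing x y z with
  | nil => rfl
  | cons p l ih =>
    obtain ⟨- | -, b⟩ := p <;>
      simp [braid, ih, braidWord, Slice.layer, LPiece.toPiece]

theorem Rep.braid {L : Link} {u v : List (Slice ℤ)} {xs ys : List ℤ} {l : List (Bool × Bool)}
    {x y z : ℤ} (h : Rep L (u ++ braid xs ys l x y z ++ v)) (hl : l ≠ []) (l' : List (Bool × Bool))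
    (hll : BraidEq l l') (ht : braidTop l x y z = braidTop l' x y z) :
    Rep L (u ++ LinkColoring.braid xs ys l' x y z ++ v) := by
  refine h.replace (chain_braid xs ys l x y z _ _ rfl rfl) (chain_braid _ _ _ _ _ _ _ _ rfl 
    (by rw [ht])) (fun m' n' h => eq_of_chain_braid hl h) ?_
  rw [erase_braid, erase_braid]
  have := hll xs.length ys.length
  simpa [length_braidTop, add_assoc, add_comm, add_left_comm] using this

end LinkColoring

namespace LinkColoring
open Diagram

/-! ### Removing crossings with the largest difference -/

/-- A colored word that represents `L`. -/
def Colored (L : Link) (w : List (Slice ℤ)) : Prop := Rep L w ∧ ∀ p ∈ crossings w, Fits p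

theorem fits_crossings_braid (xs ys : List ℤ) (l : List (Bool × Bool)) (x y z : ℤ) :
    ∀ p ∈ crossings (braid xs ys l x y z), Fits p := by
  induction l generalizing x y z with
  | nil => simp [braid, crossings]
  | cons p l ih =>
    obtain ⟨- | -, b⟩ := p
    · simpa [braid, crossings] using ih _ _ z
    · simpa [braid, crossings] using ih x _ _

theorem Colored.braid {L : Link} {u v : List (Slice ℤ)} {xs ys : List ℤ} {l : List (Bool × Bool)}
    {x y z : ℤ} (h : Colored L (u ++ braid xs ys l x y z ++ v)) (hl : l ≠ [])
    (l' : List (Bool × Bool))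
    (hll : BraidEq l l') (ht : braidTop l x y z = braidTop l' x y z) :
    Colored L (u ++ LinkColoring.braid xs ys l' x y z ++ v) := by
  refine ⟨h.1.braid hl l' hll ht, ?_⟩
  have h2 := h.2
  simp only [crossings_append, Multiset.mem_add] at h2 ⊢
  rintro p ((hp | hp) | hp)
  · exact h2 _ (.inl (.inl hp))
  · exact fits_crossings_braid _ _ _ _ _ _ _ hp
  · exact h2 _ (.inr hp)

theorem Colored.of_pl {L : Link} {w w' : List (Slice ℤ)} (h : Colored L w) (hp : Pl w w') :
    Colored L w' :=
  ⟨h.1.of_pl hp, by rw [← (hp _ _ h.1.1).2.2]; exact h.2⟩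

theorem Colored.flip {L : Link} {w : List (Slice ℤ)} (h : Colored L w) :
    Colored L (flipSlices w) := ⟨h.1.flip, by simpa using h.2⟩

/-- A cancelling pair is inserted between the two crossings, so that `braidEq_slide` applies to the
first crossing and one of the pair. -/
theorem braidEq_pull (q b b' : Bool) :
    BraidEq [(q, b), (!q, b')] [(!q, !b), (q, b), (!q, b), (q, b), (!q, !b), (!q, b')] := by
  have h1 := ((braidEq_cancel (!q) b).context [(q, b)] [(!q, b')]).symm
  have h2 := (braidEq_slide q b b (!b) (.inl rfl)).context [] [(!q, !b), (!q, b')]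
  rw [Bool.not_not] at h2
  exact h1.trans h2

/-- The effect on the crossings of replacing two crossings, the first of which has difference `D`,
by crossings with a smaller difference. -/
def Lowers (p q : Multiset ℤ × Multiset ℤ) (s t : Multiset (Multiset ℤ × Multiset ℤ)) : Prop :=
  ∃ R N, s = p ::ₘ q ::ₘ R ∧ t = N + R ∧ (∀ r ∈ N, dif r < dif p) ∧ ∃ r ∈ N, 0 < dif r

theorem Colored.lowers {L : Link} {u v : List (Slice ℤ)} {xs ys : List ℤ} {l : List (Bool × Bool)}
    {x y z : ℤ} (h : Colored L (u ++ LinkColoring.braid xs ys l x y z ++ v)) {c1 c2 : Crs ℤ}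
    (hl : crs (LinkColoring.braid xs ys l x y z) = [c1, c2]) {l' : List (Bool × Bool)}
    (hll : BraidEq l l') (ht : braidTop l x y z = braidTop l' x y z)
    (h1 : ∀ r ∈ crs (LinkColoring.braid xs ys l' x y z), dif r.abs < dif c1.abs)
    (h2 : ∃ r ∈ crs (LinkColoring.braid xs ys l' x y z), 0 < dif r.abs) :
    ∃ w', Colored L w' ∧ Lowers c1.abs c2.abs
      (crossings (u ++ LinkColoring.braid xs ys l x y z ++ v)) (crossings w') := by
  refine ⟨_, h.braid (by rintro rfl; simp [LinkColoring.braid] at hl) l' hll ht,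
    crossings u + crossings v, crossings (LinkColoring.braid xs ys l' x y z), ?_, ?_, ?_, ?_⟩
  · simp only [crossings_append]
    rw [crossings.eq_1 (LinkColoring.braid xs ys l x y z), hl]
    simp only [List.map_cons, List.map_nil,
      ← Multiset.cons_coe, Multiset.coe_nil, ← Multiset.singleton_add]
    abel
  · simp only [crossings_append]; abel
  · simpa [crossings] using h1
  · simpa [crossings] using h2

/-- With δ₁ and δ₂ the two differences, `h1` puts `y` and `z` on the same side of the shared color,
so they differ by δ₁ - δ₂. The new crossings have differences δ₂, δ₁ - δ₂ and |δ₁ - 2δ₂|, all below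
δ₁ as 0 < δ₂ < δ₁. -/
theorem exists_lowers_right {L : Link} {u v : List (Slice ℤ)} {xs ys : List ℤ} {b b' : Bool}
    {x y z : ℤ} (h : Colored L (u ++ braid xs ys [(false, b), (true, b')] x y z ++ v))
    (h1 : ((mkCrs b x y).tr < y ∧ (mkCrs b x y).tr < z) ∨
      (y < (mkCrs b x y).tr ∧ z < (mkCrs b x y).tr))
    (h2 : ((mkCrs b x y).tr - z).natAbs < (x - y).natAbs) :
    ∃ w', Colored L w' ∧ Lowers (mkCrs b x y).abs (mkCrs b' (mkCrs b x y).tr z).abs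
      (crossings (u ++ braid xs ys [(false, b), (true, b')] x y z ++ v)) (crossings w') := by
  refine h.lowers rfl (braidEq_pull false b b') ?_ ?_ ?_
  · cases b <;> cases b' <;> simp [braidTop] <;> omega
  · simp only [braid, crs_cross, crs_nil, Bool.not_false, List.forall_mem_cons, dif_mkCrs]
    cases b <;> cases b' <;> simp at h1 h2 ⊢ <;> omega
  · simp only [braid, crs_cross, crs_nil, Bool.not_false, List.mem_cons, exists_eq_or_imp,
      dif_mkCrs]
    cases b <;> cases b' <;> simp at h1 h2 ⊢ <;> omega

theorem exists_lowers_left {L : Link} {u v : List (Slice ℤ)} {xs ys : List ℤ} {b b' : Bool}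
    {x y z : ℤ} (h : Colored L (u ++ braid xs ys [(true, b), (false, b')] x y z ++ v))
    (h1 : ((mkCrs b y z).tl < y ∧ (mkCrs b y z).tl < x) ∨
      (y < (mkCrs b y z).tl ∧ x < (mkCrs b y z).tl))
    (h2 : ((mkCrs b y z).tl - x).natAbs < (y - z).natAbs) :
    ∃ w', Colored L w' ∧ Lowers (mkCrs b y z).abs (mkCrs b' x (mkCrs b y z).tl).abs
      (crossings (u ++ braid xs ys [(true, b), (false, b')] x y z ++ v)) (crossings w') := by
  refine h.lowers rfl (braidEq_pull true b b') ?_ ?_ ?_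
  · cases b <;> cases b' <;> simp [braidTop] <;> omega
  · simp only [braid, crs_cross, crs_nil, Bool.not_true, List.forall_mem_cons, dif_mkCrs]
    cases b <;> cases b' <;> simp at h1 h2 ⊢ <;> omega
  · simp only [braid, crs_cross, crs_nil, Bool.not_true, List.mem_cons, exists_eq_or_imp,
      dif_mkCrs]
    cases b <;> cases b' <;> simp at h1 h2 ⊢ <;> omega

/-- Turning both neighbouring crossings by a quarter puts the face on the other side of their common
strand at the bottom, where `exists_lowers_left` can be applied. -/
theorem pl_face {S : Type*} (xs ys : List S) (c1 c2 : Crs S) (h : c1.tr = c2.bl) :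
    Pl [⟨xs, .cross c1, c2.br :: ys⟩, ⟨xs ++ [c1.tl], .cross c2, ys⟩]
      [⟨xs, .cup c1.tl, c1.bl :: c1.br :: c2.br :: ys⟩,
        ⟨xs ++ [c1.tl], .cup c2.tl, c1.tl :: c1.bl :: c1.br :: c2.br :: ys⟩,
        ⟨xs ++ [c1.tl, c2.tl, c2.tl], .cross c1.rotInv, c1.br :: c2.br :: ys⟩,
        ⟨xs ++ [c1.tl, c2.tl], .cross c2.rotInv, c1.br :: c1.br :: c2.br :: ys⟩,
        ⟨xs ++ [c1.tl, c2.tl, c2.tr, c2.br], .cap c1.br, c2.br :: ys⟩,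
        ⟨xs ++ [c1.tl, c2.tl, c2.tr], .cap c2.br, ys⟩] := by
  have h1 := (pl_rotInv xs (c2.br :: ys) c1).context [] [⟨xs ++ [c1.tl], .cross c2, ys⟩]
  have h2 := (pl_rotInv (xs ++ [c1.tl]) ys c2).context [⟨xs, .cup c1.tl, c1.bl :: c1.br :: c2.br :: ys⟩,
      ⟨xs ++ [c1.tl], .cross c1.rotInv, c1.br :: c2.br :: ys⟩,
      ⟨xs ++ [c1.tl, c1.tr], .cap c1.br, c2.br :: ys⟩] []
  have h3 := (pl_exchange' (xs ++ [c1.tl]) (.cup c2.tl) [c1.tr] (.cap c1.br) (c2.br :: ys)).context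
    [⟨xs, .cup c1.tl, c1.bl :: c1.br :: c2.br :: ys⟩,
      ⟨xs ++ [c1.tl], .cross c1.rotInv, c1.br :: c2.br :: ys⟩]
    [⟨xs ++ [c1.tl, c2.tl], .cross c2.rotInv, c2.br :: ys⟩,
      ⟨xs ++ [c1.tl, c2.tl, c2.tr], .cap c2.br, ys⟩]
  have h4 := (pl_exchange' (xs ++ [c1.tl]) (.cup c2.tl) [] (.cross c1.rotInv)
    (c1.br :: c2.br :: ys)).context [⟨xs, .cup c1.tl, c1.bl :: c1.br :: c2.br :: ys⟩]
    [⟨xs ++ [c1.tl, c2.tl, c2.tl, c1.tr], .cap c1.br, c2.br :: ys⟩,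
      ⟨xs ++ [c1.tl, c2.tl], .cross c2.rotInv, c2.br :: ys⟩,
      ⟨xs ++ [c1.tl, c2.tl, c2.tr], .cap c2.br, ys⟩]
  have h5 := (pl_exchange' (xs ++ [c1.tl, c2.tl]) (.cross c2.rotInv) [] (.cap c1.br) 
    (c2.br :: ys)).context [⟨xs, .cup c1.tl, c1.bl :: c1.br :: c2.br :: ys⟩,
      ⟨xs ++ [c1.tl], .cup c2.tl, c1.tl :: c1.bl :: c1.br :: c2.br :: ys⟩,
      ⟨xs ++ [c1.tl, c2.tl, c2.tl], .cross c1.rotInv, c1.br :: c2.br :: ys⟩]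
    [⟨xs ++ [c1.tl, c2.tl, c2.tr], .cap c2.br, ys⟩]
  simp only [h, Crs.rotInv, LPiece.bot_cap, LPiece.top_cap, LPiece.bot_cross, LPiece.top_cross, LPiece.bot_cup,
    LPiece.top_cup, List.append_assoc, List.cons_append, List.nil_append, List.append_nil]
    at h1 h2 h3 h4 h5 ⊢
  exact (h1.trans h2).trans (h3.trans (h4.trans h5))

/-- Let α be the common color. Since `b' = !b`, the common strand is over at exactly one of the two
crossings. Hence, of the colors `y` and `z`, going to the other face replaces exactly one by its
reflection in α. If the two colors are on opposite sides of α, those at the other face are on the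
same side. -/
theorem exists_lowers_of_ne {L : Link} {u v : List (Slice ℤ)} {xs ys : List ℤ} {b b' : Bool}
    {x y z : ℤ} (h : Colored L (u ++ braid xs ys [(false, b), (true, b')] x y z ++ v))
    (hb : b' = !b) (h2 : ((mkCrs b x y).tr - z).natAbs < (x - y).natAbs)
    (h3 : (mkCrs b x y).tr ≠ z) :
    ∃ w', Colored L w' ∧ Lowers (mkCrs b x y).abs (mkCrs b' (mkCrs b x y).tr z).abs
      (crossings (u ++ braid xs ys [(false, b), (true, b')] x y z ++ v)) (crossings w') := by
  by_cases h1 : ((mkCrs b x y).tr < y ∧ (mkCrs b x y).tr < z) ∨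
      (y < (mkCrs b x y).tr ∧ z < (mkCrs b x y).tr)
  · exact exists_lowers_right h h1 h2
  have hp := (pl_face xs ys (mkCrs b x y) (mkCrs b' (mkCrs b x y).tr z) (by simp)).context u v
  simp only [mkCrs_br] at hp
  have e : crossings (u ++ braid xs ys [(false, b), (true, b')] x y z ++ v) = _ :=
    (hp _ _ h.1.1).2.2
  have h := h.of_pl hp
  have e1 : (mkCrs b x y).rotInv = mkCrs (!b) (mkCrs b x y).tl x := by
    cases b <;> simp [mkCrs, Crs.rotInv]
  have e2 : (mkCrs b' (mkCrs b x y).tr z).rotInv = mkCrs (!b')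
      (mkCrs b' (mkCrs b x y).tr z).tl (mkCrs b x y).tr := by
    generalize (mkCrs b x y).tr = a
    cases b' <;> simp [mkCrs, Crs.rotInv]
  have e3 : (mkCrs (!b) (mkCrs b x y).tl x).tl = (mkCrs b x y).tr := by rw [← e1]; rfl
  have e4 : (mkCrs (!b) (mkCrs b x y).tl x).tr = y := by rw [← e1]; simp [Crs.rotInv]
  have e5 := congrArg Crs.abs e1
  have e6 := congrArg Crs.abs e2
  rw [Crs.abs_rotInv] at e5 e6
  have key := exists_lowers_left (L := L)
    (u := u ++ [⟨xs, .cup (mkCrs b x y).tl, x :: y :: z :: ys⟩,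
      ⟨xs ++ [(mkCrs b x y).tl], .cup (mkCrs b' (mkCrs b x y).tr z).tl,
        (mkCrs b x y).tl :: x :: y :: z :: ys⟩])
    (v := [⟨xs ++ [(mkCrs b x y).tl, (mkCrs b' (mkCrs b x y).tr z).tl,
        (mkCrs b' (mkCrs b x y).tr z).tr, z], .cap y, z :: ys⟩,
        ⟨xs ++ [(mkCrs b x y).tl, (mkCrs b' (mkCrs b x y).tr z).tl,
          (mkCrs b' (mkCrs b x y).tr z).tr], .cap z, ys⟩] ++ v)
    (xs := xs ++ [(mkCrs b x y).tl, (mkCrs b' (mkCrs b x y).tr z).tl])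
    (ys := y :: z :: ys) (b := !b) (b' := !b') (x := (mkCrs b' (mkCrs b x y).tr z).tl)
    (y := (mkCrs b x y).tl) (z := x)
  rw [e3, ← e5, ← e6] at key
  simp only [LinkColoring.braid, e3, e4, List.append_assoc, List.cons_append, List.nil_append]
    at key
  simp only [e1, e2, mkCrs_bl, List.append_assoc, List.cons_append, List.nil_append] at h e
  rw [List.append_assoc, e]
  refine key h ?_ ?_
  · clear key h e e5 e6 e1 e2 e3 e4 hp
    subst hb
    cases b <;> simp at h1 h2 h3 ⊢ <;> omega
  · clear key h e e5 e6 e1 e2 e3 e4 hp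
    subst hb
    cases b <;> simp at h1 h2 h3 ⊢ <;> omega

/-- A cancelling pair inserted after the first crossing gives it a neighbour of the opposite type
with the same difference as the second crossing. The two crossings left over have this smaller
difference as well. -/
theorem exists_lowers_of_eq {L : Link} {u v : List (Slice ℤ)} {xs ys : List ℤ} {b : Bool}
    {x y z : ℤ} (h : Colored L (u ++ braid xs ys [(false, b), (true, b)] x y z ++ v))
    (h2 : ((mkCrs b x y).tr - z).natAbs < (x - y).natAbs)
    (h3 : (mkCrs b x y).tr ≠ z) :
    ∃ w', Colored L w' ∧ Lowers (mkCrs b x y).abs (mkCrs b (mkCrs b x y).tr z).abs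
      (crossings (u ++ braid xs ys [(false, b), (true, b)] x y z ++ v)) (crossings w') := by
  have hl : BraidEq [(false, b), (true, b)] [(false, b), (true, !b), (true, b), (true, b)] := by
    have := (braidEq_cancel true (!b)).context [(false, b)] [(true, b)]
    rw [Bool.not_not] at this
    exact this.symm
  have h' := h.braid (by simp) _ hl (by cases b <;> simp [braidTop] <;> omega)
  set a := (mkCrs b x y).tr with ha
  set c := mkCrs (!b) a z with hc
  have e1 : mkCrs b c.tl c.tr = ⟨b, c.tl, c.tr, a, z⟩ := by
    rw [hc]; cases b <;> simp [mkCrs]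
  have e2 : LinkColoring.braid xs ys [(false, b), (true, !b), (true, b), (true, b)] x y z =
      LinkColoring.braid xs ys [(false, b), (true, !b)] x y z ++
        [⟨xs ++ [(mkCrs b x y).tl], .cross (mkCrs b c.tl c.tr), ys⟩,
          ⟨xs ++ [(mkCrs b x y).tl], .cross (mkCrs b a z), ys⟩] := by
    simp only [LinkColoring.braid, ← ha, ← hc, List.cons_append, List.nil_append, e1]
  rw [e2] at h'
  obtain ⟨w', hw, R, N, hR, ht, h4, h5⟩ := exists_lowers_of_ne (b' := !b) (u := u)
    (v := [⟨xs ++ [(mkCrs b x y).tl], .cross (mkCrs b c.tl c.tr), ys⟩,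
          ⟨xs ++ [(mkCrs b x y).tl], .cross (mkCrs b a z), ys⟩] ++ v)
    (by simpa only [List.append_assoc] using h') rfl h2 h3
  refine ⟨w', hw, crossings u + crossings v,
    N + {(mkCrs b c.tl c.tr).abs, (mkCrs b a z).abs}, ?_, ?_, ?_, ?_⟩
  · simp only [crossings_append]
    simp only [crossings, LinkColoring.braid, crs_cross, crs_nil, List.map_cons, List.map_nil,
      ← Multiset.cons_coe, Multiset.coe_nil, ← Multiset.singleton_add, ← ha]
    abel
  · rw [ht, add_assoc]
    congr 1
    simp only [crossings_append] at hR
    simp only [crossings, LinkColoring.braid, crs_cross, crs_nil, List.map_cons, List.map_nil,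
      ← Multiset.cons_coe, Multiset.coe_nil, ← Multiset.singleton_add, ← ha, ← hc] at hR ⊢
    have h6 : {(mkCrs b x y).abs} + ({c.abs} + R) = {(mkCrs b x y).abs} + ({c.abs} +
        ({(mkCrs b c.tl c.tr).abs} + ({(mkCrs b a z).abs} + (crossings u + crossings v)))) := by
      rw [← hR, crossings.eq_1 u, crossings.eq_1 v]
      abel
    rw [add_left_cancel (add_left_cancel h6)]
    simp only [crossings, Multiset.insert_eq_cons, ← Multiset.singleton_add]
    abel
  · simp only [Multiset.mem_add]
    rintro r (hr | hr)
    · exact h4 r hr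
    · simp only [Multiset.insert_eq_cons, Multiset.mem_cons, Multiset.mem_singleton] at hr
      rcases hr with rfl | rfl
      · rw [dif_mkCrs, dif_mkCrs]
        rw [hc]
        cases b <;> simp at h2 ⊢ <;> omega
      · rw [dif_mkCrs, dif_mkCrs]; omega
  · obtain ⟨r, hr, hr'⟩ := h5
    exact ⟨r, Multiset.mem_add.2 (.inl hr), hr'⟩

/-- Two neighbouring crossings with different, non-zero differences can be replaced by crossings
with smaller differences. -/
theorem exists_lowers {L : Link} {w : List (Slice ℤ)} (hw : Colored L w) {α : ℤ} {c1 c2 : Crs ℤ}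
    (h : Adjacent α c1 c2 w) (h0 : 0 < dif c2.abs) (h1 : dif c2.abs < dif c1.abs) :
    ∃ w', Colored L w' ∧ Lowers c1.abs c2.abs (crossings w) (crossings w') := by
  obtain ⟨h2, h3, u, v, xs, ys, rfl⟩ := h
  have f1 := fits_abs_iff.1 (hw.2 c1.abs (by simp [crossings]))
  have f2 := fits_abs_iff.1 (hw.2 c2.abs (by simp [crossings]))
  obtain ⟨b, x, y, p, q⟩ := c1
  obtain ⟨b', x', z, p', q'⟩ := c2
  dsimp only at *
  subst h3 h2
  have e : u ++ (⟨xs, .cross ⟨b, x, y, p, q⟩, z :: ys⟩ : Slice ℤ) ::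
      ⟨xs ++ [p], .cross ⟨b', q, z, p', q'⟩, ys⟩ :: v =
      u ++ LinkColoring.braid xs ys [(false, b), (true, b')] x y z ++ v := by
    have e1 : (mkCrs b x y).tl = p := by rw [← f1]
    have e2 : (mkCrs b x y).tr = q := by rw [← f1]
    simp [LinkColoring.braid, f1, f2, e1, e2]
  have e2 : (mkCrs b x y).tr = q := by rw [← f1]
  rw [e] at hw ⊢
  rw [f1, f2] at h1 ⊢
  rw [f2, dif_mkCrs] at h0
  rw [dif_mkCrs, dif_mkCrs] at h1
  rw [← e2] at h0 h1 ⊢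
  by_cases hb : b' = b
  · subst hb
    exact exists_lowers_of_eq hw (by omega) (by omega)
  · exact exists_lowers_of_ne hw (by cases b <;> cases b' <;> simp_all) (by omega) (by omega)

end LinkColoring

namespace LinkColoring
open Diagram

/-! ### Labelling the strands between the crossings -/

section
variable {S T : Type*}

/-- The labels of the four ends of a crossing. -/
def ports (p : Multiset S × Multiset S) : Multiset S := p.1 + p.2

/-- The labels of the ends of the crossings of a word. -/
def allPorts (w : List (Slice S)) : Multiset S := (crossings w).bind ports

theorem mem_ports_abs {c : Crs S} {s : S} :
    s ∈ ports c.abs ↔ s = c.bl ∨ s = c.br ∨ s = c.tl ∨ s = c.tr := by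
  obtain ⟨b, bl, br, tl, tr⟩ := c
  cases b <;> simp [ports, Crs.abs] <;> tauto

theorem ports_abs (c : Crs S) : ports c.abs = {c.bl, c.br, c.tl, c.tr} := by
  obtain ⟨b, bl, br, tl, tr⟩ := c
  classical
  ext s
  cases b <;> simp [ports, Crs.abs, Multiset.count_cons, Multiset.count_singleton] <;> omega

theorem mem_crossings {w : List (Slice S)} {p : Multiset S × Multiset S} :
    p ∈ crossings w ↔ ∃ c ∈ crs w, c.abs = p := by simp [crossings]

theorem Crs.once_of_count [DecidableEq S] {c : Crs S} {α : S}
    (h : (ports c.abs).count α = 1) : c.Once α := by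
  rw [ports_abs] at h
  simp only [Multiset.insert_eq_cons, Multiset.count_cons, Multiset.count_singleton] at h
  unfold Crs.Once
  by_cases h1 : α = c.bl <;> by_cases h2 : α = c.br <;> by_cases h3 : α = c.tl <;>
    by_cases h4 : α = c.tr <;> grind

/-- If the strand `α` joins only the crossings `X` and `Y`, these can be brought together. -/
theorem exists_adjacent [DecidableEq S] {L : Link} {w : List (Slice S)} (hw : Rep L w) {α : S}
    (hα : (allPorts w).count α ≤ 2) {X Y : Multiset S × Multiset S}
    {R : Multiset (Multiset S × Multiset S)} (h : crossings w = X ::ₘ Y ::ₘ R)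
    (hX : α ∈ ports X) (hY : α ∈ ports Y) :
    ∃ w' c1 c2, Rep L w' ∧ Adjacent α c1 c2 w' ∧ c1.abs = X ∧ c2.abs = Y ∧
      crossings w' = crossings w := by
  obtain ⟨c, hc, rfl⟩ := mem_crossings.1 (h ▸ Multiset.mem_cons_self _ _ : X ∈ crossings w)
  rw [allPorts, h, Multiset.cons_bind, Multiset.cons_bind, Multiset.count_add,
    Multiset.count_add] at hα
  have h1 := Multiset.count_pos.2 hX
  have h2 := Multiset.count_pos.2 hY
  obtain ⟨w', hp, c1, c2, had, hc1⟩ := hit_of_once hw.1 hc (Crs.once_of_count (α := α) (by omega))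
  have hr : Rep L w' ∧ crossings w' = crossings w := by
    rcases hp with hp | hp
    · exact ⟨hw.of_pl hp, (hp _ _ hw.1).2.2.symm⟩
    · exact ⟨hw.flip.of_pl hp, by rw [← (hp _ _ hw.flip.1).2.2, crossings_flipSlices]⟩
  refine ⟨w', c1, c2, hr.1, had, hc1, ?_, hr.2⟩
  obtain ⟨e1, e2, u, v, xs, ys, rfl⟩ := had
  by_contra hne
  have e : c.abs ::ₘ Y ::ₘ R = c1.abs ::ₘ c2.abs ::ₘ (crossings u + crossings v) := by
    rw [← h, ← hr.2]
    simp only [crossings, crs_append, crs_cross, List.map_append, List.map_cons,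
      ← Multiset.coe_add, ← Multiset.cons_coe, ← Multiset.singleton_add]
    abel
  rw [hc1, Multiset.cons_inj_right] at e
  -- `X` and `Y` already account for both ends labelled `α`, so a neighbour other than `Y` would be
  -- a third one.
  have h3 : c2.abs ∈ R := by
    have := Multiset.mem_cons_self c2.abs (crossings u + crossings v)
    rw [← e, Multiset.mem_cons] at this
    exact this.resolve_left hne
  have h4 : 0 < (R.bind ports).count α := by
    rw [Multiset.count_pos, Multiset.mem_bind]
    exact ⟨_, h3, mem_ports_abs.2 (by simp [e2])⟩
  omega

theorem mapWord_mapWord {U : Type*} (g : T → U) (f : S → T) (w : List (Slice S)) :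
    mapWord g (mapWord f w) = mapWord (g ∘ f) w := by
  have h1 : ∀ p : LPiece S, (p.map f).map g = p.map (g ∘ f) := by rintro (s | s | c) <;> rfl
  simp [mapWord, Slice.map, h1]

theorem Crs.abs_map (f : S → T) (c : Crs S) :
    (c.map f).abs = (c.abs.1.map f, c.abs.2.map f) := by
  obtain ⟨b, bl, br, tl, tr⟩ := c
  cases b <;> simp [Crs.abs, Crs.map]

theorem crossings_mapWord (f : S → T) (w : List (Slice S)) :
    crossings (mapWord f w) = (crossings w).map fun p => (p.1.map f, p.2.map f) := by
  simp [crossings, Function.comp_def, Crs.abs_map]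

theorem allPorts_mapWord (f : S → T) (w : List (Slice S)) :
    allPorts (mapWord f w) = (allPorts w).map f := by
  simp [allPorts, crossings_mapWord, Multiset.bind_map, Multiset.map_bind, ports]

theorem allPorts_append (u v : List (Slice S)) :
    allPorts (u ++ v) = allPorts u + allPorts v := by
  simp [allPorts]

theorem count_map_merge [DecidableEq S] (M : Multiset S) {p q : S} (hpq : p ≠ q) (s : S) :
    (M.map fun x => if x = q then p else x).count s ≤
      if s = p then M.count p + M.count q else M.count s := by
  induction M using Multiset.induction_on with
  | empty => simp
  | cons a M ih =>
    simp only [Multiset.map_cons, Multiset.count_cons]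
    split_ifs at ih ⊢ <;> grind

end

theorem count_add_fresh_le {S : Type*} [DecidableEq S] {M F : Multiset S}
    (hM : ∀ s, M.count s ≤ 2) (hF : F.Nodup) (h : ∀ s ∈ F, s ∉ M) (s : S) :
    (M + F + F).count s ≤ 2 := by
  rw [Multiset.count_add, Multiset.count_add]
  have h1 := Multiset.nodup_iff_count_le_one.1 hF s
  by_cases hs : s ∈ F
  · rw [Multiset.count_eq_zero.2 (h s hs)]; omega
  · rw [Multiset.count_eq_zero.2 hs]; exact hM s

theorem exists_fresh (M : Multiset (ℤ × ℕ)) : ∃ k, ∀ s ∈ M, s.2 < k := by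
  induction M using Multiset.induction_on with
  | empty => exact ⟨0, by simp⟩
  | cons a M ih =>
    obtain ⟨k, hk⟩ := ih
    refine ⟨max k (a.2 + 1), ?_⟩
    intro s hs
    rcases Multiset.mem_cons.1 hs with rfl | hs
    · simp
    · have := hk s hs; omega

/-- Colors do not tell strands apart, so an index is added, from the bottom up: minima and crossings
create fresh labels, and a maximum identifies the labels of the strands it joins. The invariant
counts the open ends at the top together with the ends at crossings. -/
theorem exists_label {w : List (Slice ℤ)} {n : List ℤ} (hw : Chain w [] n) :
    ∃ (w' : List (Slice (ℤ × ℕ))) (n' : List (ℤ × ℕ)), Chain w' [] n' ∧ n'.map Prod.fst = n ∧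
      mapWord Prod.fst w' = w ∧ ∀ s, (allPorts w' + n').count s ≤ 2 := by
  induction w using List.reverseRecOn generalizing n with
  | nil => cases hw; exact ⟨[], [], rfl, rfl, rfl, by simp [allPorts, crossings]⟩
  | append_singleton w s ih =>
    obtain ⟨m, hwm, hs, rfl⟩ := chain_append.1 hw
    obtain ⟨w', n', h1, h2, h3, h4⟩ := ih hwm
    obtain ⟨k, hk⟩ := exists_fresh (allPorts w' + n')
    obtain ⟨xs, p, ys⟩ := s
    rw [← hs, Slice.bot] at h2
    dsimp only at h2
    obtain ⟨xs', r, rfl, rfl, h5⟩ := List.map_eq_append_iff.1 h2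
    clear h2
    obtain ⟨b, ys', rfl, h2, rfl⟩ := List.map_eq_append_iff.1 h5
    clear h5
    have hk0 : ∀ (a : ℤ) (j : ℕ),
        (a, k + j) ∉ allPorts w' + ((xs' ++ (b ++ ys') : List (ℤ × ℕ)) : Multiset (ℤ × ℕ)) := by
      intro a j h
      have := hk _ h
      simp at this
    cases p with
    | cup a =>
      simp only [LPiece.bot_cup, List.map_eq_nil_iff] at h2
      subst h2
      refine ⟨w' ++ [⟨xs', .cup (a, k), ys'⟩], xs' ++ ((a, k) :: (a, k) :: ys'),
        chain_append.2 ⟨_, h1, by simp [Slice.bot], by simp [Chain, Slice.top]⟩, by simp [Slice.top],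
        by simp [h3, Slice.map, LPiece.map], ?_⟩
      intro s
      have h5 := count_add_fresh_le h4 (F := {(a, k)}) (by simp) (by simpa using hk0 a 0) s
      have e : allPorts [(⟨xs', .cup (a, k), ys'⟩ : Slice (ℤ × ℕ))] = 0 := by
        simp [allPorts, crossings]
      rw [allPorts_append, e, add_zero]
      refine le_trans (le_of_eq ?_) h5
      simp only [Multiset.count_add, Multiset.coe_count, List.count_append, List.nil_append,
        List.count_cons, Multiset.count_singleton]
      by_cases h : s = (a, k)
      · subst h; simp; omega
      · simp [h, Ne.symm h]
    | cap a =>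
      obtain ⟨⟨p1, p2⟩, b, rfl, hp, h2⟩ := List.map_eq_cons_iff.1 h2
      obtain ⟨⟨q1, q2⟩, b, rfl, hq, h2⟩ := List.map_eq_cons_iff.1 h2
      simp only [List.map_eq_nil_iff] at h2
      dsimp only at hp hq
      subst h2 hp
      -- The merged label occurs at most 2 + 2 times, and two of these are the open ends that the
      -- maximum closes.
      set f : ℤ × ℕ → ℤ × ℕ := fun x => if x = (q1, q2) then (p1, p2) else x with hf
      have hfst : Prod.fst ∘ f = Prod.fst := by
        funext x
        simp only [hf, Function.comp_apply]
        split_ifs with h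
        · rw [h]; exact hq.symm
        · rfl
      have hfp : f (p1, p2) = (p1, p2) := by simp only [hf]; split_ifs <;> rfl
      have hfq : f (q1, q2) = (p1, p2) := by simp [hf]
      refine ⟨mapWord f w' ++ [⟨xs'.map f, .cap (p1, p2), ys'.map f⟩], xs'.map f ++ ys'.map f,
        chain_append.2 ⟨_, h1.map f, ?_, by simp [Chain, Slice.top]⟩, ?_, ?_, ?_⟩
      · simp [Slice.bot, hfp, hfq]
      · simp [hfst, Slice.top]
      · simp [mapWord_mapWord, hfst, h3, Slice.map, LPiece.map]
      · intro s
        have e : allPorts [(⟨xs'.map f, .cap (p1, p2), ys'.map f⟩ : Slice (ℤ × ℕ))] = 0 := by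
          simp [allPorts, crossings]
        have e' : (allPorts w' + (xs' ++ ([(p1, p2), (q1, q2)] ++ ys') : List _)).map f =
            (allPorts w').map f + (xs'.map f ++ ys'.map f : List _) + {(p1, p2), (p1, p2)} := by
          simp only [Multiset.map_add, Multiset.map_coe,
            ← Multiset.coe_add, ← Multiset.cons_coe, Multiset.coe_nil,
            Multiset.insert_eq_cons, ← Multiset.singleton_add, Multiset.map_singleton,
            Multiset.map_zero, hfp, hfq]
          abel
        rw [allPorts_append, allPorts_mapWord, e, add_zero]
        have e2 := congrArg (Multiset.count s) e'
        rw [Multiset.count_add _ _ {(p1, p2), (p1, p2)}] at e2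
        by_cases hpq : (p1, p2) = (q1, q2)
        · have : f = id := by
            funext x
            simp only [hf, id, hpq]
            split_ifs with h <;> simp [h]
          rw [this, Multiset.map_id] at e2
          have h6 := h4 s
          rw [this]
          omega
        · have h5 := count_map_merge (allPorts w' + ((xs' ++ ([(p1, p2), (q1, q2)] ++ ys') :
            List (ℤ × ℕ)) : Multiset (ℤ × ℕ))) hpq s
          have h6 := h4 s
          have h7 := h4 (p1, p2)
          have h8 := h4 (q1, q2)
          rw [← hf, e2] at h5
          split_ifs at h5 with h
          · subst h
            simp only [Multiset.insert_eq_cons, Multiset.count_cons_self,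
              Multiset.count_singleton_self] at h5
            omega
          · omega
    | cross c =>
      obtain ⟨⟨p1, p2⟩, b, rfl, hp, h2⟩ := List.map_eq_cons_iff.1 h2
      obtain ⟨⟨q1, q2⟩, b, rfl, hq, h2⟩ := List.map_eq_cons_iff.1 h2
      simp only [List.map_eq_nil_iff] at h2
      dsimp only at hp hq
      subst h2 
      refine ⟨w' ++ [⟨xs', .cross ⟨c.b, (p1, p2), (q1, q2), (c.tl, k), (c.tr, k + 1)⟩, ys'⟩],
        xs' ++ ((c.tl, k) :: (c.tr, k + 1) :: ys'),
        chain_append.2 ⟨_, h1, by simp [Slice.bot], by simp [Chain, Slice.top]⟩, by simp [Slice.top],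
        by simp [h3, Slice.map, LPiece.map, Crs.map, hp, hq], ?_⟩
      intro s
      have h5 := count_add_fresh_le h4 (F := {(c.tl, k), (c.tr, k + 1)}) (by simp)
        (by
          simp only [Multiset.insert_eq_cons, Multiset.mem_cons, Multiset.mem_singleton,
            forall_eq_or_imp, forall_eq]
          exact ⟨hk0 _ 0, hk0 _ 1⟩) s
      have e : allPorts [(⟨xs', .cross ⟨c.b, (p1, p2), (q1, q2), (c.tl, k), (c.tr, k + 1)⟩, ys'⟩ :
          Slice (ℤ × ℕ))] = {(p1, p2), (q1, q2), (c.tl, k), (c.tr, k + 1)} := by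
        simp [allPorts, crossings, ports_abs]
      rw [allPorts_append, e]
      refine le_trans (le_of_eq ?_) h5
      congr 1
      simp only [← Multiset.coe_add, ← Multiset.cons_coe, Multiset.coe_nil,
        Multiset.insert_eq_cons, ← Multiset.singleton_add]
      abel

theorem Rep.exists_label {L : Link} {w : List (Slice ℤ)} (hw : Rep L w) :
    ∃ w' : List (Slice (ℤ × ℕ)), Rep L w' ∧ mapWord Prod.fst w' = w ∧
      ∀ s, (allPorts w').count s ≤ 2 := by
  obtain ⟨w', n', h1, h2, h3, h4⟩ := LinkColoring.exists_label hw.1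
  rw [List.map_eq_nil_iff] at h2
  subst h2
  exact ⟨w', hw.of_eq h1 (.of_eq (by rw [← h3, erase_mapWord])), h3, by simpa using h4⟩

end LinkColoring

namespace LinkColoring
open Diagram

/-! ### Surrounding the crossings with one color -/

/-- The colors at a crossing. -/
def col (p : Multiset (ℤ × ℕ) × Multiset (ℤ × ℕ)) : Multiset ℤ × Multiset ℤ :=
  (p.1.map Prod.fst, p.2.map Prod.fst)

theorem col_abs (c : Crs (ℤ × ℕ)) : col c.abs = (c.map Prod.fst).abs := (Crs.abs_map _ _).symm

theorem dif_abs (c : Crs ℤ) : dif c.abs = (c.bl - c.br).natAbs + (c.bl - c.tl).natAbs +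
    (c.tr - c.br).natAbs + (c.tr - c.tl).natAbs := by
  obtain ⟨b, bl, br, tl, tr⟩ := c
  cases b <;> simp [dif, Crs.abs] <;> omega

theorem fits_abs (c : Crs ℤ) : Fits c.abs ↔
    (c.b = true → 2 * c.bl = c.br + c.tl ∧ 2 * c.tr = c.br + c.tl) ∧
    (c.b = false → 2 * c.br = c.bl + c.tr ∧ 2 * c.tl = c.bl + c.tr) := by
  obtain ⟨b, bl, br, tl, tr⟩ := c
  cases b <;> simp [Fits, Crs.abs]

/-- A colored word that represents `L`, its strands between the crossings having different
labels. -/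
def Labelled (L : Link) (w : List (Slice (ℤ × ℕ))) : Prop :=
  Rep L w ∧ (∀ s, (allPorts w).count s ≤ 2) ∧ ∀ p ∈ crossings w, Fits (col p)

theorem crossings_map_fst (w : List (Slice (ℤ × ℕ))) :
    crossings (mapWord Prod.fst w) = (crossings w).map col := crossings_mapWord _ _

theorem Colored.exists_labelled {L : Link} {w : List (Slice ℤ)} (h : Colored L w) :
    ∃ w', Labelled L w' ∧ mapWord Prod.fst w' = w := by
  obtain ⟨w', h1, h2, h3⟩ := h.1.exists_label
  refine ⟨w', ⟨h1, h3, ?_⟩, h2⟩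
  have := h.2
  rw [← h2, crossings_map_fst] at this
  exact Multiset.forall_mem_map_iff.1 this

/-- The slide carries the strand of the second crossing across the first. The cancelling pair added
on top puts a crossing at the remaining end of the first one. -/
theorem braidEq_surround (b b' : Bool) :
    BraidEq [(false, b), (true, b')]
      [(true, b'), (false, b'), (true, b), (false, !b'), (true, !b'), (true, b')] := by
  have h1 := braidEq_slide false b b' b' (.inr rfl)
  have h2 := ((braidEq_cancel true (!b')).context
    [(true, b'), (false, b'), (true, b), (false, !b')] []).symm
  rw [Bool.not_not] at h2
  exact h1.trans h2

/-- A crossing `Z` of one color next to `Y` becomes a crossing `Z'` of one color, all of whose ends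
lead to crossings `N` with the difference of `Y`. The ends of `Y` still lie on such crossings, so
nothing already reached is lost. -/
theorem Labelled.surround {L : Link} {w : List (Slice (ℤ × ℕ))} (hw : Labelled L w)
    {Z Y : Multiset (ℤ × ℕ) × Multiset (ℤ × ℕ)} {R : Multiset _} (h : crossings w = Z ::ₘ Y ::ₘ R)
    {α : ℤ × ℕ} (hZ : α ∈ ports Z) (hY : α ∈ ports Y) (h0 : dif (col Z) = 0) :
    ∃ w' Z' N, Labelled L w' ∧ crossings w' = Z' ::ₘ (N + R) ∧ dif (col Z') = 0 ∧
      (∀ n ∈ N, dif (col n) = dif (col Y)) ∧ (∀ s ∈ ports Z', ∃ n ∈ N, s ∈ ports n) ∧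
      ∀ s ∈ ports Y, ∃ n ∈ N, s ∈ ports n := by
  obtain ⟨w1, c1, c2, hr, ⟨e1, e2, u, v, xs, ys, rfl⟩, rfl, rfl, hcr⟩ :=
    exists_adjacent hw.1 (hw.2.1 α) h hZ hY
  have hfit := hw.2.2
  have hcount := hw.2.1
  rw [allPorts, ← hcr] at hcount
  rw [← hcr] at hfit
  obtain ⟨k, hk⟩ := exists_fresh (allPorts w)
  rw [allPorts, ← hcr] at hk
  have hR : crossings u + crossings v = R := by
    rw [h] at hcr
    have : c1.abs ::ₘ c2.abs ::ₘ (crossings u + crossings v) = c1.abs ::ₘ c2.abs ::ₘ R := by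
      rw [← hcr]
      simp only [crossings, crs_append, crs_cross, List.map_append, List.map_cons,
        ← Multiset.coe_add, ← Multiset.cons_coe, ← Multiset.singleton_add]
      abel
    simpa using this
  have f1 := hfit c1.abs (by simp [crossings])
  have f2 := hfit c2.abs (by simp [crossings])
  rw [col_abs] at f1 f2 h0
  rw [fits_abs] at f1 f2
  rw [dif_abs] at h0
  clear hZ hY hw
  obtain ⟨b, s1, s2, t, α'⟩ := c1
  obtain ⟨b', x, s3, r1, r2⟩ := c2
  dsimp only at e1 e2
  subst e1 e2
  simp only [Crs.map] at f1 f2 h0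
  let f : ℤ × ℕ := (r1.1, k)
  let g : ℤ × ℕ := (r2.1, k + 1)
  let i : ℤ × ℕ := ((mkCrs b' x.1 r1.1).tl, k + 2)
  let l : ℤ × ℕ := ((mkCrs b' x.1 r1.1).tr, k + 3)
  let j : ℤ × ℕ := (r2.1, k + 4)
  let r2' : ℤ × ℕ := (r2.1, k + 5)
  let r1' : ℤ × ℕ := ((mkCrs (!b') (mkCrs b' x.1 r1.1).tl r2.1).tr, k + 6)
  let s3' : ℤ × ℕ := (s3.1, k + 7)
  let a : List (Slice (ℤ × ℕ)) := [⟨xs, .cross ⟨b, s1, s2, t, x⟩, s3 :: ys⟩,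
    ⟨xs ++ [t], .cross ⟨b', x, s3, r1, r2⟩, ys⟩]
  let a' : List (Slice (ℤ × ℕ)) := [⟨xs ++ [s1], .cross ⟨b', s2, s3, f, g⟩, ys⟩,
    ⟨xs, .cross ⟨b', s1, f, i, l⟩, g :: ys⟩, ⟨xs ++ [i], .cross ⟨b, l, g, j, r2'⟩, ys⟩,
    ⟨xs, .cross ⟨!b', i, j, t, r1'⟩, r2' :: ys⟩, ⟨xs ++ [t], .cross ⟨!b', r1', r2', x, s3'⟩, ys⟩,
    ⟨xs ++ [t], .cross ⟨b', x, s3', r1, r2⟩, ys⟩]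
  have hrep : Rep L (u ++ a' ++ v) := by
    refine Rep.replace (a := a) (m := xs ++ s1 :: s2 :: s3 :: ys) (n := xs ++ t :: r1 :: r2 :: ys)
      (by simpa [a] using hr) ?_ ?_ ?_ ?_
    · simp [a, Chain, Slice.bot, Slice.top]
    · simp [a', Chain, Slice.bot, Slice.top]
    · rintro m' n' ⟨rfl, -, rfl⟩
      simp [Slice.bot, Slice.top]
    · have := braidEq_surround b b' xs.length ys.length
      simpa [a, a', braidWord, Slice.layer, LPiece.toPiece, add_assoc, add_comm, add_left_comm]
        using this
  refine ⟨_, (⟨b, l, g, j, r2'⟩ : Crs _).abs, {(⟨b', s2, s3, f, g⟩ : Crs _).abs,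
    (⟨b', s1, f, i, l⟩ : Crs _).abs, (⟨!b', i, j, t, r1'⟩ : Crs _).abs,
    (⟨!b', r1', r2', x, s3'⟩ : Crs _).abs, (⟨b', x, s3', r1, r2⟩ : Crs _).abs},
    ⟨hrep, ?_, ?_⟩, ?_, ?_, ?_, ?_, ?_⟩
  -- The old ends keep their multiplicities, and each of the eight fresh labels occurs exactly
  -- twice.
  · have := count_add_fresh_le hcount (F := {f, g, i, l, j, r2', r1', s3'}) ?_ ?_
    · intro s
      refine le_trans (le_of_eq ?_) (this s)
      congr 1
      simp only [allPorts, crossings_append, Multiset.add_bind]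
      simp only [a', crossings, crs_cross, List.map_cons,
        ← Multiset.coe_add, ← Multiset.cons_coe, Multiset.cons_bind, ports_abs, crs_nil,
        List.map_nil, Multiset.coe_nil, Multiset.zero_bind, Multiset.add_bind,
        Multiset.singleton_bind, Multiset.insert_eq_cons, ← Multiset.singleton_add]
      abel
    · simp [f, g, i, l, j, r2', r1', s3']
    · intro s hs hs'
      have := hk s hs'
      simp only [Multiset.insert_eq_cons, Multiset.mem_cons, Multiset.mem_singleton, f, g, i, l, j,
        r2', r1', s3'] at hs
      rcases hs with rfl | rfl | rfl | rfl | rfl | rfl | rfl | rfl <;> simp at this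
  · simp only [crossings_append, Multiset.mem_add] at hfit ⊢
    rintro p ((hp | hp) | hp)
    · exact hfit p (.inl hp)
    · simp only [a', crossings, crs_cross, crs_nil, List.map_cons, List.map_nil, Multiset.mem_coe,
        List.mem_cons, List.not_mem_nil, or_false] at hp
      rcases hp with rfl | rfl | rfl | rfl | rfl | rfl <;> rw [col_abs, fits_abs] <;>
      cases b <;> cases b' <;> simp [Crs.map, f, g, i, l, j, r2', r1', s3'] at f1 f2 h0 ⊢ <;> omega
    · refine hfit p (.inr ?_)
      simp only [crossings, crs_cross, List.map_cons, Multiset.mem_coe, List.mem_cons] at hp ⊢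
      tauto
  · rw [← hR]
    simp only [crossings_append]
    simp only [a', crossings, crs_cross, crs_nil, List.map_cons, List.map_nil,
        ← Multiset.cons_coe, Multiset.coe_nil, 
        Multiset.insert_eq_cons, ← Multiset.singleton_add]
    abel
  · rw [col_abs, dif_abs]
    cases b <;> cases b' <;> simp [Crs.map, g, l, j, r2'] at f1 f2 h0 ⊢ <;> omega
  · simp only [Multiset.insert_eq_cons, Multiset.mem_cons, Multiset.mem_singleton,
      forall_eq_or_imp, forall_eq, col_abs, dif_abs]
    cases b <;> cases b' <;> simp [Crs.map, f, g, i, l, j, r2', r1', s3'] at f1 f2 h0 ⊢ <;> omega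
  · simp only [Multiset.insert_eq_cons, Multiset.mem_cons, Multiset.mem_singleton,
      exists_eq_or_imp, exists_eq_left, mem_ports_abs]
    rintro s (rfl | rfl | rfl | rfl) <;> simp only [true_or, or_true]
  · simp only [Multiset.insert_eq_cons, Multiset.mem_cons, Multiset.mem_singleton,
      exists_eq_or_imp, exists_eq_left, mem_ports_abs]
    rintro s (rfl | rfl | rfl | rfl) <;> simp only [true_or, or_true]

end LinkColoring

namespace LinkColoring
open Diagram

/-! ### Making all differences equal -/

theorem strand_of_mem_ports {S : Type*} {w : List (Slice S)} {p : Multiset S × Multiset S}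
    (hp : p ∈ crossings w) {s : S} (hs : s ∈ ports p) : Strand w s := by
  obtain ⟨c, hc, rfl⟩ := mem_crossings.1 hp
  obtain ⟨u, x, y, v, rfl⟩ := mem_crs.1 hc
  refine ⟨⟨x, .cross c, y⟩, by simp, ?_⟩
  rw [mem_ports_abs] at hs
  simp only [Slice.bot, Slice.top, LPiece.bot_cross, LPiece.top_cross, List.mem_append,
    List.mem_cons]
  tauto

theorem Crs.splits_of_forall {S : Type*} {A : S → Prop} {c : Crs S}
    (h : (∀ s ∈ ports c.abs, A s) ∨ ∀ s ∈ ports c.abs, ¬ A s) : c.Splits A := by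
  simp only [mem_ports_abs, forall_eq_or_imp, forall_eq] at h
  unfold Crs.Splits
  tauto

/-- In a diagram of a non-splittable link, a set of strands that is not empty and does not contain
all strands appears at some crossing along with its complement, unless it contains a given
crossing. -/
theorem Rep.exists_mixed {S : Type*} {L : Link} (hL : ¬ L.IsSplittable) {w : List (Slice S)}
    (hw : Rep L w) (A : S → Prop) {X : Multiset S × Multiset S} (hX : X ∈ crossings w)
    {s : S} (hs : Strand w s) (hA : A s) :
    (∀ s ∈ ports X, A s) ∨
      ∃ Z ∈ crossings w, (∃ s ∈ ports Z, A s) ∧ ∃ s ∈ ports Z, ¬ A s := by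
  by_contra! hcon
  have hsp : ∀ c ∈ crs w, c.Splits A := by
    intro c hc
    refine Crs.splits_of_forall ?_
    by_cases h : ∃ s ∈ ports c.abs, A s
    · exact .inl (hcon.2 c.abs (mem_crossings.2 ⟨c, hc, rfl⟩) h)
    · push Not at h
      exact .inr h
  rcases hw.all_or_none hL A hsp with h | h
  · obtain ⟨⟨t, ht, ht'⟩, -⟩ := hcon
    exact ht' (h t (strand_of_mem_ports hX ht))
  · exact h s hs hA

theorem countP_le_countP {T : Type*} {M : Multiset T} {p q : T → Prop} [DecidablePred p]
    [DecidablePred q] (h : ∀ x ∈ M, p x → q x) : M.countP p ≤ M.countP q := by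
  induction M using Quotient.inductionOn with
  | h l => simpa using List.countP_mono_left (by simpa using h)

/-- `s` is an end of a crossing with a difference between `0` and `D`. -/
def Inner (D : ℕ) (M : Multiset (Multiset (ℤ × ℕ) × Multiset (ℤ × ℕ))) (s : ℤ × ℕ) : Prop :=
  ∃ p ∈ M, 0 < dif (col p) ∧ dif (col p) < D ∧ s ∈ ports p

open scoped Classical in
/-- The number of crossings with one color that have an end which is not `Inner`. -/
noncomputable def unsurrounded (D : ℕ) (M : Multiset (Multiset (ℤ × ℕ) × Multiset (ℤ × ℕ))) : ℕ :=
  M.countP fun p => dif (col p) = 0 ∧ ∃ s ∈ ports p, ¬ Inner D M s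

/-- Intermediate differences spread through the diagram over crossings of one color until they touch
a crossing with the largest difference `D`, which is then lowered. The spreading ends because each
use of `Labelled.surround` makes `unsurrounded` smaller and keeps the number of crossings of
difference `D`. -/
theorem Labelled.reduce {L : Link} (hL : ¬ L.IsSplittable) {D : ℕ} :
    ∀ {w : List (Slice (ℤ × ℕ))}, Labelled L w → (∀ p ∈ crossings w, dif (col p) ≤ D) →
    (∃ p ∈ crossings w, dif (col p) = D) →
    (∃ p ∈ crossings w, 0 < dif (col p) ∧ dif (col p) < D) →
    ∃ w', Colored L w' ∧ (∀ p ∈ crossings w', dif p ≤ D) ∧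
      (crossings w').countP (fun p => dif p = D) <
        ((crossings w).map col).countP (fun p => dif p = D) ∧
      ∃ p ∈ crossings w', 0 < dif p := by
  intro w
  induction hU : unsurrounded D (crossings w) using Nat.strong_induction_on generalizing w with
  | _ n ih =>
  subst hU
  rintro hw hle ⟨X, hX, hXD⟩ ⟨Y0, hY0, h0, h1⟩
  have hY0' := hY0
  obtain ⟨c0, hc0, rfl⟩ := mem_crossings.1 hY0
  -- A crossing with one end `Inner` and another not has no intermediate difference, so its
  -- difference is `D` or 0. Such a crossing exists unless all ends of `X` are `Inner`, in which
  -- case `X` serves.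
  have key : ∃ Z ∈ crossings w, (dif (col Z) = D ∨ (dif (col Z) = 0 ∧
      ∃ s ∈ ports Z, ¬ Inner D (crossings w) s)) ∧ ∃ s ∈ ports Z, Inner D (crossings w) s := by
    have hbl : c0.bl ∈ ports c0.abs := mem_ports_abs.2 (.inl rfl)
    rcases hw.1.exists_mixed hL (Inner D (crossings w)) hX (strand_of_mem_ports hY0 hbl)
      ⟨_, hY0, h0, h1, hbl⟩ with h | ⟨Z, hZ, h2, t, ht, ht'⟩
    · obtain ⟨c, hc, rfl⟩ := mem_crossings.1 hX
      have hbl : c.bl ∈ ports c.abs := mem_ports_abs.2 (.inl rfl)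
      exact ⟨_, hX, .inl hXD, _, hbl, h _ hbl⟩
    · refine ⟨Z, hZ, ?_, h2⟩
      have h3 := hle Z hZ
      have h4 : ¬ (0 < dif (col Z) ∧ dif (col Z) < D) := fun h => ht' ⟨Z, hZ, h.1, h.2, ht⟩
      rcases Nat.eq_zero_or_pos (dif (col Z)) with h | h
      · exact .inr ⟨h, t, ht, ht'⟩
      · exact .inl (by omega)
  obtain ⟨Z, hZ, hZ2, α, hα, Y, hY, hY1, hY2, hαY⟩ := key
  obtain ⟨R0, hR0⟩ := Multiset.exists_cons_of_mem hZ
  have hYR : Y ∈ R0 := by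
    rw [hR0, Multiset.mem_cons] at hY
    rcases hY with rfl | hY
    · omega
    · exact hY
  obtain ⟨R, rfl⟩ := Multiset.exists_cons_of_mem hYR
  rcases hZ2 with hZ2 | ⟨hZ2, t, ht, ht'⟩
  · obtain ⟨w1, c1, c2, hr, had, rfl, rfl, hcr⟩ := exists_adjacent hw.1 (hw.2.1 α) hR0 hα hαY
    have hc1 : Colored L (mapWord Prod.fst w1) := by
      refine ⟨hr.map _, ?_⟩
      rw [crossings_map_fst, hcr]
      exact Multiset.forall_mem_map_iff.2 hw.2.2
    have had' : Adjacent α.1 (c1.map Prod.fst) (c2.map Prod.fst) (mapWord Prod.fst w1) := by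
      obtain ⟨e1, e2, u, v, xs, ys, rfl⟩ := had
      refine ⟨by simp [Crs.map, e1], by simp [Crs.map, e2], mapWord Prod.fst u,
        mapWord Prod.fst v, xs.map Prod.fst, ys.map Prod.fst, ?_⟩
      simp [Slice.map, LPiece.map, Crs.map]
    rw [col_abs] at hZ2 hY1 hY2
    obtain ⟨w', hw', R', N, hR', ht, h5, h6⟩ := exists_lowers hc1 had' hY1 (by omega)
    rw [crossings_map_fst, hcr] at hR'
    refine ⟨w', hw', ?_, ?_, ?_⟩
    · intro p hp
      rw [ht, Multiset.mem_add] at hp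
      rcases hp with hp | hp
      · have := h5 p hp; omega
      · have : p ∈ (crossings w).map col := by rw [hR']; simp [hp]
        obtain ⟨q, hq, rfl⟩ := Multiset.mem_map.1 this
        exact hle q hq
    · rw [hR', ht, Multiset.countP_add, Multiset.countP_cons, Multiset.countP_cons, if_pos hZ2,
        if_neg (by omega)]
      rw [Multiset.countP_eq_zero.2 fun p hp => by have := h5 p hp; omega]
      omega
    · obtain ⟨r, hr, hr'⟩ := h6
      exact ⟨r, by rw [ht]; simp [hr], hr'⟩
  · obtain ⟨w', Z', N, hw', hcr, hz0, hN, hsur, hYp⟩ := hw.surround hR0 hα hαY hZ2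
    have hmono : ∀ s, Inner D (crossings w) s → Inner D (crossings w') s := by
      rintro s ⟨p, hp, h2, h3, h4⟩
      rw [hR0, Multiset.mem_cons, Multiset.mem_cons] at hp
      rcases hp with rfl | rfl | hp
      · omega
      · obtain ⟨n, hn, hs⟩ := hYp s h4
        exact ⟨n, by rw [hcr]; simp [hn], by rw [hN n hn]; exact h2, by rw [hN n hn]; exact h3, hs⟩
      · exact ⟨p, by rw [hcr]; simp [hp], h2, h3, h4⟩
    have hsur' : ∀ s ∈ ports Z', Inner D (crossings w') s := by
      intro s hs
      obtain ⟨n, hn, hs⟩ := hsur s hs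
      exact ⟨n, by rw [hcr]; simp [hn], by rw [hN n hn]; exact hY1, by rw [hN n hn]; exact hY2, hs⟩
    have hlt : unsurrounded D (crossings w') < unsurrounded D (crossings w) := by
      unfold unsurrounded
      classical
      have e1 := congrArg (Multiset.countP
        fun p => dif (col p) = 0 ∧ ∃ s ∈ ports p, ¬ Inner D (crossings w') s) hcr
      have e2 := congrArg (Multiset.countP
        fun p => dif (col p) = 0 ∧ ∃ s ∈ ports p, ¬ Inner D (crossings w) s) hR0
      rw [Multiset.countP_cons_of_neg _ (by rintro ⟨-, s, hs, hs'⟩; exact hs' (hsur' s hs)),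
        Multiset.countP_add,
        Multiset.countP_eq_zero (s := N).2 fun p hp h => by rw [hN p hp] at h; omega] at e1
      rw [Multiset.countP_cons_of_pos _ ⟨hZ2, t, ht, ht'⟩, Multiset.countP_cons] at e2
      have := countP_le_countP (M := R)
        (p := fun p => dif (col p) = 0 ∧ ∃ s ∈ ports p, ¬ Inner D (crossings w') s)
        (q := fun p => dif (col p) = 0 ∧ ∃ s ∈ ports p, ¬ Inner D (crossings w) s)
        fun p _ ⟨h1, s, h2, h3⟩ => ⟨h1, s, h2, fun h => h3 (hmono s h)⟩
      omega
    have hXR : X ∈ R := by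
      rw [hR0, Multiset.mem_cons, Multiset.mem_cons] at hX
      rcases hX with rfl | rfl | hX
      · omega
      · omega
      · exact hX
    obtain ⟨n0, hn0, -⟩ := hYp α hαY
    have hle' : ∀ p ∈ crossings w', dif (col p) ≤ D := by
      intro p hp
      rw [hcr, Multiset.mem_cons, Multiset.mem_add] at hp
      rcases hp with rfl | hp | hp
      · omega
      · rw [hN p hp]; omega
      · exact hle p (by rw [hR0]; simp [hp])
    obtain ⟨w'', h2, h3, h4, h5⟩ := ih _ hlt rfl hw' hle' ⟨X, by rw [hcr]; simp [hXR], hXD⟩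
      ⟨n0, by rw [hcr]; simp [hn0], by rw [hN _ hn0]; exact hY1, by rw [hN _ hn0]; exact hY2⟩
    refine ⟨w'', h2, h3, h4.trans_le (le_of_eq ?_), h5⟩
    rw [hcr, hR0]
    simp only [Multiset.countP_map, Multiset.map_cons, Multiset.countP_cons, Multiset.map_add,
      Multiset.countP_add]
    rw [if_neg (by omega), if_neg (by omega), if_neg (by omega)]
    rw [Multiset.filter_eq_nil.2 fun p hp => by rw [hN p hp]; omega]
    simp

/-- If a non-splittable link has a non-trivial coloring, it has one for which the crossings that
do not have one color all have the same difference. -/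
theorem Colored.exists_uniform {L : Link} (hL : ¬ L.IsSplittable) (D : ℕ) :
    ∀ {w : List (Slice ℤ)}, Colored L w → (∀ p ∈ crossings w, dif p ≤ D) →
    (∃ p ∈ crossings w, 0 < dif p) →
    ∃ w', Colored L w' ∧ ∃ d, 0 < d ∧ (∃ p ∈ crossings w', dif p = d) ∧
      ∀ p ∈ crossings w', dif p = 0 ∨ dif p = d := by
  induction D with
  | zero =>
    rintro w - h ⟨p, hp, h0⟩
    have := h p hp
    omega
  | succ D ihD =>
    intro w
    induction hn : (crossings w).countP (fun p => dif p = D + 1) using Nat.strong_induction_on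
      generalizing w with
    | _ n ih =>
    subst hn
    intro hw hle hpos
    -- Double induction: on the bound for the differences and, inside, on the number of crossings
    -- that attain it.
    by_cases h1 : ∃ p ∈ crossings w, dif p = D + 1
    · by_cases h2 : ∃ p ∈ crossings w, 0 < dif p ∧ dif p < D + 1
      · obtain ⟨w1, hw1, rfl⟩ := hw.exists_labelled
        rw [crossings_map_fst] at *
        obtain ⟨p, hp, h1⟩ := h1
        obtain ⟨p, hp1, rfl⟩ := Multiset.mem_map.1 hp
        obtain ⟨q, hq, h2⟩ := h2
        obtain ⟨q, hq1, rfl⟩ := Multiset.mem_map.1 hq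
        obtain ⟨w', h3, h4, h5, h6⟩ := hw1.reduce hL (D := D + 1)
          (fun p hp => hle _ (Multiset.mem_map_of_mem _ hp)) ⟨p, hp1, h1⟩ ⟨q, hq1, h2⟩
        exact ih _ h5 rfl h3 h4 h6
      · push Not at h2
        refine ⟨w, hw, D + 1, by omega, h1, fun p hp => ?_⟩
        have := h2 p hp
        have := hle p hp
        omega
    · push Not at h1
      exact ihD hw (fun p hp => by have := hle p hp; have := h1 p hp; omega) hpos

end LinkColoring

namespace LinkColoring
open Diagram

/-! ### Removing the largest color -/

theorem TangleEq.of_local {m n : ℕ} (u x y v : List Layer) (h : LocalMove x y)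
    (ha : IsTangle (u ++ x ++ v) m n) (hb : IsTangle (u ++ y ++ v) m n) :
    TangleEq m n (u ++ x ++ v) (u ++ y ++ v) :=
  .of_step ⟨ha, hb, u, x, y, v, h, rfl, rfl⟩

theorem tangleEq_curl {i k : ℕ} : TangleEq (i + 1 + k) (i + 1 + k)
    [⟨i, .cup⟩, ⟨i + 1, .cross false⟩, ⟨i, .cap⟩] [] := by
  have h1 : TangleEq (i + 1 + k) (i + 1 + k) [⟨i + 1, .cup⟩, ⟨i, .cross true⟩, ⟨i, .cap⟩]
      [⟨i, .cup⟩, ⟨i + 1, .cross false⟩, ⟨i, .cap⟩] :=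
    .of_local [] _ _ [⟨i, .cap⟩] (.slideCup i true) (by simp [IsTangle]; omega)
      (by simp [IsTangle]; omega)
  have h2 : TangleEq (i + 1 + k) (i + 1 + k) [⟨i + 1, .cup⟩, ⟨i, .cross true⟩, ⟨i, .cap⟩]
      [⟨i + 1, .cup⟩, ⟨i, .cap⟩] :=
    .of_local [⟨i + 1, .cup⟩] _ _ [] (.reidemeister1Cap i true) (by simp [IsTangle]; omega)
      (by simp [IsTangle]; omega)
  have h3 : TangleEq (i + 1 + k) (i + 1 + k) [⟨i + 1, .cup⟩, ⟨i, .cap⟩] [] :=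
    .of_move (.zigzag' i) (by simp [IsTangle]; omega) rfl
  exact h1.symm.trans (h2.trans h3)

/-- On the left, a strand runs to the right over two others, back over them, and only then to the
right under them and under itself. Two third Reidemeister moves pull the last passage free; then the
excursion cancels by two second moves, and a curl remains, which `tangleEq_curl` removes. -/
theorem tangleEq_detour {i k : ℕ} : TangleEq (i + 3 + k) (i + 3 + k)
    [⟨i, .cross true⟩, ⟨i + 1, .cross true⟩, ⟨i, .cup⟩, ⟨i + 1, .cross false⟩,
      ⟨i + 2, .cross false⟩, ⟨i + 3, .cross false⟩, ⟨i + 2, .cross false⟩, ⟨i + 1, .cross false⟩,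
      ⟨i, .cap⟩] [⟨i, .cross false⟩, ⟨i + 1, .cross false⟩] := by
  have step : ∀ (u x y v : List Layer), LocalMove x y →
      IsTangle (u ++ x ++ v) (i + 3 + k) (i + 3 + k) →
      IsTangle (u ++ y ++ v) (i + 3 + k) (i + 3 + k) →
      TangleEq (i + 3 + k) (i + 3 + k) (u ++ x ++ v) (u ++ y ++ v) :=
    fun u x y v => .of_local u x y v
  have h1 := step [⟨i, .cross true⟩, ⟨i + 1, .cross true⟩, ⟨i, .cup⟩, ⟨i + 1, .cross false⟩] _ _
    [⟨i + 1, .cross false⟩, ⟨i, .cap⟩] (.reidemeister3 (i + 2) false false false (.inl rfl))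
    (by simp [IsTangle]; omega) (by simp [IsTangle]; omega)
  have h2 := step [⟨i, .cross true⟩, ⟨i + 1, .cross true⟩, ⟨i, .cup⟩] _ _
    [⟨i + 2, .cross false⟩, ⟨i + 3, .cross false⟩, ⟨i + 1, .cross false⟩, ⟨i, .cap⟩]
    (.exchange (i + 1) 0 (.cross false) (.cross false))
    (by simp [IsTangle]; omega) (by simp [IsTangle]; omega)
  have h3 := (step [⟨i, .cross true⟩, ⟨i + 1, .cross true⟩, ⟨i, .cup⟩, ⟨i + 3, .cross false⟩,
    ⟨i + 1, .cross false⟩, ⟨i + 2, .cross false⟩] _ _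
    [⟨i, .cap⟩] (.exchange (i + 1) 0 (.cross false) (.cross false))
    (by simp [IsTangle]; omega) (by simp [IsTangle]; omega)).symm
  have h4 := step [⟨i, .cross true⟩, ⟨i + 1, .cross true⟩, ⟨i, .cup⟩, ⟨i + 3, .cross false⟩] _ _
    [⟨i + 3, .cross false⟩, ⟨i, .cap⟩] (.reidemeister3 (i + 1) false false false (.inl rfl))
    (by simp [IsTangle]; omega) (by simp [IsTangle]; omega)
  have h5 := step [⟨i, .cross true⟩, ⟨i + 1, .cross true⟩] _ _
    [⟨i + 2, .cross false⟩, ⟨i + 1, .cross false⟩, ⟨i + 2, .cross false⟩, ⟨i + 3, .cross false⟩,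
      ⟨i, .cap⟩] (.exchange i 1 .cup (.cross false))
    (by simp [IsTangle]; omega) (by simp [IsTangle]; omega)
  have h6 := step [⟨i, .cross true⟩, ⟨i + 1, .cross true⟩, ⟨i + 1, .cross false⟩] _ _
    [⟨i + 1, .cross false⟩, ⟨i + 2, .cross false⟩, ⟨i + 3, .cross false⟩,
      ⟨i, .cap⟩] (.exchange i 0 .cup (.cross false))
    (by simp [IsTangle]; omega) (by simp [IsTangle]; omega)
  have h7 := (step [⟨i, .cross true⟩, ⟨i + 1, .cross true⟩, ⟨i + 1, .cross false⟩,
    ⟨i, .cross false⟩, ⟨i, .cup⟩, ⟨i + 1, .cross false⟩, ⟨i + 2, .cross false⟩] _ _ []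
    (.exchange i 1 .cap (.cross false))
    (by simp [IsTangle]; omega) (by simp [IsTangle]; omega)).symm
  have h8 := (step [⟨i, .cross true⟩, ⟨i + 1, .cross true⟩, ⟨i + 1, .cross false⟩,
    ⟨i, .cross false⟩, ⟨i, .cup⟩, ⟨i + 1, .cross false⟩] _ _ [⟨i + 1, .cross false⟩]
    (.exchange i 0 .cap (.cross false))
    (by simp [IsTangle]; omega) (by simp [IsTangle]; omega)).symm
  have h9 := step [⟨i, .cross true⟩] _ _ [⟨i, .cross false⟩, ⟨i, .cup⟩, ⟨i + 1, .cross false⟩,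
    ⟨i, .cap⟩, ⟨i, .cross false⟩, ⟨i + 1, .cross false⟩] (.reidemeister2 (i + 1) true)
    (by simp [IsTangle]; omega) (by simp [IsTangle]; omega)
  have h10 := step [] _ _ [⟨i, .cup⟩, ⟨i + 1, .cross false⟩,
    ⟨i, .cap⟩, ⟨i, .cross false⟩, ⟨i + 1, .cross false⟩] (.reidemeister2 i true)
    (by simp [IsTangle]; omega) (by simp [IsTangle]; omega)
  have h11 := (tangleEq_curl (i := i) (k := k + 2)).append_right
    (v := [⟨i, .cross false⟩, ⟨i + 1, .cross false⟩]) (l := i + 3 + k)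
    (by simp [IsTangle]; omega)
  rw [show i + 1 + (k + 2) = i + 3 + k by omega] at h11
  exact h1.trans (h2.trans (h3.trans (h4.trans (h5.trans (h6.trans (h7.trans (h8.trans
    (h9.trans (h10.trans h11)))))))))

/-- All colors at the crossings are between `m` and `M`, the differences are all `0` or `4 * d`, not
all `0`. -/
def Uniform (d : ℕ) (m M : ℤ) (w : List (Slice ℤ)) : Prop :=
  (∀ s ∈ allPorts w, m ≤ s ∧ s ≤ M) ∧ (∀ p ∈ crossings w, dif p = 0 ∨ dif p = 4 * d) ∧
    ∃ p ∈ crossings w, dif p = 4 * d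

theorem Uniform.replace {d : ℕ} {m M : ℤ} {u v a b : List (Slice ℤ)} (h : Uniform d m M (u ++ a ++ v))
    (h1 : ∀ s ∈ allPorts b, m ≤ s ∧ s ≤ M)
    (h2 : ∀ p ∈ crossings b, dif p = 0 ∨ dif p = 4 * d)
    (h3 : ∃ p ∈ crossings b, dif p = 4 * d) : Uniform d m M (u ++ b ++ v) := by
  obtain ⟨i1, i2, -⟩ := h
  simp only [allPorts_append, crossings_append, Multiset.mem_add] at i1 i2
  refine ⟨?_, ?_, ?_⟩
  · simp only [allPorts_append, Multiset.mem_add]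
    rintro s ((hs | hs) | hs)
    exacts [i1 s (.inl (.inl hs)), h1 s hs, i1 s (.inr hs)]
  · simp only [crossings_append, Multiset.mem_add]
    rintro s ((hs | hs) | hs)
    exacts [i2 s (.inl (.inl hs)), h2 s hs, i2 s (.inr hs)]
  · obtain ⟨p, hp, h⟩ := h3
    exact ⟨p, by simp [hp], h⟩

theorem allPorts_cons_cross {S : Type*} (x y : List S) (c : Crs S) (w : List (Slice S)) :
    allPorts (⟨x, .cross c, y⟩ :: w) = {c.bl, c.br, c.tl, c.tr} + allPorts w := by
  simp [allPorts, crossings, ← Multiset.cons_coe, ports_abs]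

theorem allPorts_cons_cup {S : Type*} (x y : List S) (s : S) (w : List (Slice S)) :
    allPorts (⟨x, .cup s, y⟩ :: w) = allPorts w := by
  simp [allPorts, crossings]

theorem allPorts_cons_cap {S : Type*} (x y : List S) (s : S) (w : List (Slice S)) :
    allPorts (⟨x, .cap s, y⟩ :: w) = allPorts w := by
  simp [allPorts, crossings]

theorem allPorts_nil {S : Type*} : allPorts ([] : List (Slice S)) = 0 := rfl

theorem mem_allPorts {S : Type*} {w : List (Slice S)} {s : S} :
    s ∈ allPorts w ↔ ∃ p ∈ crossings w, s ∈ ports p := by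
  simp only [allPorts, Multiset.mem_bind]

/-- A crossing with an end of the largest color. -/
theorem eq_of_bl_eq_max {d : ℕ} {m M : ℤ} (hd : 0 < d) {c : Crs ℤ} (hc : Fits c.abs)
    (h : ∀ s ∈ ports c.abs, m ≤ s ∧ s ≤ M) (h2 : dif c.abs = 0 ∨ dif c.abs = 4 * d)
    (hM : ∃ s ∈ ports c.abs, s ≠ M) :
    (c.bl = M → c = mkCrs false M (M - d)) ∧ (c.tr = M → c = mkCrs false (M - 2 * d) (M - d)) ∧
      ∀ s ∈ ports c.abs, s = M → c.Once M := by
  rw [fits_abs_iff] at hc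
  obtain ⟨b, x, y, hc⟩ : ∃ b x y, c = mkCrs b x y := ⟨_, _, _, hc⟩
  subst hc
  rw [dif_mkCrs] at h2
  simp only [mem_ports_abs, forall_eq_or_imp, forall_eq, exists_eq_or_imp, exists_eq_left] at *
  unfold Crs.Once
  -- An over color M would be the average of two under colors that are at most M, so all ends would
  -- have color M. Hence M is an under color, the over color is M - d, and the other under color is
  -- M - 2d.
  cases b
  · simp only [mkCrs_bl, mkCrs_br, mkCrs_false_tl, mkCrs_false_tr] at *
    refine ⟨fun h3 => ?_, fun h3 => ?_, ?_⟩
    · rw [h3, show y = M - d by omega]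
    · rw [show y = M - d by omega, show x = M - 2 * d by omega]
    · refine ⟨fun _ => ?_, fun _ => ?_, fun _ => ?_, fun _ => ?_⟩ <;> omega
  · simp only [mkCrs_bl, mkCrs_br, mkCrs_true_tl, mkCrs_true_tr] at *
    refine ⟨fun h3 => ?_, fun h3 => ?_, ?_⟩
    · omega
    · omega
    · refine ⟨fun _ => ?_, fun _ => ?_, fun _ => ?_, fun _ => ?_⟩ <;> omega

theorem Colored.replace {L : Link} {u v a b : List (Slice ℤ)} {m n : List ℤ}
    (h : Colored L (u ++ a ++ v)) (ha : Chain a m n) (hb : Chain b m n)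
    (hm : ∀ m' n', Chain a m' n' → m' = m ∧ n' = n)
    (hab : TangleEq m.length n.length (erase a) (erase b)) (hf : ∀ p ∈ crossings b, Fits p) :
    Colored L (u ++ b ++ v) := by
  refine ⟨h.1.replace ha hb hm hab, ?_⟩
  have h2 := h.2
  simp only [crossings_append, Multiset.mem_add] at h2 ⊢
  rintro p ((hp | hp) | hp)
  exacts [h2 _ (.inl (.inl hp)), hf _ hp, h2 _ (.inr hp)]

/-- Two neighbouring crossings that share an arc of the largest color, which is not an over arc. -/
theorem exists_fewer_of_under {L : Link} {d : ℕ} {m M : ℤ} (hd : 0 < d) (hmM : m + 4 * d ≤ M)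
    {u v : List (Slice ℤ)} {xs ys : List ℤ}
    (hw : Colored L (u ++ braid xs ys [(false, false), (true, false)] (M - 2 * d) (M - d) (M - d)
      ++ v))
    (hu : Uniform d m M (u ++ braid xs ys [(false, false), (true, false)] (M - 2 * d) (M - d)
      (M - d) ++ v)) :
    ∃ w', Colored L w' ∧ Uniform d m M w' ∧ (allPorts w').count M < (allPorts
      (u ++ braid xs ys [(false, false), (true, false)] (M - 2 * d) (M - d) (M - d) ++ v)).count M := by
  obtain ⟨a, rfl⟩ : ∃ a : ℤ, M = a + 2 * d := ⟨M - 2 * d, by ring⟩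
  have e1 : a + 2 * (d : ℤ) - 2 * d = a := by ring
  have e2 : a + 2 * (d : ℤ) - d = a + d := by ring
  rw [e1, e2] at hw hu ⊢
  -- The strand of color a = M - 2d used to take color M between two arcs of color a + d. Running
  -- over them first turns their color into a - d, so its passage under them takes color a - 2d = M
  -- - 4d instead. This is why m + 4d ≤ M is needed.
  let b : List (Slice ℤ) := [⟨xs, .cross (mkCrs true a (a + d)), (a + d) :: ys⟩,
    ⟨xs ++ [a - d], .cross (mkCrs true a (a + d)), ys⟩,
    ⟨xs, .cup a, (a - d) :: (a - d) :: a :: ys⟩,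
    ⟨xs ++ [a], .cross ⟨false, a, a - d, a - d, a - 2 * d⟩, (a - d) :: a :: ys⟩,
    ⟨xs ++ [a, a - d], .cross ⟨false, a - 2 * d, a - d, a - d, a⟩, a :: ys⟩,
    ⟨xs ++ [a, a - d, a - d], .cross ⟨false, a, a, a, a⟩, ys⟩,
    ⟨xs ++ [a, a - d], .cross ⟨false, a - d, a, a, a + d⟩, a :: ys⟩,
    ⟨xs ++ [a], .cross ⟨false, a - d, a, a, a + d⟩, (a + d) :: a :: ys⟩,
    ⟨xs, .cap a, (a + d) :: (a + d) :: a :: ys⟩]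
  have e3 : braidTop [(false, false), (true, false)] a (a + d) (a + d) = [a + d, a + d, a] := by
    simp [braidTop]
  have hc : Chain b (xs ++ a :: (a + d) :: (a + d) :: ys)
      (xs ++ (braidTop [(false, false), (true, false)] a (a + d) (a + d) ++ ys)) := by
    rw [e3]
    simp [b, Chain, Slice.bot, Slice.top]
    omega
  have hcb : crossings b = ↑[(mkCrs true a (a + d)).abs, (mkCrs true a (a + d)).abs,
    (⟨false, a, a - d, a - d, a - 2 * d⟩ : Crs ℤ).abs,
    (⟨false, a - 2 * d, a - d, a - d, a⟩ : Crs ℤ).abs, (⟨false, a, a, a, a⟩ : Crs ℤ).abs,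
    (⟨false, a - d, a, a, a + d⟩ : Crs ℤ).abs, (⟨false, a - d, a, a, a + d⟩ : Crs ℤ).abs] := rfl
  refine ⟨_, hw.replace (b := b) (chain_braid _ _ _ _ _ _ _ _ rfl rfl) hc
    (fun _ _ => eq_of_chain_braid (by simp)) ?_ ?_, hu.replace ?_ ?_ ?_, ?_⟩
  · rw [e3]
    have := tangleEq_detour (i := xs.length) (k := ys.length)
    simpa [b, braid, Slice.layer, LPiece.toPiece, add_assoc, add_comm, add_left_comm] using this.symm
  · rw [hcb]
    simp only [Multiset.mem_coe, List.forall_mem_cons, fits_abs]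
    simp
    omega
  · simp only [b, allPorts_cons_cross, allPorts_cons_cup, allPorts_cons_cap, allPorts_nil,
      Multiset.insert_eq_cons, Multiset.mem_add, Multiset.mem_cons, Multiset.mem_singleton,
      mkCrs_bl, mkCrs_br, mkCrs_true_tl, mkCrs_true_tr, Multiset.notMem_zero, or_false]
    rintro s hs
    omega
  · rw [hcb]
    simp only [Multiset.mem_coe, List.forall_mem_cons, dif_abs]
    simp
    omega
  · exact ⟨_, by rw [hcb]; simp; exact .inl rfl, by rw [dif_mkCrs]; omega⟩
  · simp only [allPorts_append, Multiset.count_add]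
    have h1 : (allPorts b).count (a + 2 * d) = 0 := by
      rw [Multiset.count_eq_zero]
      simp only [b, allPorts_cons_cross, allPorts_cons_cup, allPorts_cons_cap, allPorts_nil,
        Multiset.insert_eq_cons, Multiset.mem_add, Multiset.mem_cons, Multiset.mem_singleton,
        mkCrs_bl, mkCrs_br, mkCrs_true_tl, mkCrs_true_tr, Multiset.notMem_zero, or_false]
      omega
    have h2 : 0 < (allPorts (braid xs ys [(false, false), (true, false)] a (a + d)
        (a + d))).count (a + 2 * d) := by
      rw [Multiset.count_pos]
      simp only [braid, allPorts_cons_cross, Multiset.insert_eq_cons, Multiset.mem_add, Multiset.mem_cons,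
        Multiset.mem_singleton, mkCrs_false_tr]
      left; right; right; right; ring
    omega

/-- Two neighbouring crossings that share an arc of the largest color, one of them having only that
color. -/
theorem exists_fewer_of_trivial {L : Link} {d : ℕ} {m M : ℤ} (hd : 0 < d) (hmM : m + 4 * d ≤ M) {b : Bool}
    {u v : List (Slice ℤ)} {xs ys : List ℤ}
    (hw : Colored L (u ++ braid xs ys [(false, b), (true, false)] M M (M - d) ++ v))
    (hu : Uniform d m M (u ++ braid xs ys [(false, b), (true, false)] M M (M - d) ++ v)) :
    ∃ w', Colored L w' ∧ Uniform d m M w' ∧ (allPorts w').count M <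
      (allPorts (u ++ braid xs ys [(false, b), (true, false)] M M (M - d) ++ v)).count M := by
  have hc : crs (braid xs ys [(true, false), (false, false), (true, b), (false, true)] M M (M - d))
      = [⟨false, M, M - d, M - d, M - 2 * d⟩, ⟨false, M, M - d, M - d, M - 2 * d⟩,
        ⟨b, M - 2 * d, M - 2 * d, M - 2 * d, M - 2 * d⟩, ⟨true, M - d, M - 2 * d, M, M - d⟩] := by
    cases b <;> simp [braid, mkCrs] <;> ring_nf <;> trivial
  have hp : allPorts (braid xs ys [(true, false), (false, false), (true, b), (false, true)]
      M M (M - d)) = {M, M - d, M - d, M - 2 * d} + ({M, M - d, M - d, M - 2 * d} +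
        ({M - 2 * d, M - 2 * d, M - 2 * d, M - 2 * d} + {M - d, M - 2 * d, M, M - d})) := by
    rw [allPorts, crossings, hc]
    simp [← Multiset.cons_coe, ports_abs, -Multiset.map_coe]
  -- The strand of color M - d is slid over the crossing of color M, which takes color M - 2d; the
  -- number of ends of color M drops from 5 to 3.
  refine ⟨_, hw.braid (by simp) [(true, false), (false, false), (true, b), (false, true)]
    (by simpa using braidEq_slide false b false false (.inr rfl)) ?_, hu.replace ?_ ?_ ?_, ?_⟩
  · cases b <;> simp [braidTop] <;> omega
  · rw [hp]
    simp only [Multiset.insert_eq_cons, Multiset.mem_add, Multiset.mem_cons,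
      Multiset.mem_singleton]
    intro s hs
    omega
  · rw [crossings, hc]
    simp only [List.map_cons, List.map_nil, Multiset.mem_coe, List.forall_mem_cons, dif_abs]
    simp
    omega
  · refine ⟨(⟨false, M, M - d, M - d, M - 2 * d⟩ : Crs ℤ).abs, ?_, ?_⟩
    · rw [crossings, hc]; simp
    · rw [dif_abs]; simp; omega
  · simp only [allPorts_append, Multiset.count_add]
    have h1 : (allPorts (braid xs ys [(true, false), (false, false), (true, b), (false, true)]
      M M (M - d))).count M = 3 := by
      rw [hp]
      have e1 : M ≠ M - d := by omega
      have e2 : M ≠ M - 2 * d := by omega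
      simp [Multiset.count_cons, Multiset.count_singleton, e1, e2]
    have h2 : 5 ≤ (allPorts (braid xs ys [(false, b), (true, false)] M M (M - d))).count M := by
      have e1 : mkCrs b M M = ⟨b, M, M, M, M⟩ := by cases b <;> simp [mkCrs] <;> ring
      simp [braid, allPorts_cons_cross, allPorts_nil, Multiset.count_cons, e1]
      omega
    omega

end LinkColoring

/-! ### Descent on the largest color -/

namespace LinkColoring
open Diagram

theorem Uniform.congr {d : ℕ} {m M : ℤ} {w w' : List (Slice ℤ)} (h : Uniform d m M w)
    (hc : crossings w' = crossings w) : Uniform d m M w' := by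
  unfold Uniform allPorts at *
  rwa [hc]

/-- If some crossing has only the color M, non-splittability provides one joined to a crossing that
is not of this kind, and the former is changed. Otherwise every strand of color M between crossings
is an under end at both crossings, and the detour removes it. -/
theorem exists_fewer {L : Link} (hL : ¬ L.IsSplittable) {d : ℕ} {m M : ℤ} (hd : 0 < d)
    (hmM : m + 4 * d ≤ M) {w : List (Slice ℤ)} (hw : Colored L w) (hu : Uniform d m M w)
    (hM : M ∈ allPorts w) :
    ∃ w', Colored L w' ∧ Uniform d m M w' ∧ (allPorts w').count M < (allPorts w).count M := by
  have hmax : ∀ c : Crs ℤ, c.abs ∈ crossings w → (∃ s ∈ ports c.abs, s ≠ M) →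
      (c.bl = M → c = mkCrs false M (M - d)) ∧ (c.tr = M → c = mkCrs false (M - 2 * d) (M - d)) ∧
      ∀ s ∈ ports c.abs, s = M → c.Once M := fun c hc h =>
    eq_of_bl_eq_max hd (hw.2 _ hc) (fun s hs => hu.1 s (mem_allPorts.2 ⟨_, hc, hs⟩)) (hu.2.1 _ hc) h
  by_cases hZ : ∃ Z ∈ crossings w, ∀ s ∈ ports Z, s = M
  · obtain ⟨w1, hw1, rfl⟩ := hw.exists_labelled
    rw [crossings_map_fst] at hZ
    obtain ⟨Z0, hZ0, hZM⟩ := hZ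
    obtain ⟨Z, hZ, rfl⟩ := Multiset.mem_map.1 hZ0
    obtain ⟨X0, hX0, hXd⟩ := hu.2.2
    rw [crossings_map_fst] at hX0
    obtain ⟨X, hX, rfl⟩ := Multiset.mem_map.1 hX0
    have hcol : ∀ p : Multiset (ℤ × ℕ) × Multiset (ℤ × ℕ), ports (col p) =
        (ports p).map Prod.fst := fun p => by simp [ports, col]
    -- The ends of crossings of color M only. They do not include all ends of `X`, whose difference
    -- is not zero.
    let A : ℤ × ℕ → Prop := fun s => ∃ p ∈ crossings w1, (∀ t ∈ ports p, t.1 = M) ∧ s ∈ ports p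
    have key : ∃ Y ∈ crossings w1, (∃ s ∈ ports Y, A s) ∧ ∃ s ∈ ports Y, ¬ A s := by
      obtain ⟨c, hc, rfl⟩ := mem_crossings.1 hZ
      have hbl : c.bl ∈ ports c.abs := mem_ports_abs.2 (.inl rfl)
      refine (hw1.1.exists_mixed hL A hX (strand_of_mem_ports hZ hbl) ⟨_, hZ, ?_, hbl⟩).resolve_left
        fun h => ?_
      · rw [hcol] at hZM
        exact Multiset.forall_mem_map_iff.1 hZM
      · have h' : ∀ s ∈ ports X, s.1 = M := fun s hs => by
          obtain ⟨p, -, h1, h2⟩ := h s hs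
          exact h1 s h2
        obtain ⟨e, -, rfl⟩ := mem_crossings.1 hX
        rw [col_abs, dif_abs] at hXd
        simp only [mem_ports_abs, forall_eq_or_imp, forall_eq] at h'
        simp only [Crs.map, h'] at hXd
        omega
    obtain ⟨Y, hY, ⟨α, hα, Z, hZ, hZM, hαZ⟩, t, ht, htA⟩ := key
    obtain ⟨R0, hR0⟩ := Multiset.exists_cons_of_mem hZ
    have hYR : Y ∈ R0 := by
      rw [hR0, Multiset.mem_cons] at hY
      refine hY.resolve_left ?_
      rintro rfl
      exact htA ⟨_, hZ, hZM, ht⟩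
    obtain ⟨R, rfl⟩ := Multiset.exists_cons_of_mem hYR
    obtain ⟨w2, c1, c2, hr, ⟨e1, e2, u, v, xs, ys, rfl⟩, rfl, rfl, hcr⟩ :=
      exists_adjacent hw1.1 (hw1.2.1 α) hR0 hαZ hα
    have hcr' := congrArg (Multiset.map col) hcr
    rw [← crossings_map_fst, ← crossings_map_fst] at hcr'
    have hw2 : Colored L (mapWord Prod.fst _) := ⟨hr.map Prod.fst, by rw [hcr']; exact hw.2⟩
    have hu2 := hu.congr hcr'
    have hαM : α.1 = M := hZM α hαZ
    have hc1 : c1.map Prod.fst = ⟨c1.b, M, M, M, M⟩ := by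
      simp only [mem_ports_abs, forall_eq_or_imp, forall_eq] at hZM
      simp [Crs.map, hZM]
    have hc2 : c2.map Prod.fst = mkCrs false M (M - d) := by
      refine (hmax (c2.map Prod.fst) ?_ ?_).1 (by simp [Crs.map, e2, hαM])
      · rw [crossings_map_fst, ← col_abs]
        exact Multiset.mem_map_of_mem _ hY
      · by_contra! hcon
        refine htA ⟨_, hY, ?_, ht⟩
        rw [← col_abs, hcol] at hcon
        exact Multiset.forall_mem_map_iff.1 hcon
    have e : mapWord Prod.fst (u ++ ⟨xs, .cross c1, c2.br :: ys⟩ ::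
        ⟨xs ++ [c1.tl], .cross c2, ys⟩ :: v) = mapWord Prod.fst u ++
        braid (xs.map Prod.fst) (ys.map Prod.fst) [(false, c1.b), (true, false)] M M (M - d) ++
          mapWord Prod.fst v := by
      have h1 : mkCrs c1.b M M = ⟨c1.b, M, M, M, M⟩ := by cases c1.b <;> simp [mkCrs] <;> ring
      have h2 : c1.tl.1 = M := hZM _ (mem_ports_abs.2 (by simp))
      have h3 : c2.br.1 = M - d := congrArg Crs.br hc2
      simp [Slice.map, LPiece.map, hc1, hc2, braid, h1, h2, h3]
    have hcount : (allPorts (mapWord Prod.fst w1)).count M = (allPorts (mapWord Prod.fst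
        (u ++ ⟨xs, .cross c1, c2.br :: ys⟩ :: ⟨xs ++ [c1.tl], .cross c2, ys⟩ :: v))).count M := by
      rw [allPorts, ← hcr']; rfl
    rw [hcount]
    rw [e] at hw2 hu2 ⊢
    exact exists_fewer_of_trivial hd hmM hw2 hu2
  · push Not at hZ
    obtain ⟨X, hX, hMX⟩ := mem_allPorts.1 hM
    have hX' := hX
    obtain ⟨c, hc, rfl⟩ := mem_crossings.1 hX
    -- No auxiliary labels are needed: a crossing with an end of color M has exactly one, so the
    -- color itself singles out the strand.
    obtain ⟨w', hp, c1, c2, ⟨e1, e2, u, v, xs, ys, rfl⟩, hc1⟩ :=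
      hit_of_once hw.1.1 hc ((hmax c hX (hZ _ hX)).2.2 M hMX rfl)
    have hcr : Colored L (u ++ ⟨xs, .cross c1, c2.br :: ys⟩ :: ⟨xs ++ [c1.tl], .cross c2, ys⟩ :: v) ∧
        crossings (u ++ ⟨xs, .cross c1, c2.br :: ys⟩ :: ⟨xs ++ [c1.tl], .cross c2, ys⟩ :: v) =
          crossings w := by
      rcases hp with hp | hp
      · exact ⟨hw.of_pl hp, (hp _ _ hw.1.1).2.2.symm⟩
      · exact ⟨hw.flip.of_pl hp, by rw [← (hp _ _ hw.flip.1.1).2.2, crossings_flipSlices]⟩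
    obtain ⟨hw', hcr⟩ := hcr
    have m1 : c1.abs ∈ crossings w := by rw [← hcr]; simp [crossings]
    have m2 : c2.abs ∈ crossings w := by rw [← hcr]; simp [crossings]
    have f1 := (hmax c1 m1 (hZ _ m1)).2.1 e1
    have f2 := (hmax c2 m2 (hZ _ m2)).1 e2
    have hu' := hu.congr hcr
    have hcount : (allPorts w).count M = (allPorts
        (u ++ ⟨xs, .cross c1, c2.br :: ys⟩ :: ⟨xs ++ [c1.tl], .cross c2, ys⟩ :: v)).count M := by
      rw [allPorts, ← hcr]; rfl
    have e : u ++ (⟨xs, .cross c1, c2.br :: ys⟩ : Slice ℤ) :: ⟨xs ++ [c1.tl], .cross c2, ys⟩ :: v =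
        u ++ braid xs ys [(false, false), (true, false)] (M - 2 * d) (M - d) (M - d) ++ v := by
      have h1 : (mkCrs false (M - 2 * d) (M - d)).tr = M := by simp; ring
      simp only [braid, h1, f1, f2, mkCrs_br, List.append_assoc, List.cons_append, List.nil_append]
    rw [hcount]
    rw [e] at hw' hu' ⊢
    exact exists_fewer_of_under hd hmM hw' hu'

theorem exists_lower_max {L : Link} (hL : ¬ L.IsSplittable) {d : ℕ} {m M : ℤ} (hd : 0 < d)
    (hmM : m + 4 * d ≤ M) {w : List (Slice ℤ)} (hw : Colored L w) (hu : Uniform d m M w) :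
    ∃ w', Colored L w' ∧ Uniform d m (M - 1) w' := by
  induction hn : (allPorts w).count M using Nat.strong_induction_on generalizing w with
  | _ n ih =>
  subst hn
  by_cases hM : M ∈ allPorts w
  · obtain ⟨w', h1, h2, h3⟩ := exists_fewer hL hd hmM hw hu hM
    exact ih _ h3 h1 h2 rfl
  · refine ⟨w, hw, fun s hs => ?_, hu.2⟩
    have := hu.1 s hs
    have : s ≠ M := by rintro rfl; exact hM hs
    omega

theorem exists_small_range {L : Link} (hL : ¬ L.IsSplittable) {d : ℕ} {m : ℤ} (hd : 0 < d) (n : ℕ) :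
    ∀ {w : List (Slice ℤ)}, Colored L w → Uniform d m (m + 4 * d - 1 + n) w →
      ∃ w', Colored L w' ∧ Uniform d m (m + 4 * d - 1) w' := by
  induction n with
  | zero => intro w hw hu; exact ⟨w, hw, by simpa using hu⟩
  | succ n ih =>
    intro w hw hu
    obtain ⟨w', h1, h2⟩ := exists_lower_max hL hd (by push_cast; omega) hw hu
    refine ih h1 ?_
    convert h2 using 1
    push_cast; ring

theorem exists_natAbs_le (M : Multiset ℤ) : ∃ B : ℕ, ∀ s ∈ M, s.natAbs ≤ B := by
  induction M using Multiset.induction_on with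
  | empty => exact ⟨0, by simp⟩
  | cons a M ih =>
    obtain ⟨B, hB⟩ := ih
    refine ⟨max a.natAbs B, ?_⟩
    intro s hs
    rcases Multiset.mem_cons.1 hs with rfl | hs
    · omega
    · have := hB s hs; omega

/-- A non-splittable link that has a non-trivial coloring has one with at most four colors. -/
theorem Colored.exists_four {L : Link} (hL : ¬ L.IsSplittable) {w : List (Slice ℤ)}
    (hw : Colored L w) (hpos : ∃ p ∈ crossings w, 0 < dif p) :
    ∃ w', Colored L w' ∧ (∃ p ∈ crossings w', 0 < dif p) ∧
      ∃ S : Finset ℤ, S.card ≤ 4 ∧ ∀ s, Strand w' s → s ∈ S := by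
  obtain ⟨B, hB⟩ : ∃ B, ∀ p ∈ crossings w, dif p ≤ B := by
    obtain ⟨B, hB⟩ := exists_natAbs_le ((crossings w).map fun p => (dif p : ℤ))
    exact ⟨B, fun p hp => by simpa using hB _ (Multiset.mem_map_of_mem _ hp)⟩
  obtain ⟨w1, hw1, d', hd', ⟨p, hp, hpd⟩, hall⟩ := hw.exists_uniform hL B hB hpos
  obtain ⟨d, rfl⟩ : ∃ d, d' = 4 * d := by
    obtain ⟨c, -, rfl⟩ := mem_crossings.1 hp
    rw [fits_abs_iff.1 (hw1.2 _ hp), dif_mkCrs] at hpd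
    exact ⟨_, hpd.symm⟩
  have hd : 0 < d := by omega
  obtain ⟨B, hB⟩ := exists_natAbs_le (allPorts w1)
  -- All colors lie between -B and B, and the upper end -B + 4d - 1 + 2B of the initial interval is
  -- at least B.
  obtain ⟨w2, hw2, hu⟩ := exists_small_range hL hd (m := -B) (2 * B) hw1
    ⟨fun s hs => by have := hB s hs; push_cast; omega, hall, p, hp, hpd⟩
  obtain ⟨h1, h2, X, hX, hXd⟩ := hu
  refine ⟨w2, hw2, ⟨X, hX, by omega⟩, ?_⟩
  obtain ⟨c0, hc0, rfl⟩ := mem_crossings.1 hX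
  have hbl : Strand w2 c0.bl := strand_of_mem_ports hX (mem_ports_abs.2 (.inl rfl))
  -- The bounds concern ends of crossings only; strands whose colors appear at no crossing would
  -- split off.
  have hin : ∀ s, Strand w2 s → s ∈ allPorts w2 := by
    refine (hw2.1.all_or_none hL (· ∈ allPorts w2) fun c hc => Crs.splits_of_forall (.inl
      fun s hs => mem_allPorts.2 ⟨_, mem_crossings.2 ⟨c, hc, rfl⟩, hs⟩)).resolve_right fun h => ?_
    exact h _ hbl (mem_allPorts.2 ⟨_, hX, mem_ports_abs.2 (.inl rfl)⟩)
  -- At each crossing all colors are congruent modulo d, so a residue class of colors splits off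
  -- unless it is everything.
  have hmod : ∀ s, Strand w2 s → (d : ℤ) ∣ s - c0.bl := by
    refine (hw2.1.all_or_none hL (fun s => (d : ℤ) ∣ s - c0.bl) fun c hc =>
      Crs.splits_of_forall ?_).resolve_right fun h => h _ hbl (by simp)
    have hm := mem_crossings.2 ⟨c, hc, rfl⟩
    have hf := fits_abs_iff.1 (hw2.2 _ hm)
    have h3 := h2 _ hm
    rw [hf, dif_mkCrs] at h3
    have h4 : ∀ s ∈ ports c.abs, (d : ℤ) ∣ s - c.bl := by
      intro s hs
      have h5 : s - c.bl = 0 ∨ s - c.bl = d ∨ s - c.bl = -d ∨ s - c.bl = 2 * d ∨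
          s - c.bl = -(2 * d) := by
        rw [hf, mem_ports_abs] at hs
        generalize c.b = b at hs
        cases b <;> simp at hs <;> omega
      rcases h5 with h | h | h | h | h <;> rw [h] <;> simp
    by_cases h5 : (d : ℤ) ∣ c.bl - c0.bl
    · refine .inl fun s hs => ?_
      have := dvd_add (h4 s hs) h5
      simpa using this
    · refine .inr fun s hs h => h5 ?_
      have := dvd_sub h (h4 s hs)
      simpa using this
  -- The four members of the residue class in an interval of 4d integers that starts at -B.
  refine ⟨(Finset.range 4).image fun j : ℕ => -(B : ℤ) + (c0.bl - -B) % d + j * d,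
    Finset.card_image_le, fun s hs => ?_⟩
  have h3 := h1 s (hin s hs)
  obtain ⟨q, hq⟩ := hmod s hs
  have hd' : (0 : ℤ) < d := by exact_mod_cast hd
  have h4 := Int.emod_nonneg (c0.bl - -B) hd'.ne'
  have h5 := Int.emod_lt_of_pos (c0.bl - -B) hd'
  have h6 := Int.emod_add_mul_ediv (c0.bl - -B) d
  set r := (c0.bl - -(B : ℤ)) % d
  set e := (c0.bl - -(B : ℤ)) / d
  have h7 : s = -B + r + (q + e) * d := by linear_combination hq - h6
  have h8 : 0 ≤ q + e := by
    by_contra! h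
    have : (q + e) * d ≤ -1 * d := mul_le_mul_of_nonneg_right (by omega) hd'.le
    omega
  have h9 : q + e ≤ 3 := by
    by_contra! h
    have : 4 * (d : ℤ) ≤ (q + e) * d := mul_le_mul_of_nonneg_right (by omega) hd'.le
    omega
  rw [Finset.mem_image]
  refine ⟨(q + e).toNat, by simp; omega, ?_⟩
  rw [h7, Int.toNat_of_nonneg h8]

end LinkColoring

namespace LinkColoring
open Diagram

/-! ### Colorings of diagrams and colored words -/

theorem strandsAfter_take_succ {w : List Layer} {m n t : ℕ} {l : Layer} (hw : IsTangle w m n)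
    (h : w[t]? = some l) : l.left + l.piece.dom ≤ strandsAfter (w.take t) m ∧
      strandsAfter (w.take (t + 1)) m =
        strandsAfter (w.take t) m - l.piece.dom + l.piece.cod := by
  induction w generalizing m t with
  | nil => simp at h
  | cons a w ih =>
    cases t with
    | zero =>
      simp only [List.getElem?_cons_zero, Option.some.injEq] at h
      subst h
      exact ⟨hw.1, rfl⟩
    | succ t => exact ih hw.2 (by simpa using h)

theorem strandsAfter_eq {w : List Layer} {m n : ℕ} (hw : IsTangle w m n) :
    strandsAfter w m = n := by
  induction w generalizing m with
  | nil => exact hw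
  | cons a w ih => exact ih hw.2

/-- The labels of the strands at the level `t` of a word with the labels `n` at the top. -/
def levelLabels {S : Type*} (w : List (Slice S)) (n : List S) (t : ℕ) : List S :=
  (w[t]?.map Slice.bot).getD n

theorem Chain.levelLabels_zero {S : Type*} {w : List (Slice S)} {m n : List S} (h : Chain w m n) :
    levelLabels w n 0 = m := by
  cases w with
  | nil => exact h.symm
  | cons s w => exact h.1

theorem Chain.levelLabels_eq {S : Type*} {w : List (Slice S)} {m n : List S} (h : Chain w m n)
    {t : ℕ} {s : Slice S} (hs : w[t]? = some s) :
    levelLabels w n t = s.bot ∧ levelLabels w n (t + 1) = s.top := by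
  refine ⟨by simp [levelLabels, hs], ?_⟩
  induction w generalizing m t with
  | nil => simp at hs
  | cons a w ih =>
    cases t with
    | zero =>
      simp only [List.getElem?_cons_zero, Option.some.injEq] at hs
      subst hs
      have := Chain.levelLabels_zero h.2
      simpa [levelLabels] using this
    | succ t =>
      have := ih h.2 (by simpa using hs)
      simpa [levelLabels] using this

theorem Chain.length_levelLabels {S : Type*} {w : List (Slice S)} {m n : List S} (h : Chain w m n)
    {t : ℕ} (ht : t ≤ w.length) :
    (levelLabels w n t).length = strandsAfter ((erase w).take t) m.length := by
  induction t with
  | zero => rw [h.levelLabels_zero]; rfl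
  | succ t ih =>
    have hs : w[t]? = some w[t] := List.getElem?_eq_getElem (by omega)
    have hl : (erase w)[t]? = some w[t].layer := by simp [erase, hs]
    obtain ⟨h1, h2⟩ := h.levelLabels_eq hs
    have ih := ih (by omega)
    obtain ⟨h3, h4⟩ := strandsAfter_take_succ h.isTangle hl
    rw [h4, ← ih, h1, h2]
    simp [Slice.bot, Slice.top, Slice.layer]
    omega

theorem getD_append_add {S : Type*} (a b : List S) (k : ℕ) (d : S) :
    (a ++ b).getD (a.length + k) d = b.getD k d := by
  rw [List.getD_eq_getElem?_getD, List.getD_eq_getElem?_getD,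
    List.getElem?_append_right (by omega), Nat.add_sub_cancel_left]

theorem toPiece_eq_cross {S : Type*} {p : LPiece S} {b : Bool} (h : p.toPiece = .cross b) :
    ∃ c, p = .cross c ∧ c.b = b := by
  cases p <;> simp_all [LPiece.toPiece]

theorem exists_coloring {w : List (Slice ℤ)} {D : Diagram} (hD : D.word = erase w)
    (hw : Chain w [] []) (hf : ∀ p ∈ crossings w, Fits p) :
    ∃ γ : D.Arc → ℤ, D.IsZColoring γ ∧ ∀ s, s ∈ Set.range γ ↔ Strand w s := by
  have hget : ∀ {t : ℕ} {l : Layer}, D.word[t]? = some l → ∃ s, w[t]? = some s ∧ s.layer = l := by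
    intro t l h
    rw [hD, erase, List.getElem?_map, Option.map_eq_some_iff] at h
    exact h
  have hwidth : ∀ t ≤ w.length, (levelLabels w [] t).length = D.width t := by
    intro t ht
    rw [hw.length_levelLabels ht, ← hD]
    rfl
  have hfit : ∀ {t : ℕ} {xs ys : List ℤ} {c : Crs ℤ},
      w[t]? = some ⟨xs, .cross c, ys⟩ → c = mkCrs c.b c.bl c.br := by
    intro t xs ys c hs
    refine fits_abs_iff.1 (hf c.abs (mem_crossings.2 ⟨c, mem_crs.2 ?_, rfl⟩))
    obtain ⟨u, v, h⟩ := List.append_of_mem (List.mem_of_getElem? hs)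
    exact ⟨u, _, _, v, h⟩
  -- By `hwidth` the default value 0 is never taken at a point of the diagram.
  let g : ℕ × ℕ → ℤ := fun x => (levelLabels w [] x.1).getD x.2 0
  have hg : ∀ x y, Joins D.word x y → g x = g y := by
    intro x y hxy
    simp only [g]
    cases hxy with
    | @left t p l h hp =>
      obtain ⟨s, hs, rfl⟩ := hget h
      obtain ⟨h1, h2⟩ := hw.levelLabels_eq hs
      simp only [h1, h2, Slice.bot, Slice.top]
      simp only [Slice.layer] at hp
      rw [List.getD_append _ _ _ _ hp, List.getD_append _ _ _ _ hp]
    | @right t l h k =>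
      obtain ⟨s, hs, rfl⟩ := hget h
      obtain ⟨h1, h2⟩ := hw.levelLabels_eq hs
      simp only [h1, h2, Slice.bot, Slice.top, Slice.layer, add_assoc, getD_append_add]
      rw [← LPiece.length_bot, ← LPiece.length_top, getD_append_add, getD_append_add]
    | @cup t i h =>
      obtain ⟨⟨xs, p, ys⟩, hs, hl⟩ := hget h
      obtain ⟨-, h2⟩ := hw.levelLabels_eq hs
      simp only [Slice.layer, Layer.mk.injEq] at hl
      obtain ⟨rfl, hp⟩ := hl
      have e := getD_append_add xs (p.top ++ ys) 0 0
      rw [add_zero] at e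
      simp only [h2, Slice.top, e, getD_append_add]
      cases p <;> simp_all [LPiece.toPiece]
    | @cap t i h =>
      obtain ⟨⟨xs, p, ys⟩, hs, hl⟩ := hget h
      obtain ⟨h2, -⟩ := hw.levelLabels_eq hs
      simp only [Slice.layer, Layer.mk.injEq] at hl
      obtain ⟨rfl, hp⟩ := hl
      have e := getD_append_add xs (p.bot ++ ys) 0 0
      rw [add_zero] at e
      simp only [h2, Slice.bot, e, getD_append_add]
      cases p <;> simp_all [LPiece.toPiece]
    | @overTrue t i h =>
      obtain ⟨⟨xs, p, ys⟩, hs, hl⟩ := hget h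
      obtain ⟨h1, h2⟩ := hw.levelLabels_eq hs
      simp only [Slice.layer, Layer.mk.injEq] at hl
      obtain ⟨rfl, hp⟩ := hl
      obtain ⟨c, rfl, hb⟩ := toPiece_eq_cross hp
      have e := getD_append_add xs ([c.bl, c.br] ++ ys) 0 0
      rw [add_zero] at e
      simp only [h1, h2, Slice.bot, Slice.top, LPiece.bot_cross, LPiece.top_cross, e,
        getD_append_add]
      have hc := hfit hs
      rw [hb] at hc
      simpa using (congrArg Crs.tr hc).symm
    | @overFalse t i h =>
      obtain ⟨⟨xs, p, ys⟩, hs, hl⟩ := hget h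
      obtain ⟨h1, h2⟩ := hw.levelLabels_eq hs
      simp only [Slice.layer, Layer.mk.injEq] at hl
      obtain ⟨rfl, hp⟩ := hl
      obtain ⟨c, rfl, hb⟩ := toPiece_eq_cross hp
      have e := getD_append_add xs ([c.tl, c.tr] ++ ys) 0 0
      rw [add_zero] at e
      simp only [h1, h2, Slice.bot, Slice.top, LPiece.bot_cross, LPiece.top_cross, e,
        getD_append_add]
      have hc := hfit hs
      rw [hb] at hc
      simpa using (congrArg Crs.tl hc).symm
  refine ⟨Quot.lift (fun x => g x.1) fun x y h => hg _ _ h, ?_, ?_⟩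
  · rintro ⟨x, hx⟩ ⟨y, hy⟩ ⟨z, hz⟩ hxyz
    change 2 * g x = g y + g z
    change IsCrossing D.word x y z at hxyz
    simp only [g]
    cases hxyz with
    | @crossTrue t i h =>
      obtain ⟨⟨xs, p, ys⟩, hs, hl⟩ := hget h
      obtain ⟨h1, h2⟩ := hw.levelLabels_eq hs
      simp only [Slice.layer, Layer.mk.injEq] at hl
      obtain ⟨rfl, hp⟩ := hl
      obtain ⟨c, rfl, hb⟩ := toPiece_eq_cross hp
      have e := getD_append_add xs ([c.bl, c.br] ++ ys) 0 0
      have e' := getD_append_add xs ([c.tl, c.tr] ++ ys) 0 0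
      rw [add_zero] at e e'
      simp only [h1, h2, Slice.bot, Slice.top, LPiece.bot_cross, LPiece.top_cross, e, e',
        getD_append_add]
      have hc := hfit hs
      rw [hb] at hc
      have := congrArg Crs.tl hc
      simp at this ⊢
      omega
    | @crossFalse t i h =>
      obtain ⟨⟨xs, p, ys⟩, hs, hl⟩ := hget h
      obtain ⟨h1, h2⟩ := hw.levelLabels_eq hs
      simp only [Slice.layer, Layer.mk.injEq] at hl
      obtain ⟨rfl, hp⟩ := hl
      obtain ⟨c, rfl, hb⟩ := toPiece_eq_cross hp
      have e := getD_append_add xs ([c.bl, c.br] ++ ys) 0 0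
      rw [add_zero] at e
      simp only [h1, h2, Slice.bot, Slice.top, LPiece.bot_cross, LPiece.top_cross, e,
        getD_append_add]
      have hc := hfit hs
      rw [hb] at hc
      have := congrArg Crs.tr hc
      simp at this ⊢
      omega
  · have hlen : D.word.length = w.length := by simp [hD, erase]
    have hpt : ∀ {t : ℕ} {s : ℤ}, t ≤ w.length → s ∈ levelLabels w [] t →
        s ∈ Set.range (Quot.lift (fun x : D.Point => g x.1) fun x y h => hg _ _ h) := by
      intro t s ht hs
      obtain ⟨p, hp, rfl⟩ := List.mem_iff_getElem.1 hs
      refine ⟨D.arc ⟨(t, p), by rw [hlen]; exact ht, by rw [← hwidth t ht]; exact hp⟩, ?_⟩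
      exact List.getD_eq_getElem _ _ hp
    intro s
    constructor
    · rintro ⟨a, rfl⟩
      induction a using Quot.inductionOn with
      | h x =>
        obtain ⟨⟨t, p⟩, ht, hp⟩ := x
        simp only at ht hp
        rw [hlen] at ht
        rw [← hwidth t ht] at hp
        have htl : t < w.length := by
          rcases ht.lt_or_eq with h | rfl
          · exact h
          · simp [levelLabels] at hp
        have hs : w[t]? = some w[t] := List.getElem?_eq_getElem htl
        refine ⟨w[t], List.getElem_mem htl, .inl ?_⟩
        rw [← (hw.levelLabels_eq hs).1]
        change (levelLabels w [] t).getD p 0 ∈ _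
        rw [List.getD_eq_getElem _ _ hp]
        exact List.getElem_mem hp
    · rintro ⟨q, hq, h⟩
      obtain ⟨t, ht, rfl⟩ := List.mem_iff_getElem.1 hq
      obtain ⟨h1, h2⟩ := hw.levelLabels_eq (List.getElem?_eq_getElem ht)
      rcases h with h | h
      · exact hpt ht.le (h1 ▸ h)
      · exact hpt (Nat.succ_le_of_lt ht) (h2 ▸ h)

theorem Colored.exists_diagram {L : Link} {w : List (Slice ℤ)} (hw : Colored L w) :
    ∃ D : Diagram, D.Represents L ∧ ∃ γ : D.Arc → ℤ, D.IsZColoring γ ∧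
      ∀ s, s ∈ Set.range γ ↔ Strand w s := by
  obtain ⟨w', h, hc, D, hD, hDL⟩ := hw.1.exists_diagram
  rcases h with rfl | rfl
  · obtain ⟨γ, h1, h2⟩ := exists_coloring hD hc hw.2
    exact ⟨D, hDL, γ, h1, h2⟩
  · obtain ⟨γ, h1, h2⟩ := exists_coloring hD hc hw.flip.2
    exact ⟨D, hDL, γ, h1, fun s => (h2 s).trans strand_flipSlices⟩

/-! ### Three colors are not enough -/

/-- The colors of a non-splittable diagram with two colors are not contained in a set of three
elements. -/
theorem Colored.three_lt_card {L : Link} (hL : ¬ L.IsSplittable) {w : List (Slice ℤ)}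
    (hw : Colored L w) {s t : ℤ} (hs : Strand w s) (ht : Strand w t) (hst : s ≠ t)
    {S : Finset ℤ} (hS : ∀ s, Strand w s → s ∈ S) : 3 < S.card := by
  by_contra! hcard
  have hport : ∀ c ∈ crs w, c.bl ∈ S ∧ c.br ∈ S ∧ c.tl ∈ S ∧ c.tr ∈ S := by
    intro c hc
    have h := fun s h => hS s (strand_of_mem_ports (mem_crossings.2 ⟨c, hc, rfl⟩) h)
    simp only [mem_ports_abs, forall_eq_or_imp, forall_eq] at h
    exact h
  have hfit : ∀ c ∈ crs w, c = mkCrs c.b c.bl c.br := fun c hc =>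
    fits_abs_iff.1 (hw.2 _ (mem_crossings.2 ⟨c, hc, rfl⟩))
  by_cases hd : ∃ c ∈ crs w, c.bl ≠ c.br
  · obtain ⟨c, hc, hne⟩ := hd
    -- Here m is the over color of a crossing with distinct colors; the under colors are symmetric
    -- about it.
    obtain ⟨m, d, hd, h1, h2, h3⟩ : ∃ m d : ℤ, d ≠ 0 ∧ Strand w m ∧ Strand w (m + d) ∧
        Strand w (m - d) := by
      have h := hfit c hc
      have hp := fun s h => strand_of_mem_ports (mem_crossings.2 ⟨c, hc, rfl⟩) (s := s) h
      simp only [mem_ports_abs, forall_eq_or_imp, forall_eq] at hp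
      obtain ⟨p1, p2, p3, p4⟩ := hp
      obtain ⟨b, x, y, z, u⟩ := c
      dsimp only at *
      cases b <;> simp only [mkCrs] at h
      · refine ⟨y, x - y, by omega, p2, by convert p1 using 1; omega,
          by convert p4 using 1; simp at h; omega⟩
      · refine ⟨x, y - x, by omega, p1, by convert p2 using 1; omega,
          by convert p3 using 1; simp at h; omega⟩
    have hSe : S = {m, m + d, m - d} := by
      symm
      refine Finset.eq_of_subset_of_card_le ?_ ?_
      · simp [Finset.insert_subset_iff, hS _ h1, hS _ h2, hS _ h3]
      · rw [Finset.card_eq_three.2 ⟨m, m + d, m - d, by omega, by omega, by omega, rfl⟩]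
        exact hcard
    -- Among m - d, m and m + d, only m is the average of two other colors. So at a crossing with
    -- distinct colors the over strand has color m and the under ends do not.
    have hA : ∀ c ∈ crs w, c.Splits (· = m) := by
      intro c hc
      have h := hfit c hc
      have hp := hport c hc
      simp only [hSe, Finset.mem_insert, Finset.mem_singleton] at hp
      obtain ⟨b, x, y, z, u⟩ := c
      unfold Crs.Splits
      cases b <;> simp [mkCrs] at * <;> omega
    rcases hw.1.all_or_none hL _ hA with h | h
    · exact hd (by simpa using h _ h2)
    · exact h _ h1 rfl
  · push Not at hd
    -- Every crossing has a single color, so every color class splits.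
    have hA : ∀ c ∈ crs w, c.Splits (· = s) := by
      intro c hc
      have h := hfit c hc
      have h2 := hd c hc
      obtain ⟨b, x, y, z, u⟩ := c
      unfold Crs.Splits
      cases b <;> simp [mkCrs] at * <;> omega
    rcases hw.1.all_or_none hL _ hA with h | h
    · exact hst (h t ht).symm
    · exact h s hs rfl

/-! ### The word of a colored diagram -/

section ToSlices

variable (col : ℕ → ℕ → ℤ)

/-- The labels of the `n` strands starting with number `k` at level `t`. -/
def row (t k n : ℕ) : List ℤ := (List.range n).map fun i => col t (k + i)

/-- The labelled slice of a layer at level `t` with `n` strands below it. -/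
def toSlice (t n : ℕ) (l : Layer) : Slice ℤ :=
  ⟨row col t 0 l.left,
    match l.piece with
    | .cup => .cup (col (t + 1) l.left)
    | .cap => .cap (col t l.left)
    | .cross b => .cross ⟨b, col t l.left, col t (l.left + 1), col (t + 1) l.left,
        col (t + 1) (l.left + 1)⟩,
    row col t (l.left + l.piece.dom) (n - l.left - l.piece.dom)⟩

/-- The labelled word of a word of layers on `n` strands. -/
def toSlices : ℕ → ℕ → List Layer → List (Slice ℤ)
  | _, _, [] => []
  | t, n, l :: w => toSlice col t n l :: toSlices (t + 1) (n - l.piece.dom + l.piece.cod) w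

theorem row_add (t k m n : ℕ) : row col t k (m + n) = row col t k m ++ row col t (k + m) n := by
  simp [row, List.range_add, Function.comp_def, add_assoc]

@[simp] theorem row_two (t k : ℕ) : row col t k 2 = [col t k, col t (k + 1)] := rfl
@[simp] theorem row_zero (t k : ℕ) : row col t k 0 = [] := rfl

variable {col}

@[simp] theorem layer_toSlice (t n : ℕ) (l : Layer) : (toSlice col t n l).layer = l := by
  obtain ⟨i, g | g | b⟩ := l <;> simp [toSlice, Slice.layer, row, LPiece.toPiece]

theorem erase_toSlices (t n : ℕ) (w : List Layer) : erase (toSlices col t n w) = w := by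
  induction w generalizing t n with
  | nil => rfl
  | cons l w ih => simp [toSlices, ih]

theorem bot_toSlice {t n : ℕ} {l : Layer} (hn : l.left + l.piece.dom ≤ n)
    (h : ∀ i, l.piece = .cap → l.left = i → col t i = col t (i + 1)) :
    (toSlice col t n l).bot = row col t 0 n := by
  obtain ⟨k, rfl⟩ := Nat.exists_eq_add_of_le hn
  rw [row_add, row_add, List.append_assoc]
  obtain ⟨i, g | g | b⟩ := l <;>
    simp [toSlice, Slice.bot, LPiece.bot, Nat.sub_sub]
  exact h i rfl rfl

theorem top_toSlice {t n : ℕ} {l : Layer} (hn : l.left + l.piece.dom ≤ n)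
    (h : l.piece = .cup → col (t + 1) l.left = col (t + 1) (l.left + 1))
    (hl : ∀ p < l.left, col t p = col (t + 1) p)
    (hr : ∀ k, l.left + l.piece.dom + k < n →
      col t (l.left + l.piece.dom + k) = col (t + 1) (l.left + l.piece.cod + k)) :
    (toSlice col t n l).top = row col (t + 1) 0 (n - l.piece.dom + l.piece.cod) := by
  obtain ⟨k, rfl⟩ := Nat.exists_eq_add_of_le hn
  have e1 : row col t 0 l.left = row col (t + 1) 0 l.left :=
    List.map_congr_left fun p hp => by simpa using hl p (by simpa using hp)
  have e2 : row col t (l.left + l.piece.dom) k = row col (t + 1) (l.left + l.piece.cod) k :=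
    List.map_congr_left fun p hp => hr p (by simpa using hp)
  rw [show l.left + l.piece.dom + k - l.piece.dom + l.piece.cod = l.left + l.piece.cod + k by omega,
    row_add, row_add, List.append_assoc, Nat.zero_add, Nat.zero_add, ← e1, ← e2]
  obtain ⟨i, g | g | b⟩ := l <;>
    simp [toSlice, Slice.top, LPiece.top, Nat.sub_sub]
  exact h rfl

theorem getElem?_toSlices (t n : ℕ) (w : List Layer) (k : ℕ) :
    (toSlices col t n w)[k]? = w[k]?.map (toSlice col (t + k) (strandsAfter (w.take k) n)) := by
  induction w generalizing t n k with
  | nil => simp [toSlices]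
  | cons l w ih =>
    cases k with
    | zero => simp [toSlices, strandsAfter]
    | succ k => simp [toSlices, ih, strandsAfter, show t + 1 + k = t + (k + 1) by omega]

theorem chain_of_levels {S : Type*} {w : List (Slice S)} {f : ℕ → List S}
    (h : ∀ t s, w[t]? = some s → s.bot = f t ∧ s.top = f (t + 1)) :
    Chain w (f 0) (f w.length) := by
  induction w generalizing f with
  | nil => rfl
  | cons s w ih =>
    have h0 := h 0 s rfl
    refine ⟨h0.1, ?_⟩
    rw [h0.2]
    exact ih (f := fun t => f (t + 1)) fun t s hs => h (t + 1) s (by simpa using hs)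

end ToSlices

/-- The labels of the slices are read off from γ level by level. The value 0 of `col` outside the
diagram plays no role, since all positions used are checked to be points of it. -/
theorem exists_colored {D : Diagram} {L : Link} (hD : D.Represents L) {γ : D.Arc → ℤ}
    (hγ : D.IsZColoring γ) : ∃ w : List (Slice ℤ), Colored L w ∧
      ∀ s, Strand w s ↔ s ∈ Set.range γ := by
  classical
  let col : ℕ → ℕ → ℤ := fun t p =>
    if h : t ≤ D.word.length ∧ p < D.width t then γ (D.arc ⟨(t, p), h⟩) else 0
  have hcol : ∀ {t p : ℕ} (h : t ≤ D.word.length ∧ p < D.width t),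
      col t p = γ (D.arc ⟨(t, p), h⟩) := fun h => dif_pos h
  have hstep : ∀ {t : ℕ} {l : Layer}, D.word[t]? = some l → t < D.word.length ∧
      l.left + l.piece.dom ≤ D.width t ∧
      D.width (t + 1) = D.width t - l.piece.dom + l.piece.cod := by
    intro t l h
    exact ⟨(List.getElem?_eq_some_iff.1 h).1, strandsAfter_take_succ D.closed h⟩
  have hjoin : ∀ {t p t' p' : ℕ}, Joins D.word (t, p) (t', p') →
      (t ≤ D.word.length ∧ p < D.width t) → (t' ≤ D.word.length ∧ p' < D.width t') →
      col t p = col t' p' := by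
    intro t p t' p' h hv hv'
    rw [hcol hv, hcol hv']
    exact congrArg γ (Quot.sound h)
  have hcross : ∀ {t p t' p' t'' p'' : ℕ}, IsCrossing D.word (t, p) (t', p') (t'', p'') →
      (t ≤ D.word.length ∧ p < D.width t) → (t' ≤ D.word.length ∧ p' < D.width t') →
      (t'' ≤ D.word.length ∧ p'' < D.width t'') →
      2 * col t p = col t' p' + col t'' p'' := by
    intro t p t' p' t'' p'' h hv hv' hv''
    rw [hcol hv, hcol hv', hcol hv'']
    exact hγ _ _ _ h
  let w := toSlices col 0 0 D.word
  have hlen : w.length = D.word.length := by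
    have := congrArg List.length (erase_toSlices (col := col) 0 0 D.word)
    simpa [erase] using this
  have hget : ∀ {t : ℕ} {s : Slice ℤ}, w[t]? = some s →
      ∃ l, D.word[t]? = some l ∧ s = toSlice col t (D.width t) l := by
    intro t s h
    rw [getElem?_toSlices, Option.map_eq_some_iff] at h
    obtain ⟨l, h1, h2⟩ := h
    exact ⟨l, h1, by rw [← h2, Nat.zero_add]; rfl⟩
  have hlev : ∀ t s, w[t]? = some s →
      s.bot = row col t 0 (D.width t) ∧ s.top = row col (t + 1) 0 (D.width (t + 1)) := by
    intro t s h
    obtain ⟨l, hl, rfl⟩ := hget h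
    obtain ⟨h1, h2, h3⟩ := hstep hl
    refine ⟨bot_toSlice h2 ?_, ?_⟩
    · intro i hc hi
      obtain ⟨j, q⟩ := l
      dsimp only at *
      subst hc hi
      simp only [Piece.dom_cap] at h2
      exact hjoin (.cap hl) ⟨by omega, by omega⟩ ⟨by omega, by omega⟩
    · rw [h3]
      refine top_toSlice h2 ?_ ?_ ?_
      · intro hc
        obtain ⟨j, q⟩ := l
        dsimp only at *
        subst hc
        simp only [Piece.dom_cup, Piece.cod_cup] at h2 h3
        exact hjoin (.cup hl) ⟨by omega, by omega⟩ ⟨by omega, by omega⟩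
      · exact fun p hp => hjoin (.left hl hp) ⟨by omega, by omega⟩ ⟨by omega, by omega⟩
      · exact fun k hk => hjoin (.right hl k) ⟨by omega, by omega⟩ ⟨by omega, by omega⟩
  -- There are no points at the top level, so the word closes up and every point of the diagram is
  -- on the lower side of some slice.
  have hend : D.width D.word.length = 0 := by
    rw [Diagram.width, List.take_length]
    exact strandsAfter_eq D.closed
  have hchain : Chain w [] [] := by
    have h := chain_of_levels (f := fun t => row col t 0 (D.width t)) hlev
    rw [hlen, hend] at h
    exact h
  refine ⟨w, ⟨⟨hchain, D, hD, .inl (.of_eq (erase_toSlices _ _ _).symm)⟩, ?_⟩, ?_⟩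
  · intro p hp
    obtain ⟨c, hc, rfl⟩ := mem_crossings.1 hp
    obtain ⟨u, x, y, v, hw⟩ := mem_crs.1 hc
    have hs : w[u.length]? = some ⟨x, .cross c, y⟩ := by simp [hw]
    obtain ⟨⟨i, q⟩, hl, e⟩ := hget hs
    obtain ⟨h1, h2, h3⟩ := hstep hl
    rcases q with _ | _ | b <;> simp only [toSlice, Slice.mk.injEq, reduceCtorEq, false_and,
      and_false, LPiece.cross.injEq] at e
    obtain ⟨-, rfl, -⟩ := e
    simp only [Piece.dom_cross, Piece.cod_cross] at h2 h3
    rw [fits_abs]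
    cases b
    · refine ⟨nofun, fun _ => ?_⟩
      have e1 := hcross (.crossFalse hl) ⟨by omega, by omega⟩ ⟨by omega, by omega⟩
        ⟨by omega, by omega⟩
      have e2 := hjoin (.overFalse hl) ⟨by omega, by omega⟩ ⟨by omega, by omega⟩
      dsimp only
      omega
    · refine ⟨fun _ => ?_, nofun⟩
      have e1 := hcross (.crossTrue hl) ⟨by omega, by omega⟩ ⟨by omega, by omega⟩
        ⟨by omega, by omega⟩
      have e2 := hjoin (.overTrue hl) ⟨by omega, by omega⟩ ⟨by omega, by omega⟩
      dsimp only
      omega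
  · have hmem : ∀ {t : ℕ} {s : ℤ}, t ≤ D.word.length → s ∈ row col t 0 (D.width t) →
        s ∈ Set.range γ := by
      intro t s ht h
      simp only [row, List.mem_map, List.mem_range, Nat.zero_add] at h
      obtain ⟨p, hp, rfl⟩ := h
      exact ⟨_, (hcol ⟨ht, hp⟩).symm⟩
    intro s
    constructor
    · rintro ⟨q, hq, h⟩
      obtain ⟨t, ht, rfl⟩ := List.mem_iff_getElem.1 hq
      obtain ⟨h1, h2⟩ := hlev t _ (List.getElem?_eq_getElem ht)
      rcases h with h | h
      · exact hmem (by omega) (h1 ▸ h)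
      · exact hmem (by omega) (h2 ▸ h)
    · rintro ⟨a, rfl⟩
      induction a using Quot.inductionOn with
      | h x =>
        obtain ⟨⟨t, p⟩, hv⟩ := x
        have htl : t < w.length := by
          rw [hlen]
          rcases hv.1.lt_or_eq with h | rfl
          · exact h
          · have := hv.2
            simp only at this
            omega
        refine ⟨w[t], List.getElem_mem htl, .inl ?_⟩
        rw [(hlev t _ (List.getElem?_eq_getElem htl)).1, row, List.mem_map]
        exact ⟨p, by simpa using hv.2, by rw [Nat.zero_add]; exact hcol hv⟩

/-! ### The two bounds for the number of colors -/

theorem finite_strands {S : Type*} (w : List (Slice S)) : {s | Strand w s}.Finite := by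
  refine ((w.flatMap fun t => t.bot ++ t.top).finite_toSet).subset fun s hs => ?_
  obtain ⟨t, ht, h⟩ := hs
  exact List.mem_flatMap.2 ⟨t, ht, by simpa using h⟩

theorem four_le_of_mem_colorNumbers {L : Link} (hL : ¬ L.IsSplittable) {k : ℕ}
    (hk : k ∈ L.colorNumbers) : 4 ≤ k := by
  obtain ⟨D, hD, γ, hγ, hn, rfl⟩ := hk
  obtain ⟨w, hw, hs⟩ := exists_colored hD hγ
  have hset : {s | Strand w s} = Set.range γ := Set.ext hs
  have hfin : (Set.range γ).Finite := hset ▸ finite_strands w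
  unfold Diagram.IsTrivial at hn
  push Not at hn
  obtain ⟨a, b, hab⟩ := hn
  rw [Set.ncard_eq_toFinset_card _ hfin]
  exact hw.three_lt_card hL ((hs _).2 ⟨a, rfl⟩) ((hs _).2 ⟨b, rfl⟩) hab
    fun s h => hfin.mem_toFinset.2 ((hs s).1 h)

/-- If all differences were 0, the strands of one color would never meet the others at a crossing
and would split off. -/
theorem Colored.exists_dif_pos {L : Link} (hL : ¬ L.IsSplittable) {w : List (Slice ℤ)}
    (hw : Colored L w) {s t : ℤ} (hs : Strand w s) (ht : Strand w t) (hst : s ≠ t) :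
    ∃ p ∈ crossings w, 0 < dif p := by
  by_contra! h
  have hA : ∀ c ∈ crs w, c.Splits (· = s) := by
    intro c hc
    have hd := h _ (mem_crossings.2 ⟨c, hc, rfl⟩)
    rw [dif_abs] at hd
    unfold Crs.Splits
    omega
  rcases hw.1.all_or_none hL _ hA with h1 | h1
  · exact hst (h1 t ht).symm
  · exact h1 s hs rfl

/-- The reduction gives a coloring with at most four colors, still non-trivial because a non-zero
difference survives; the lower bound makes the number exactly four. -/
theorem exists_four_colors {L : Link} (hL : ¬ L.IsSplittable) {D : Diagram} (hD : D.Represents L)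
    {γ : D.Arc → ℤ} (hγ : D.IsZColoring γ) (hn : ¬ D.IsTrivial γ) : 4 ∈ L.colorNumbers := by
  obtain ⟨w, hw, hs⟩ := exists_colored hD hγ
  unfold Diagram.IsTrivial at hn
  push Not at hn
  obtain ⟨a, b, hab⟩ := hn
  obtain ⟨w', hw', ⟨p, hp, hpos⟩, S, hcard, hS⟩ := hw.exists_four hL
    (hw.exists_dif_pos hL ((hs _).2 ⟨a, rfl⟩) ((hs _).2 ⟨b, rfl⟩) hab)
  obtain ⟨E, hE, δ, hδ, hs'⟩ := hw'.exists_diagram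
  have hnt : ¬ E.IsTrivial δ := by
    intro ht
    obtain ⟨c, hc, rfl⟩ := mem_crossings.1 hp
    have hst : ∀ s ∈ ports c.abs, s ∈ Set.range δ := fun s h =>
      (hs' s).2 (strand_of_mem_ports hp h)
    simp only [mem_ports_abs, forall_eq_or_imp, forall_eq] at hst
    obtain ⟨⟨a1, h1⟩, ⟨a2, h2⟩, ⟨a3, h3⟩, ⟨a4, h4⟩⟩ := hst
    have e2 := ht a1 a2
    have e3 := ht a1 a3
    have e4 := ht a1 a4
    rw [dif_abs] at hpos
    omega
  have hmem : (Set.range δ).ncard ∈ L.colorNumbers := ⟨E, hE, δ, hδ, hnt, rfl⟩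
  have hle : (Set.range δ).ncard ≤ S.card := by
    rw [← Set.ncard_coe_finset]
    exact Set.ncard_le_ncard (fun s h => hS s ((hs' s).1 h)) S.finite_toSet
  have hge := four_le_of_mem_colorNumbers hL hmem
  rwa [show (Set.range δ).ncard = 4 by omega] at hmem

end LinkColoring

theorem theorem5p3 (L : LinkColoring.Link) (hL : ¬ L.IsSplittable)
    (h5 : ∃ D : LinkColoring.Diagram, D.Represents L ∧
      ∃ γ : D.Arc → ℤ, D.IsZColoring γ ∧ (Set.range γ).ncard = 5) :
    L.mincol = 4 := by
  obtain ⟨D, hD, γ, hγ, hcard⟩ := h5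
  have hn : ¬ D.IsTrivial γ := by
    intro ht
    have : (Set.range γ).Subsingleton := by
      rintro _ ⟨a, rfl⟩ _ ⟨b, rfl⟩
      exact ht a b
    have := (Set.ncard_le_one this.finite).2 fun a ha b hb => this ha hb
    omega
  have h4 := LinkColoring.exists_four_colors hL hD hγ hn
  exact le_antisymm (Nat.sInf_le h4)
    (le_csInf ⟨4, h4⟩ fun k hk => LinkColoring.four_le_of_mem_colorNumbers hL hk)
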